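/- **Setting.** Let $\mathfrak h$ be a finite-dimensional complex vector space with a non-degenerate symmetric bilinear form $(\cdot|\cdot)$, used to identify $\mathfrak h$ with $\mathfrak h^*$; write $|x|^2=(x|x)$ and $\gamma^\vee=2\gamma/(\gamma|\gamma)$. Let $\hat{\mathfrak h}^*=\mathfrak h\oplus\mathbb C\Lambda_0\oplus\mathbb C\delta$ with $(\Lambda_0|\delta)=1$, $(\Lambda_0|\Lambda_0)=(\delta|\delta)=0$ and $\Lambda_0,\delta\perp\mathfrak h$. For $\lambda=\bar\lambda+k\Lambda_0+a\delta$ the level is $\lambda(K)=k$, and $e^\lambda(\tau,z,t)=e^{2\pi i((\bar\lambda|z)+kt-a\tau)}$ for $\operatorname{Im}\tau>0$, $z\in\mathfrak h$, $t\in\mathbb C$; put $q=e^{2\pi i\tau}=e^{-\delta}$. For $\gamma\in\mathfrak h$ let $t_\gamma(\lambda)=\lambda+\lambda(K)\gamma-((\bar\lambda|\gamma)+\tfrac12\lambda(K)|\gamma|^2)\delta$. Let $L\subset\mathfrak h$ be a lattice with $\mathbb Z$-basis $\gamma_1,\dots,\gamma_m$ on which the form is real and positive definite, and let $T=\{\beta_1,\dots,\beta_n\}\subset\mathfrak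 h$, $n\le m$, $(\beta_i|\beta_j)=0$ for all $i,j$, with $$(\gamma_i|\beta_j)=-\delta_{ij}\ (1\le i\le m,\ 1\le j\le n),\qquad(\gamma_i^\vee|\gamma_j)\in\mathbb Z\ (1\le i\le n,\ i\le j\le m),\qquad\dim\mathfrak h=m+n.$$ Let $k>0$ be real with $k(L|L)\subset\mathbb Z$ and $k|\gamma|^2\in2\mathbb Z$ for all $\gamma\in L$. Let $P_{k,T}$ be the set of $\lambda\in\hat{\mathfrak h}^*$ of level $k$ with $(\bar\lambda|L)\subset\mathbb Z$ and $(\bar\lambda|T)=0$. For $0\le s\le n$ put $$L_s=\mathbb Z\{\gamma_i+\textstyle\sum_{p=1}^s(\gamma_i|\gamma_p)\beta_p: s<i\le m\},\quad T_s=\{\beta_{s+1},\dots,\beta_n\},\quad\lambda_s=\lambda+\textstyle\sum_{i=1}^s(\lambda|\gamma_i)\beta_i,$$ $M=L_n$, $M^\perp=\{h\in\mathfrak h:(h|M)=0\}$, $M^*=\{h\in\mathbb CM:(h|M)\subset\mathbb Z\}$, and let $z^{(1)}$ be the orthogonal projection of $z$ to $\mathbb CM$. **Rank one functions.** For $r\in\mathbb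 Z_{>0}$ and $s,j\in\mathbb Z$ let $$\Phi^{[r;s]}(\tau,z_1,z_2)=\sum_{a\in\mathbb Z}\frac{e^{2\pi i ra(z_1+z_2)+2\pi isz_1}q^{ra^2+sa}}{1-e^{2\pi iz_1}q^a},\qquad\Theta_{j,r}(\tau,z)=\sum_{a\in\mathbb Z}e^{2\pi irz(a+\frac j{2r})}q^{r(a+\frac j{2r})^2},$$ $$R_{j,r}(\tau,z)=\sum_{a\equiv j\,(2r)}\Big\{\operatorname{sign}(a-\tfrac12-j+2r)-E\Big(\big(a-2r\tfrac{\operatorname{Im}z}{\operatorname{Im}\tau}\big)\sqrt{\tfrac{\operatorname{Im}\tau}{r}}\Big)\Big\}e^{-\frac{\pi ia^2}{2r}\tau+2\pi iaz},\quad E(x)=2\int_0^xe^{-\pi u^2}du,$$ $\Phi^{[r;s]}_{\mathrm{add}}(\tau,z_1,z_2)=\sum_{s\le j<s+2r}R_{j,r}(\tau,\tfrac{z_1-z_2}2)\,\Theta_{j,r}(\tau,z_1+z_2)$ and $\tilde\Phi^{[r;s]}=\Phi^{[r;s]}-\tfrac12\Phi^{[r;s]}_{\mathrm{add}}$. **Modified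 mock theta functions.** For a lattice $Q\subset\mathfrak h$, a finite set $S\subset\mathfrak h$ and $\lambda$ of level $k$, let $$\Theta^Q_{\lambda,S}=q^{\frac{|\lambda|^2}{2k}}\sum_{\gamma\in Q}t_\gamma\frac{e^\lambda}{\prod_{\beta\in S}(1-e^{-\beta})},\qquad\Theta^Q_\lambda=\Theta^Q_{\lambda,\emptyset},$$ where $t_\gamma e^\mu=e^{t_\gamma(\mu)}$. Let $\lambda\in P_{k,T}$. For $1\le p\le n$ put $\tilde\gamma_p=\gamma_p+\sum_{i<p}(\gamma_p|\gamma_i)\beta_i$, $N_p=\mathbb Z\{\gamma_i+\sum_{j<p}(\gamma_i|\gamma_j)\beta_j:p<i\le m\}$ (so that $L_{p-1}=\mathbb Z\tilde\gamma_p\oplus N_p$), $r_p=\tfrac k2|\gamma_p|^2\in\mathbb Z_{>0}$ and $s_p=(\lambda|\gamma_p)\in\mathbb Z$. Here, by summing over $\mathbb Z\tilde\gamma_p$, $$\Theta^{L_{p-1}}_{\lambda_{p-1},T_{p-1}}=q^{\frac{|\lambda_p|^2}{2k}}\sum_{\gamma\in N_p}\Big(t_\gamma\frac{e^{\lambda_p}}{\prod_{\beta\in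 T_p}(1-e^{-\beta})}\Big)\,\Phi^{[r_p;s_p]}\big(\tau,-\beta_p,\beta_p+\tilde\gamma_p^\vee+\tau(\gamma|\tilde\gamma_p^\vee)\big),$$ where $\beta_p,\tilde\gamma_p^\vee$ in the arguments stand for $(\beta_p|z),(\tilde\gamma_p^\vee|z)$. The $p$-th modification step replaces $\Phi^{[r_p;s_p]}$ by $\tilde\Phi^{[r_p;s_p]}$ in this formula, that is, it subtracts from $\Theta^{L_{p-1}}_{\lambda_{p-1},T_{p-1}}$ one half of the same sum with $\Phi^{[r_p;s_p]}_{\mathrm{add}}$ in place of $\Phi^{[r_p;s_p]}$. Let $\tilde\Theta^{0;L}_{\lambda,T}=\Theta^L_{\lambda,T}$, and for $1\le p\le n$ let $\tilde\Theta^{p;L}_{\lambda,T}$ be the product of the result of the $p$-th step and of $\prod_{i<p}\tilde\Phi^{[r_i;s_i]}(\tau,-\beta_i,\beta_i+\tilde\gamma_i^\vee)$. The modified mock theta function is $\tilde\Theta^L_{\lambda,T}=\tilde\Theta^{n;L}_{\lambda,T}$. **Proposition 3.2.** The set $P_{k,T}$ consists of finitely many classes modulo $kM+M^\perp+\mathbb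 C\delta$. Let $\lambda\in P_{k,T}$, $\operatorname{Im}\tau>0$, $t\in\mathbb C$, and let $z\in\mathfrak h$ be off the poles, i.e. $(\beta_p|z)\notin\mathbb Z+\mathbb Z\tau$ for all $p$. Then: (a) The projection $z^{(1)}$ exists and is unique, and for all integers $s'_1,\dots,s'_n$ (so that $\tilde\Phi^{[r]}:=\tilde\Phi^{[r;s]}$ may be written for the factors) $$\tilde\Theta^L_{\lambda,T}(\tau,z,t)=\Theta^M_{\lambda_n}(\tau,z^{(1)},t)\prod_{p=1}^n\tilde\Phi^{[\frac k2|\gamma_p|^2;\,s'_p]}\Big(\tau,-(\beta_p|z),(\beta_p|z)+(\gamma_p^\vee|z)+\sum_{i=1}^{p-1}(\gamma_p^\vee|\gamma_i)(\beta_i|z)\Big).$$ (b) With the principal branch of powers, and for every choice of representatives of the classes, $$\tilde\Theta^L_{\lambda,T}\Big(-\frac1\tau,\frac z\tau,t-\frac{|z|^2}{2\tau}\Big)=i^n(-i\tau)^{\frac{\dim\mathfrak h}2}|M^*/kM|^{-\frac12}\sum_{\mu\in P_{k,T}\bmod(kM+M^\perp+\mathbb C\delta)}e^{-\frac{2\pi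 i}k(\bar\lambda|\bar\mu)}\tilde\Theta^L_{\mu,T}(\tau,z,t),$$ $$\tilde\Theta^L_{\lambda,T}(\tau+1,z,t)=e^{\frac{\pi i}k|\bar\lambda|^2}\,\tilde\Theta^L_{\lambda,T}(\tau,z,t).$$ -/

import Mathlib

namespace MockTheta

noncomputable section

open Complex

/-! ## Rank one functions -/

/-- `q ^ x` with `q = exp (2 π i τ)`. -/
def qpow (τ x : ℂ) : ℂ := cexp (2 * Real.pi * I * τ * x)

/-- The rank one Jacobi form `Θ_{j,m}(τ, z)`. -/
def jacobiForm (m : ℕ) (j : ℤ) (τ z : ℂ) : ℂ :=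
  ∑' n : ℤ, cexp (2 * Real.pi * I * m * z * (n + j / (2 * m)))
    * qpow τ (m * (n + j / (2 * m)) ^ 2)

/-- The rank one mock theta function `Φ^{[m;s]}(τ, z₁, z₂)`.
Its poles are the points with `z₁ ∈ ℤ + ℤ τ`. -/
def Phi (m : ℕ) (s : ℤ) (τ z₁ z₂ : ℂ) : ℂ :=
  ∑' n : ℤ, cexp (2 * Real.pi * I * m * n * (z₁ + z₂) + 2 * Real.pi * I * s * z₁)
    * qpow τ (m * n ^ 2 + s * n) / (1 - cexp (2 * Real.pi * I * z₁) * qpow τ n)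

/-- `E(x) = 2 ∫₀ˣ exp (-π u²) du`. -/
def errE (x : ℝ) : ℝ := 2 * ∫ u in (0 : ℝ)..x, Real.exp (-Real.pi * u ^ 2)

/-- `ψ_{m,n}(τ, z) = (n - 2 m Im z / Im τ) √(Im τ / m)`. -/
def psi (m : ℕ) (n : ℤ) (τ z : ℂ) : ℝ :=
  (n - 2 * m * (z.im / τ.im)) * Real.sqrt (τ.im / m)

/-- The summand of `R_{j,m}(τ, z)` with index `n`. -/
def RTerm (m : ℕ) (j n : ℤ) (τ z : ℂ) : ℂ :=
  ((Real.sign ((n : ℝ) - 1 / 2 - j + 2 * m) - errE (psi m n τ z) : ℝ) : ℂ)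
    * cexp (-(Real.pi * I * n ^ 2 / (2 * m)) * τ + 2 * Real.pi * I * n * z)

/-- The real analytic function `R_{j,m}(τ, z)`. The sum is over the integers congruent to `j`
modulo `2 m`, written as `j + 2 m l` with `l ∈ ℤ`. -/
def RFun (m : ℕ) (j : ℤ) (τ z : ℂ) : ℂ :=
  ∑' l : ℤ, RTerm m j (j + 2 * m * l) τ z

/-- Zwegers' modifier `Φ_add^{[m;s]}`. -/
def PhiAdd (m : ℕ) (s : ℤ) (τ z₁ z₂ : ℂ) : ℂ :=
  ∑ j ∈ Finset.Ico s (s + 2 * m), RFun m j τ ((z₁ - z₂) / 2) * jacobiForm m j τ (z₁ + z₂)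

/-- The modified mock theta function `Φ̃^{[m;s]} = Φ^{[m;s]} - ½ Φ_add^{[m;s]}`. -/
def PhiMod (m : ℕ) (s : ℤ) (τ z₁ z₂ : ℂ) : ℂ :=
  Phi m s τ z₁ z₂ - 1 / 2 * PhiAdd m s τ z₁ z₂

/-! ## Affine weights and mock theta functions attached to a lattice -/

section Affine

variable {H : Type*} [AddCommGroup H] [Module ℂ H]

/-- The affine dual space `𝔥* ⊕ ℂ Λ₀ ⊕ ℂ δ`, where `𝔥*` is identified with `𝔥 = H` by the bilinear
form. The triple `(x, k, a)` stands for `x + k Λ₀ + a δ`. -/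
abbrev AffDual (H : Type*) := H × ℂ × ℂ

/-- An element of `𝔥* = 𝔥`, as an affine weight. -/
def ofFin (x : H) : AffDual H := (x, 0, 0)

/-- The level `λ(K) = (λ | δ)`. -/
def level (l : AffDual H) : ℂ := l.2.1

/-- The invariant form on the affine dual: `(Λ₀ | δ) = 1`, and `Λ₀`, `δ` are isotropic and
orthogonal to `𝔥*`. -/
def affForm (B : LinearMap.BilinForm ℂ H) (l l' : AffDual H) : ℂ :=
  B l.1 l'.1 + l.2.1 * l'.2.2 + l.2.2 * l'.2.1

/-- The translation `t_γ(λ) = λ + λ(K) γ - (λ(γ) + ½ λ(K) |γ|²) δ`. -/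
def translate (B : LinearMap.BilinForm ℂ H) (g : H) (l : AffDual H) : AffDual H :=
  l + level l • ofFin g - ((0, 0, B l.1 g + 1 / 2 * level l * B g g) : AffDual H)

/-- The function `e^λ` at the point `2 π i (z + t K - τ d)`. For `λ = x + k Λ₀ + a δ` one has
`λ(z) = (x | z)`, `λ(K) = k` and `λ(d) = a`. -/
def expWt (B : LinearMap.BilinForm ℂ H) (l : AffDual H) (τ : ℂ) (z : H) (t : ℂ) : ℂ :=
  cexp (2 * Real.pi * I * (B l.1 z + t * l.2.1 - τ * l.2.2))

/-- The value at `2 π i (z + t K - τ d)` of `t_γ (e^λ / ∏_{p ∈ S} (1 - e^{-β_p}))`. -/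
def mockTerm (B : LinearMap.BilinForm ℂ H) (l : AffDual H) {ι : Type*} (S : Finset ι)
    (β : ι → H) (g : H) (τ : ℂ) (z : H) (t : ℂ) : ℂ :=
  expWt B (translate B g l) τ z t
    / ∏ p ∈ S, (1 - expWt B (-(translate B g (ofFin (β p)))) τ z t)

/-- The mock theta function `Θ^L_{λ,T}` with `T = {β_p | p ∈ S}`, in the coordinates `(τ, z, t)`.
For `S = ∅` it is the ordinary theta function `Θ^L_λ`. -/
def mockTheta (B : LinearMap.BilinForm ℂ H) (L : Submodule ℤ H) (l : AffDual H) {ι : Type*}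
    (S : Finset ι) (β : ι → H) (τ : ℂ) (z : H) (t : ℂ) : ℂ :=
  qpow τ (affForm B l l / (2 * level l)) * ∑' g : L, mockTerm B l S β g τ z t

/-- `γ^∨ = 2 γ / (γ | γ)`. -/
def coroot (B : LinearMap.BilinForm ℂ H) (g : H) : H := (2 / B g g) • g

end Affine

/-! ## The modification procedure -/

/-- The data and standing assumptions of the modification procedure: a finite-dimensional complex
space `H` with a non-degenerate symmetric bilinear form, a positive definite lattice
`L = ℤ γ_1 ⊕ … ⊕ ℤ γ_m` in it, and pairwise orthogonal isotropic vectors `β_1, …, β_n`, `n ≤ m`.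
(Indices start from `0` in the code.) -/
structure Setup (H : Type*) [AddCommGroup H] [Module ℂ H] where
  /-- the bilinear form -/
  form : LinearMap.BilinForm ℂ H
  form_symm : form.IsSymm
  form_nondeg : form.Nondegenerate
  /-- the rank of the lattice -/
  m : ℕ
  /-- the defect -/
  n : ℕ
  n_le_m : n ≤ m
  /-- the basis of the lattice -/
  gam : Fin m → H
  /-- the isotropic set `T` -/
  bet : Fin n → H
  /-- the form is real on the lattice -/
  gram_real : ∀ i j, (form (gam i) (gam j)).im = 0
  /-- the form is positive definite on the lattice; in particular the `γ_i` are linearly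
  independent, hence a basis of their integral span -/
  gram_posDef : (Matrix.of fun i j => (form (gam i) (gam j)).re).PosDef
  bet_isotropic : ∀ p p', form (bet p) (bet p') = 0
  /-- `(γ_i | β_j) = -δ_{ij}` -/
  gam_bet : ∀ (i : Fin m) (p : Fin n), form (gam i) (bet p) = if (i : ℕ) = p then -1 else 0
  /-- `(γ_i^∨ | γ_j) ∈ ℤ` for `i ≤ n` and `i ≤ j` -/
  coroot_int : ∀ (p : Fin n) (j : Fin m), (p : ℕ) ≤ j →
    ∃ c : ℤ, form (coroot form (gam (Fin.castLE n_le_m p))) (gam j) = c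
  /-- `dim 𝔥 = rank L + |T|` -/
  dim_eq : Module.finrank ℂ H = m + n

namespace Setup

variable {H : Type*} [AddCommGroup H] [Module ℂ H] (D : Setup H)

/-- `γ_p` for `p` among the first `n` indices. -/
def gamT (p : Fin D.n) : H := D.gam (Fin.castLE D.n_le_m p)

/-- `γ_i + ∑_{p ≤ s} (γ_i | γ_p) β_p`. -/
def gamStep (s : ℕ) (i : Fin D.m) : H :=
  D.gam i + ∑ p : Fin D.n with p.val < s, D.form (D.gam i) (D.gamT p) • D.bet p

/-- The lattice `L_s`, spanned by `γ_i + ∑_{p ≤ s} (γ_i | γ_p) β_p` with `i > s`. -/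
def lat (s : ℕ) : Submodule ℤ H := Submodule.span ℤ {x | ∃ i : Fin D.m, s ≤ i ∧ x = D.gamStep s i}

/-- The lattice `L = L_0`. -/
def L : Submodule ℤ H := Submodule.span ℤ (Set.range D.gam)

/-- The lattice `M = L_n`. -/
def M : Submodule ℤ H := D.lat D.n

/-- The set `T_s = {β_{s+1}, …, β_n}`, through its indices. -/
def T (s : ℕ) : Finset (Fin D.n) := {p | s ≤ p.val}

/-- `λ_s = λ + ∑_{i ≤ s} (λ | γ_i) β_i`. -/
def wt (s : ℕ) (l : AffDual H) : AffDual H :=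
  l + ∑ p : Fin D.n with p.val < s, D.form l.1 (D.gamT p) • ofFin (D.bet p)

/-- The positive integer `k |γ_p|² / 2` (under the hypotheses in force it is one). -/
def deg (k : ℂ) (p : Fin D.n) : ℕ := ⌊(k / 2 * D.form (D.gamT p) (D.gamT p)).re⌋₊

/-- The integer `(λ | γ_p)` (under the hypotheses in force it is one). -/
def charge (l : AffDual H) (p : Fin D.n) : ℤ := ⌊(D.form l.1 (D.gamT p)).re⌋

/-- The vector `γ_p + ∑_{i < p} (γ_p | γ_i) β_i`: the first basis vector of the lattice to which
the modification step with number `p` is applied. -/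
def gamTilde (p : Fin D.n) : H := D.gamStep p (Fin.castLE D.n_le_m p)

/-- The complement `ℤ {γ_i + ∑_{j < p} (γ_i | γ_j) β_j | i > p}` to `ℤ gamTilde p` in the lattice
to which the modification step with number `p` is applied. -/
def rest (p : Fin D.n) : Submodule ℤ H :=
  Submodule.span ℤ {x | ∃ i : Fin D.m, (p : ℕ) < i ∧ x = D.gamStep p i}

/-- One modification step, applied to `Θ = Θ^{L_{p-1}}_{λ_{p-1}, T_{p-1}}` (`p` counted from 1).
Write `γ̃ = gamTilde p`, `m = k |γ̃|² / 2`, `s = (λ | γ̃)`. Splitting the lattice as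
`ℤ γ̃ ⊕ rest p` and summing over `ℤ γ̃` first presents `Θ` as
`q^{|λ_p|² / 2k} ∑_{γ ∈ rest p} t_γ (e^{λ_p} / ∏_{β ∈ T_p} (1 - e^{-β})) Φ^{[m;s]}(τ, -β_p, w_γ)`,
`w_γ = β_p + γ̃^∨ + τ (γ | γ̃^∨)`. The step replaces `Φ^{[m;s]}` in this sum by
`Φ̃^{[m;s]} = Φ^{[m;s]} - ½ Φ_add^{[m;s]}`. -/
def stepModified (l : AffDual H) (p : Fin D.n) (τ : ℂ) (z : H) (t : ℂ) : ℂ :=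
  mockTheta D.form (D.lat p) (D.wt p l) (D.T p) D.bet τ z t
    - 1 / 2 * (qpow τ (affForm D.form (D.wt (p + 1) l) (D.wt (p + 1) l) / (2 * level l))
      * ∑' g : D.rest p, mockTerm D.form (D.wt (p + 1) l) (D.T (p + 1)) D.bet g τ z t
        * PhiAdd (D.deg (level l) p) (D.charge l p) τ (-(D.form (D.bet p) z))
          (D.form (D.bet p) z + D.form (coroot D.form (D.gamTilde p)) z
            + τ * D.form g (coroot D.form (D.gamTilde p))))

/-- The factor `Φ̃^{[m;s]}(τ, -β_p, β_p + γ̃_p^∨)` split off by the modification step `p`. -/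
def phiFactor (l : AffDual H) (p : Fin D.n) (τ : ℂ) (z : H) : ℂ :=
  PhiMod (D.deg (level l) p) (D.charge l p) τ (-(D.form (D.bet p) z))
    (D.form (D.bet p) z + D.form (coroot D.form (D.gamTilde p)) z)

/-- The function `Θ̃^{s;L}_{λ,T}` obtained after `s ≤ n` steps. After `s` steps one has the product
of `Θ^{L_s}_{λ_s,T_s}` and of `s` factors `Φ̃`; step `s + 1` modifies the first function. -/
def modifiedStage (l : AffDual H) (τ : ℂ) (z : H) (t : ℂ) : ℕ → ℂ
  | 0 => mockTheta D.form D.L l (D.T 0) D.bet τ z t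
  | s + 1 =>
    if h : s < D.n then
      D.stepModified l ⟨s, h⟩ τ z t * ∏ p : Fin D.n with p.val < s, D.phiFactor l p τ z
    else 0

/-- The modified mock theta function `Θ̃^L_{λ,T} = Θ̃^{n;L}_{λ,T}`. -/
def modTheta (l : AffDual H) (τ : ℂ) (z : H) (t : ℂ) : ℂ := D.modifiedStage l τ z t D.n

/-! ## Weights of level `k` and congruence classes -/

/-- The set `P_{k,T}` of the weights `λ` of level `k` with `(λ | L) ⊆ ℤ` and `(λ | T) = 0`. -/
def weights (k : ℝ) : Set (AffDual H) :=
  {l | level l = k ∧ (∀ x ∈ D.L, ∃ c : ℤ, D.form l.1 x = c) ∧ ∀ p, D.form l.1 (D.bet p) = 0}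

/-- `M^⊥`, the orthogonal complement of `M` in `𝔥`. -/
def MPerp : Submodule ℂ H where
  carrier := {y | ∀ x ∈ D.M, D.form y x = 0}
  zero_mem' := by intro x _; simp
  add_mem' := by intro a b ha hb x hx; simp [ha x hx, hb x hx]
  smul_mem' := by intro c a ha x hx; simp [ha x hx]

/-- Congruence modulo `k M + M^⊥ + ℂ δ`. -/
def Congr (k : ℝ) (l l' : AffDual H) : Prop :=
  ∃ x ∈ D.M, ∃ y ∈ D.MPerp, ∃ a : ℂ, l - l' = ((k : ℂ) • x + y, 0, a)

/-- `R` is a finite set of representatives of `P_{k,T}` modulo `k M + M^⊥ + ℂ δ`. -/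
def IsRepresentatives (k : ℝ) (R : Finset (AffDual H)) : Prop :=
  (R : Set (AffDual H)) ⊆ D.weights k ∧ ∀ l ∈ D.weights k, ∃! r, r ∈ R ∧ D.Congr k l r

/-- The complex span `ℂ M`. -/
def MC : Submodule ℂ H := Submodule.span ℂ (D.M : Set H)

/-- `z₁` is the orthogonal projection of `z` to `ℂ M`. -/
def IsProj (z z₁ : H) : Prop := z₁ ∈ D.MC ∧ z - z₁ ∈ D.MPerp

/-- The dual lattice `M*` in `ℂ M`. -/
def MDual : AddSubgroup H where
  carrier := {x | x ∈ D.MC ∧ ∀ y ∈ D.M, ∃ c : ℤ, D.form x y = c}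
  zero_mem' := ⟨zero_mem _, fun y _ => ⟨0, by simp⟩⟩
  add_mem' := by
    rintro a b ⟨ha, ha'⟩ ⟨hb, hb'⟩
    refine ⟨add_mem ha hb, fun y hy => ?_⟩
    obtain ⟨c, hc⟩ := ha' y hy
    obtain ⟨d, hd⟩ := hb' y hy
    exact ⟨c + d, by simp [hc, hd]⟩
  neg_mem' := by
    rintro a ⟨ha, ha'⟩
    refine ⟨neg_mem ha, fun y hy => ?_⟩
    obtain ⟨c, hc⟩ := ha' y hy
    exact ⟨-c, by simp [hc]⟩

/-- The lattice `k M`. -/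
def kM (k : ℝ) : AddSubgroup H :=
  D.M.toAddSubgroup.map (DistribSMul.toAddMonoidHom H (k : ℂ))

/-- The order of `M* / k M`. -/
def indexM (k : ℝ) : ℕ := Nat.card (D.MDual ⧸ (D.kM k).addSubgroupOf D.MDual)

/-- `z` lies off the poles of the functions in question: `(β_p | z) ∉ ℤ + ℤ τ` for all `p`. -/
def OffPoles (τ : ℂ) (z : H) : Prop := ∀ p, ∀ a b : ℤ, D.form (D.bet p) z ≠ a + b * τ

end Setup

end

end MockTheta

namespace MockTheta

open Complex

/-! ## Gaussian sums over the integers -/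

/-! Everything rests on one formula in rank one. For z₁ outside ℤ + ℤτ, the function Φ̃^{[m;s]}(τ,
z₁, z₂) is an absolutely convergent sum over g ∈ ℤτ + ℤ of a Gaussian exponential divided by z₁ + g
(`PhiMod_eq_tsum`). The summand does not contain s, and it depends on τ only through g and Im τ.
Independence of s and the rules for τ ↦ τ + 1, τ ↦ -1/τ and z₂ ↦ z₂ + cτ therefore follow term by
term, by changing the basis of ℤτ + ℤ where τ changes.

The formula comes from a kernel identity in one variable (`geomCompletion_eq`). The series
x^s/(1-x), x = e^{2πiζ}, completed by the sum of (sign - E)x^n, is a sum over b of Gaussians with a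
pole at ζ = -b. Both sides are multiplied by x when the centre ρ of the error functions moves by 1,
and their increments are integrals of the two sides of a Poisson summation formula. Since x ≠ 1, the
identity follows by division.

In a modification step, the second argument of Φ̃ for γ ∈ `rest p` differs from its value at γ = 0
by an integral multiple of τ, by integrality of (γ | γ̃_p^∨). The resulting elliptic factor is
exactly what the exponential gains when γ is replaced by γ + (γ | γ̃_p)β_p, and these vectors run
through the next lattice. So the step splits off one factor Φ̃ and leaves the mock theta function of
the next lattice (`stepModified_eq`); after n steps the ordinary theta function of M remains. This
gives the factorization.

The theta function of M is inverted by Poisson summation over ℤ^r, which yields a sum over M*. The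
classes in P_{k,T} are the cosets of kM in M* (`bijective_of_isRepresentatives`), whence the finite
sum over μ; the factors Φ̃ are the same for all μ because they do not depend on s. The automorphy
exponents add up: the factors Φ̃ contribute |z|² - |z⁽¹⁾|² and the theta function contributes
|z⁽¹⁾|² (`IsProj.sum_eq`), which the shift of t cancels. -/

theorem summable_exp_quadratic {a : ℝ} (ha : 0 < a) (b : ℝ) :
    Summable fun n : ℤ => Real.exp (-a * n ^ 2 + b * n) := by
  have h := ((summable_jacobiTheta₂_term_iff (-(I * b / (2 * Real.pi))) (I * (a / Real.pi))).2
    (by simp; positivity)).norm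
  refine h.congr fun n => ?_
  rw [norm_jacobiTheta₂_term]
  congr 1
  simp
  field_simp
  ring_nf
  simp [sq, mul_comm]
  field_simp

/-! ## The error function -/

theorem continuous_exp_neg_pi_sq : Continuous fun u : ℝ => Real.exp (-Real.pi * u ^ 2) := by
  fun_prop

theorem errE_neg (x : ℝ) : errE (-x) = -errE x := by
  unfold errE
  have h := intervalIntegral.integral_comp_neg (a := 0) (b := x)
    (fun u : ℝ => Real.exp (-Real.pi * u ^ 2))
  simp only [neg_sq, neg_zero] at h
  rw [h, intervalIntegral.integral_symm (-x) 0]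
  ring

/-- The difference is a Gaussian tail. After translation by x it is bounded by means of (u + x)² ≥
u² + x² for u, x ≥ 0. -/
theorem abs_one_sub_errE_le {x : ℝ} (hx : 0 ≤ x) :
    |1 - errE x| ≤ Real.exp (-Real.pi * x ^ 2) := by
  have hi : MeasureTheory.Integrable fun u : ℝ => Real.exp (-Real.pi * u ^ 2) :=
    integrable_exp_neg_mul_sq Real.pi_pos
  have h0 : ∫ u in Set.Ioi (0 : ℝ), Real.exp (-Real.pi * u ^ 2) = 1 / 2 := by
    rw [integral_gaussian_Ioi]; simp [Real.pi_ne_zero]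
  have h1 : 1 - errE x = 2 * ∫ u in Set.Ioi x, Real.exp (-Real.pi * u ^ 2) := by
    have := intervalIntegral.integral_interval_add_Ioi (a := 0) (b := x)
      (f := fun u : ℝ => Real.exp (-Real.pi * u ^ 2)) hi.integrableOn hi.integrableOn
    unfold errE
    linarith
  have h2 : ∫ u in Set.Ioi x, Real.exp (-Real.pi * u ^ 2)
      ≤ Real.exp (-Real.pi * x ^ 2) * (1 / 2) := by
    have h3 := (MeasureTheory.measurePreserving_add_right MeasureTheory.volume x).setIntegral_preimage_emb
      (measurableEmbedding_addRight x) (fun u : ℝ => Real.exp (-Real.pi * u ^ 2)) (Set.Ioi x)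
    simp only [Set.preimage_add_const_Ioi, sub_self] at h3
    rw [← h3, ← h0, ← MeasureTheory.integral_const_mul]
    refine MeasureTheory.setIntegral_mono_on (hi.comp_add_right x).integrableOn
      (hi.const_mul _).integrableOn measurableSet_Ioi fun u hu => ?_
    rw [← Real.exp_add, Real.exp_le_exp]
    have : 0 ≤ Real.pi * (u * x) := by
      have := (Set.mem_Ioi.1 hu).le
      positivity
    nlinarith
  have h4 : 0 ≤ ∫ u in Set.Ioi x, Real.exp (-Real.pi * u ^ 2) :=
    MeasureTheory.integral_nonneg fun u => (Real.exp_pos _).le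
  rw [h1, abs_of_nonneg (by positivity)]
  linarith

theorem abs_neg_one_sub_errE_le {x : ℝ} (hx : x ≤ 0) :
    |-1 - errE x| ≤ Real.exp (-Real.pi * x ^ 2) := by
  have h := abs_one_sub_errE_le (neg_nonneg.2 hx)
  rw [errE_neg, neg_sq] at h
  rw [← abs_neg]
  convert h using 2
  ring

theorem errE_sub (x y : ℝ) :
    errE x - errE y = 2 * ∫ u in y..x, Real.exp (-Real.pi * u ^ 2) := by
  unfold errE
  rw [← mul_sub, intervalIntegral.integral_interval_sub_left] <;>
  exact continuous_exp_neg_pi_sq.intervalIntegrable _ _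

/-- The signs `1` for `n ≥ s` and `-1` for `n < s`. -/
noncomputable def sgnFrom (s n : ℤ) : ℝ := if s ≤ n then 1 else -1

/-- The sign jumps at s and the error function changes sign at ρ. Between the two there are finitely
many n, and a large constant covers them; elsewhere the signs agree and the Gaussian tail bound
applies. -/
theorem abs_sgnFrom_sub_errE_le (s : ℤ) {κ : ℝ} (hκ : 0 < κ) (ρ : ℝ) : ∃ C : ℝ, ∀ n : ℤ,
    |sgnFrom s n - errE ((n - ρ) * √κ)| ≤ C * Real.exp (-Real.pi * κ * (n - ρ) ^ 2) := by
  have hpos : 0 < √κ := Real.sqrt_pos.2 hκ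
  have hsq : ∀ n : ℤ, -Real.pi * ((n - ρ) * √κ) ^ 2 = -Real.pi * κ * (n - ρ) ^ 2 := fun n => by
    rw [mul_pow, Real.sq_sqrt hκ.le]; ring
  set M := |(s : ℝ) - ρ| with hM
  -- A wrong sign costs at most 2 and occurs only for |n - ρ| ≤ M, where the product of the two
  -- exponentials is at least 1; the tail bound costs 1 more.
  refine ⟨3 * Real.exp (Real.pi * κ * M ^ 2), fun n => ?_⟩
  have h1 : (1 : ℝ) ≤ Real.exp (Real.pi * κ * M ^ 2) := Real.one_le_exp (by positivity)
  have key : ∀ t : ℝ, |t| = 1 → |sgnFrom s n - t| = 0 ∨ |(n : ℝ) - ρ| ≤ M →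
      |t - errE ((n - ρ) * √κ)| ≤ Real.exp (-Real.pi * κ * (n - ρ) ^ 2) →
      |sgnFrom s n - errE ((n - ρ) * √κ)|
        ≤ 3 * Real.exp (Real.pi * κ * M ^ 2) * Real.exp (-Real.pi * κ * (n - ρ) ^ 2) := by
    intro t ht hc hb
    have hE := Real.exp_pos (-Real.pi * κ * (n - ρ) ^ 2)
    have htri : |sgnFrom s n - errE ((n - ρ) * √κ)|
        ≤ |sgnFrom s n - t| + |t - errE ((n - ρ) * √κ)| := abs_sub_le _ _ _
    rcases hc with hc | hc
    · nlinarith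
    · have h2 : |sgnFrom s n - t| ≤ 2 := by
        have : |sgnFrom s n| = 1 := by unfold sgnFrom; split_ifs <;> simp
        have := abs_sub (sgnFrom s n) t
        linarith
      have h3 : 1 ≤ Real.exp (Real.pi * κ * M ^ 2) * Real.exp (-Real.pi * κ * (n - ρ) ^ 2) := by
        rw [← Real.exp_add]
        apply Real.one_le_exp
        have h4 : ((n : ℝ) - ρ) ^ 2 ≤ M ^ 2 := by
          rw [← sq_abs]; exact pow_le_pow_left₀ (abs_nonneg _) hc 2
        have : 0 ≤ Real.pi * κ * (M ^ 2 - (n - ρ) ^ 2) :=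
          mul_nonneg (by positivity) (by linarith)
        linarith
      nlinarith
  rcases le_total 0 ((n : ℝ) - ρ) with h | h
  · refine key 1 (by simp) ?_ ?_
    · by_cases hs : s ≤ n
      · left; simp [sgnFrom, hs]
      · right
        have : (n : ℝ) ≤ s := by exact_mod_cast (not_le.1 hs).le
        rw [abs_of_nonneg h, hM]
        exact le_trans (by linarith) (le_abs_self _)
    · rw [← hsq]; exact abs_one_sub_errE_le (by positivity)
  · refine key (-1) (by simp) ?_ ?_
    · by_cases hs : s ≤ n
      · right
        have : (s : ℝ) ≤ n := by exact_mod_cast hs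
        rw [abs_of_nonpos h, hM]
        exact le_trans (by linarith) (neg_le_abs _)
      · left; simp [sgnFrom, hs]
    · rw [← hsq]; exact abs_neg_one_sub_errE_le (mul_nonpos_of_nonpos_of_nonneg h hpos.le)

/-! ## A one-dimensional kernel identity -/

theorem tsum_integral_eq_integral_tsum {f : ℤ → ℝ → ℂ} (hc : ∀ n, Continuous (f n)) {g : ℤ → ℝ}
    (hg : Summable g) {a b : ℝ} (hfg : ∀ n, ∀ t ∈ Set.uIcc a b, ‖f n t‖ ≤ g n) :
    ∑' n, ∫ t in a..b, f n t = ∫ t in a..b, ∑' n, f n t := by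
  refine (intervalIntegral.hasSum_integral_of_dominated_convergence (fun n _ => g n)
    (fun n => (hc n).aestronglyMeasurable) (fun n => ?_) ?_ ?_ ?_).tsum_eq
  · exact .of_forall fun t ht => hfg n t (Set.uIoc_subset_uIcc ht)
  · exact .of_forall fun t _ => hg
  · exact intervalIntegrable_const
  · exact .of_forall fun t ht => (Summable.of_norm_bounded hg
      fun n => hfg n t (Set.uIoc_subset_uIcc ht)).hasSum

theorem summable_sgnFrom_sub_errE (s : ℤ) {κ : ℝ} (hκ : 0 < κ) (ρ : ℝ) (ζ : ℂ) :
    Summable fun n : ℤ => ((sgnFrom s n - errE ((n - ρ) * √κ) : ℝ) : ℂ)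
      * cexp (2 * Real.pi * I * n * ζ) := by
  obtain ⟨C, hC⟩ := abs_sgnFrom_sub_errE_le s hκ ρ
  refine Summable.of_norm_bounded (((summable_exp_quadratic
    (mul_pos Real.pi_pos hκ) (2 * Real.pi * κ * ρ - 2 * Real.pi * ζ.im)).mul_left
      (C * Real.exp (-Real.pi * κ * ρ ^ 2)))) fun n => ?_
  rw [norm_mul, Complex.norm_real, Real.norm_eq_abs, Complex.norm_exp]
  refine (mul_le_mul_of_nonneg_right (hC n) (Real.exp_pos _).le).trans (le_of_eq ?_)
  rw [mul_assoc C, ← Real.exp_add, mul_assoc C, ← Real.exp_add]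
  congr 2
  simp
  ring

/-- Links the two sides of the kernel identity: the left side is what differences of error functions
integrate, the right side what differences of `gaussPole` integrate. -/
theorem gaussian_poisson {κ : ℝ} (hκ : 0 < κ) (t : ℝ) (ζ : ℂ) :
    ∑' n : ℤ, ((√κ * Real.exp (-Real.pi * κ * (n - t) ^ 2) : ℝ) : ℂ)
        * cexp (2 * Real.pi * I * n * ζ)
      = ∑' b : ℤ, cexp (-Real.pi * (ζ + b) ^ 2 / κ + 2 * Real.pi * I * t * (ζ + b)) := by
  have hκ' : (κ : ℂ) ≠ 0 := by exact_mod_cast hκ.ne'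
  have h := Complex.tsum_exp_neg_quadratic (a := κ) (by simpa using hκ) (κ * t + I * ζ)
  have hs : (κ : ℂ) ^ (1 / 2 : ℂ) = (√κ : ℝ) := by
    rw [Real.sqrt_eq_rpow, Complex.ofReal_cpow hκ.le]; simp
  have hs0 : ((√κ : ℝ) : ℂ) ≠ 0 := by exact_mod_cast (Real.sqrt_pos.2 hκ).ne'
  rw [hs] at h
  have h1 : ∀ n : ℤ, ((√κ * Real.exp (-Real.pi * κ * (n - t) ^ 2) : ℝ) : ℂ)
        * cexp (2 * Real.pi * I * n * ζ) = (√κ : ℝ) * cexp (-Real.pi * κ * t ^ 2)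
        * cexp (-Real.pi * κ * n ^ 2 + 2 * Real.pi * (κ * t + I * ζ) * n) := fun n => by
    push_cast
    rw [mul_assoc (√κ : ℂ), ← Complex.exp_add, mul_assoc (√κ : ℂ), ← Complex.exp_add]
    congr 2
    ring
  simp_rw [h1]
  rw [tsum_mul_left, h, mul_mul_mul_comm, mul_one_div_cancel hs0, one_mul, ← tsum_mul_left,
    ← (Equiv.neg ℤ).tsum_eq]
  refine tsum_congr fun n => ?_
  rw [← Complex.exp_add]
  congr 1
  simp only [Equiv.neg_apply, Int.cast_neg]
  field_simp
  ring_nf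
  simp only [I_sq, I_pow_three, I_pow_four]
  ring

theorem sub_sq_ge (n t : ℝ) : n ^ 2 / 2 - t ^ 2 ≤ (n - t) ^ 2 := by
  nlinarith [sq_nonneg (n - 2 * t)]

theorem exp_two_pi_I_int_mul (n : ℤ) (ζ : ℂ) :
    cexp (2 * Real.pi * I * n * ζ) = cexp (2 * Real.pi * I * ζ) ^ n := by
  rw [← Complex.exp_int_mul]; congr 1; ring

theorem exp_two_pi_I_ne_one {ζ : ℂ} (hζ : ∀ b : ℤ, ζ + b ≠ 0) :
    cexp (2 * Real.pi * I * ζ) ≠ 1 := by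
  intro h
  obtain ⟨n, hn⟩ := Complex.exp_eq_one_iff.1 h
  refine hζ (-n) ?_
  have h2 : (2 * Real.pi * I : ℂ) ≠ 0 := Complex.two_pi_I_ne_zero
  have : ζ = n := mul_left_cancel₀ h2 (by rw [hn]; ring)
  simp [this]

/-- The completion of the geometric series `x ^ s / (1 - x)`, `x = exp (2 π i ζ)`. -/
noncomputable def geomCompletion (s : ℤ) (κ : ℝ) (ζ : ℂ) (ρ : ℝ) : ℂ :=
  cexp (2 * Real.pi * I * ζ) ^ s / (1 - cexp (2 * Real.pi * I * ζ))
    - 1 / 2 * ∑' n : ℤ, ((sgnFrom s n - errE ((n - ρ) * √κ) : ℝ) : ℂ)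
      * cexp (2 * Real.pi * I * n * ζ)

/-- Shifting n by one reproduces the correction series times x, except that the sign jump at n = s -
1 leaves 2x^s. Half of it turns x^s/(1-x) into x^{s+1}/(1-x). -/
theorem geomCompletion_add_one (s : ℤ) {κ : ℝ} (hκ : 0 < κ) {ζ : ℂ} (hζ : ∀ b : ℤ, ζ + b ≠ 0)
    (ρ : ℝ) : geomCompletion s κ ζ (ρ + 1)
      = cexp (2 * Real.pi * I * ζ) * geomCompletion s κ ζ ρ := by
  have hx1 := exp_two_pi_I_ne_one hζ
  have hS := summable_sgnFrom_sub_errE s hκ ρ ζ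
  have hS' := summable_sgnFrom_sub_errE s hκ (ρ + 1) ζ
  unfold geomCompletion
  simp only [exp_two_pi_I_int_mul] at hS hS' ⊢
  set x := cexp (2 * Real.pi * I * ζ) with hx
  have hx0 : x ≠ 0 := Complex.exp_ne_zero _
  have hshift : ∑' n : ℤ, ((sgnFrom s n - errE ((n - (ρ + 1)) * √κ) : ℝ) : ℂ) * x ^ n
      = x * (∑' n : ℤ, ((sgnFrom s n - errE ((n - ρ) * √κ) : ℝ) : ℂ) * x ^ n)
        + 2 * x ^ s := by
    rw [← (Equiv.addRight (1 : ℤ)).tsum_eq, ← tsum_mul_left]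
    have h1 : ∀ n : ℤ, ((sgnFrom s (Equiv.addRight (1 : ℤ) n)
          - errE (((Equiv.addRight (1 : ℤ) n : ℤ) - (ρ + 1)) * √κ) : ℝ) : ℂ)
          * x ^ (Equiv.addRight (1 : ℤ) n)
        = x * (((sgnFrom s n - errE ((n - ρ) * √κ) : ℝ) : ℂ) * x ^ n)
          + if n = s - 1 then 2 * x ^ s else 0 := fun n => by
      simp only [Equiv.coe_addRight]
      rw [zpow_add_one₀ hx0]
      have h2 : (((n + 1 : ℤ) : ℝ) - (ρ + 1)) = n - ρ := by push_cast; ring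
      rw [h2]
      split_ifs with h
      · subst h
        have h3 : x ^ s = x ^ (s - 1) * x := by rw [← zpow_add_one₀ hx0]; simp
        simp only [sgnFrom, sub_add_cancel, le_refl, if_true]
        rw [if_neg (by omega), h3]
        push_cast
        ring
      · have h3 : sgnFrom s (n + 1) = sgnFrom s n := by
          unfold sgnFrom
          by_cases h4 : s ≤ n
          · rw [if_pos h4, if_pos (by omega)]
          · rw [if_neg h4, if_neg (by omega)]
        rw [h3]
        ring
    simp_rw [h1]
    rw [(hS.mul_left x).tsum_add (summable_of_ne_finset_zero (s := {s - 1}) ?_), tsum_ite_eq]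
    intro b hb
    rw [if_neg (by simpa using hb)]
  rw [hshift]
  generalize ∑' n : ℤ, ((sgnFrom s n - errE ((n - ρ) * √κ) : ℝ) : ℂ) * x ^ n = S
  have h1x : 1 - x ≠ 0 := sub_ne_zero.2 (Ne.symm hx1)
  field_simp
  ring

/-- The signs and the rational part cancel. What remains is a difference of error functions, an
integral of a Gaussian over an interval of length one in the centre. -/
theorem geomCompletion_sub (s : ℤ) {κ : ℝ} (hκ : 0 < κ) (ζ : ℂ) (ρ : ℝ) :
    geomCompletion s κ ζ (ρ + 1) - geomCompletion s κ ζ ρ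
      = -∫ t in ρ..ρ + 1, ∑' n : ℤ, ((√κ * Real.exp (-Real.pi * κ * (n - t) ^ 2) : ℝ) : ℂ)
        * cexp (2 * Real.pi * I * n * ζ) := by
  have hS := summable_sgnFrom_sub_errE s hκ ρ ζ
  have hS' := summable_sgnFrom_sub_errE s hκ (ρ + 1) ζ
  have hterm : ∀ n : ℤ, ((sgnFrom s n - errE ((n - (ρ + 1)) * √κ) : ℝ) : ℂ)
        * cexp (2 * Real.pi * I * n * ζ) - ((sgnFrom s n - errE ((n - ρ) * √κ) : ℝ) : ℂ)
        * cexp (2 * Real.pi * I * n * ζ)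
      = 2 * ∫ t in ρ..ρ + 1, ((√κ * Real.exp (-Real.pi * κ * (n - t) ^ 2) : ℝ) : ℂ)
        * cexp (2 * Real.pi * I * n * ζ) := fun n => by
    rw [intervalIntegral.integral_mul_const, intervalIntegral.integral_ofReal, ← sub_mul,
      ← mul_assoc]
    congr 1
    norm_cast
    rw [sub_sub_sub_cancel_left, errE_sub, intervalIntegral.integral_const_mul]
    congr 1
    have h := intervalIntegral.mul_integral_comp_sub_mul (a := ρ) (b := ρ + 1)
      (f := fun u : ℝ => Real.exp (-Real.pi * u ^ 2)) (√κ) (n * √κ)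
    have h1 : ∀ y : ℝ, (n : ℝ) * √κ - √κ * y = (n - y) * √κ := fun y => by ring
    simp only [h1] at h
    rw [← h]
    congr 1
    refine intervalIntegral.integral_congr fun t _ => ?_
    simp only [mul_pow, Real.sq_sqrt hκ.le]
    ring_nf
  unfold geomCompletion
  rw [sub_sub_sub_cancel_left, ← mul_sub, ← hS.tsum_sub hS',
    -- The majorant is uniform in t: (n - t)² ≥ n²/2 - t² and |t| ≤ |ρ| + 1 on the interval.
    ← tsum_integral_eq_integral_tsum (g := fun n : ℤ => √κ * Real.exp (Real.pi * κ * (|ρ| + 1) ^ 2)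
      * Real.exp (-(Real.pi * κ / 2) * n ^ 2 + (-2 * Real.pi * ζ.im) * n))]
  · rw [← tsum_mul_left, ← tsum_neg]
    refine tsum_congr fun n => ?_
    rw [← neg_sub, hterm]
    ring
  · intro n
    fun_prop
  · exact (summable_exp_quadratic (by positivity) _).mul_left _
  · intro n t ht
    rw [norm_mul, Complex.norm_real, Complex.norm_exp, norm_mul, Real.norm_of_nonneg (by positivity),
      Real.norm_of_nonneg (by positivity), mul_assoc (√κ), ← Real.exp_add, mul_assoc (√κ), ← Real.exp_add]
    refine mul_le_mul_of_nonneg_left (Real.exp_le_exp.2 ?_) (Real.sqrt_nonneg _)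
    rw [Set.uIcc_of_le (by linarith)] at ht
    have ht' : t ^ 2 ≤ (|ρ| + 1) ^ 2 := by
      rw [← sq_abs]
      refine pow_le_pow_left₀ (abs_nonneg _) (abs_le.2 ⟨?_, ?_⟩) 2
      · linarith [ht.1, neg_abs_le ρ]
      · linarith [ht.2, le_abs_self ρ]
    have h2 := mul_le_mul_of_nonneg_left ((sub_le_sub_left ht' _).trans (sub_sq_ge n t))
      (mul_pos Real.pi_pos hκ).le
    have h3 : (2 * Real.pi * I * n * ζ : ℂ).re = -2 * Real.pi * ζ.im * n := by
      simp
      ring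
    rw [h3]
    linarith

/-- A Gaussian with a simple pole. -/
noncomputable def gaussPole (κ : ℝ) (ρ : ℝ) (w : ℂ) : ℂ :=
  cexp (-Real.pi * w ^ 2 / κ + 2 * Real.pi * I * ρ * w) / w

theorem norm_exp_gauss_le {κ : ℝ} (hκ : 0 < κ) {t T : ℝ} (ht : |t| ≤ T) (ζ : ℂ) (b : ℤ) :
    ‖cexp (-Real.pi * (ζ + b) ^ 2 / κ + 2 * Real.pi * I * t * (ζ + b))‖
      ≤ Real.exp (Real.pi * (ζ.re ^ 2 + ζ.im ^ 2) / κ + 2 * Real.pi * T * |ζ.im|)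
        * Real.exp (-(Real.pi / (2 * κ)) * b ^ 2 + 0 * b) := by
  rw [Complex.norm_exp, ← Real.exp_add, Real.exp_le_exp]
  have h1 : (-Real.pi * (ζ + b) ^ 2 / κ + 2 * Real.pi * I * t * (ζ + b) : ℂ).re
      = Real.pi / κ * (ζ.im ^ 2 - (b - -ζ.re) ^ 2) + 2 * Real.pi * -(t * ζ.im) := by
    have h2 : (-Real.pi * (ζ + b) ^ 2 / κ : ℂ) = ((Real.pi / κ : ℝ) : ℂ) * -(ζ + b) ^ 2 := by
      push_cast; ring
    rw [add_re, h2, re_ofReal_mul]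
    simp [sq]
    ring
  rw [h1]
  have h3 : -(t * ζ.im) ≤ T * |ζ.im| := by
    rw [← neg_mul]
    refine (le_abs_self _).trans ?_
    rw [abs_mul, abs_neg]
    gcongr
  have h4 := mul_le_mul_of_nonneg_left (sub_sq_ge b (-ζ.re)) (div_pos Real.pi_pos hκ).le
  have h5 := mul_le_mul_of_nonneg_left h3 Real.two_pi_pos.le
  have h6 : Real.pi * (ζ.re ^ 2 + ζ.im ^ 2) / κ + 2 * Real.pi * T * |ζ.im|
      + (-(Real.pi / (2 * κ)) * b ^ 2 + 0 * b)
      = Real.pi / κ * (ζ.im ^ 2) - Real.pi / κ * (b ^ 2 / 2 - (-ζ.re) ^ 2)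
        + 2 * Real.pi * (T * |ζ.im|) := by ring
  rw [h6]
  linarith

theorem exists_le_norm_add_int {ζ : ℂ} (hζ : ∀ b : ℤ, ζ + b ≠ 0) :
    ∃ ε : ℝ, 0 < ε ∧ ∀ b : ℤ, ε ≤ ‖ζ + b‖ := by
  have hfin : {b : ℤ | ‖ζ + b‖ ≤ 1}.Finite := by
    refine (Set.finite_Icc (-⌈‖ζ‖ + 1⌉) ⌈‖ζ‖ + 1⌉).subset fun b hb => ?_
    have h1 : |(b : ℝ)| ≤ ‖ζ‖ + 1 := by
      have : ‖(b : ℂ)‖ ≤ ‖ζ + b‖ + ‖ζ‖ := by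
        simpa using norm_sub_le (ζ + b) ζ
      rw [Complex.norm_intCast] at this
      have hb' : ‖ζ + b‖ ≤ 1 := hb
      linarith
    have h2 : |(b : ℝ)| ≤ (⌈‖ζ‖ + 1⌉ : ℤ) := h1.trans (Int.le_ceil _)
    have h3 : |b| ≤ ⌈‖ζ‖ + 1⌉ := by exact_mod_cast h2
    exact abs_le.1 h3
  rcases hfin.toFinset.eq_empty_or_nonempty with h | h
  · refine ⟨1, one_pos, fun b => ?_⟩
    by_contra hb
    have : b ∈ hfin.toFinset := by simpa using (not_le.1 hb).le
    simp [h] at this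
  · obtain ⟨b₀, hb₀, hmin⟩ := hfin.toFinset.exists_min_image (fun b : ℤ => ‖ζ + b‖) h
    refine ⟨‖ζ + b₀‖, norm_pos_iff.2 (hζ b₀), fun b => ?_⟩
    by_cases hb : b ∈ hfin.toFinset
    · exact hmin b hb
    · have h1 : ‖ζ + b₀‖ ≤ 1 := by simpa using hb₀
      have h2 : 1 < ‖ζ + b‖ := by simpa using hb
      linarith

theorem summable_gaussPole {κ : ℝ} (hκ : 0 < κ) {ζ : ℂ} (hζ : ∀ b : ℤ, ζ + b ≠ 0) (ρ : ℝ) :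
    Summable fun b : ℤ => gaussPole κ ρ (ζ + b) := by
  obtain ⟨ε, hε, hle⟩ := exists_le_norm_add_int hζ
  refine Summable.of_norm_bounded (((summable_exp_quadratic
    (a := Real.pi / (2 * κ)) (by positivity) 0).mul_left
    (Real.exp (Real.pi * (ζ.re ^ 2 + ζ.im ^ 2) / κ + 2 * Real.pi * |ρ| * |ζ.im|))).mul_right ε⁻¹)
    fun b => ?_
  rw [gaussPole, norm_div, div_eq_mul_inv]
  exact mul_le_mul (norm_exp_gauss_le hκ le_rfl ζ b) (inv_anti₀ hε (hle b)) (by positivity)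
    (by positivity)

theorem gaussPole_add_one (κ ρ : ℝ) (ζ : ℂ) (b : ℤ) :
    gaussPole κ (ρ + 1) (ζ + b) = cexp (2 * Real.pi * I * ζ) * gaussPole κ ρ (ζ + b) := by
  have h : cexp (2 * Real.pi * I * ζ) = cexp (2 * Real.pi * I * (ζ + b)) := by
    rw [mul_add, Complex.exp_add, mul_comm _ (b : ℂ), Complex.exp_int_mul_two_pi_mul_I, mul_one]
  rw [gaussPole, gaussPole, h, ← mul_div_assoc, ← Complex.exp_add]
  congr 2
  push_cast
  ring

/-- Integrating e^{2πitw} over t produces the denominator 2πiw, so the increment in ρ has no pole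
left. -/
theorem gaussPole_sub (κ ρ : ℝ) {w : ℂ} (hw : w ≠ 0) :
    gaussPole κ (ρ + 1) w - gaussPole κ ρ w
      = 2 * Real.pi * I * ∫ t in ρ..ρ + 1, cexp (-Real.pi * w ^ 2 / κ + 2 * Real.pi * I * t * w) := by
  have hc : (2 * Real.pi * I * w : ℂ) ≠ 0 := mul_ne_zero Complex.two_pi_I_ne_zero hw
  have h1 : ∀ t : ℝ, cexp (-Real.pi * w ^ 2 / κ + 2 * Real.pi * I * t * w)
      = cexp (-Real.pi * w ^ 2 / κ) * cexp (2 * Real.pi * I * w * t) := fun t => by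
    rw [← Complex.exp_add]; congr 1; ring
  simp only [gaussPole, h1]
  rw [intervalIntegral.integral_const_mul, integral_exp_mul_complex hc]
  field_simp

/-- Each side takes the factor x = e^{2πiζ} when ρ grows by 1, so its increment is (x - 1) times
itself. The increments are integrals over [ρ, ρ + 1] of functions that agree by `gaussian_poisson`,
and x ≠ 1. -/
theorem geomCompletion_eq (s : ℤ) {κ : ℝ} (hκ : 0 < κ) {ζ : ℂ} (hζ : ∀ b : ℤ, ζ + b ≠ 0)
    (ρ : ℝ) : geomCompletion s κ ζ ρ
      = -(1 / (2 * Real.pi * I)) * ∑' b : ℤ, gaussPole κ ρ (ζ + b) := by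
  have hS := summable_gaussPole hκ hζ ρ
  have hS' := summable_gaussPole hκ hζ (ρ + 1)
  have hx1 : cexp (2 * Real.pi * I * ζ) - 1 ≠ 0 := sub_ne_zero.2 (exp_two_pi_I_ne_one hζ)
  have hL := geomCompletion_sub s hκ ζ ρ
  rw [geomCompletion_add_one s hκ hζ, ← sub_one_mul] at hL
  have hR : (cexp (2 * Real.pi * I * ζ) - 1) * ∑' b : ℤ, gaussPole κ ρ (ζ + b)
      = 2 * Real.pi * I * ∫ t in ρ..ρ + 1,
        ∑' b : ℤ, cexp (-Real.pi * (ζ + b) ^ 2 / κ + 2 * Real.pi * I * t * (ζ + b)) := by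
    rw [← tsum_integral_eq_integral_tsum
      (g := fun b : ℤ => Real.exp (Real.pi * (ζ.re ^ 2 + ζ.im ^ 2) / κ
          + 2 * Real.pi * (|ρ| + 1) * |ζ.im|)
        * Real.exp (-(Real.pi / (2 * κ)) * b ^ 2 + 0 * b))]
    · rw [sub_mul, ← tsum_mul_left, one_mul, ← tsum_mul_left,
        ← (hS.mul_left _).tsum_sub hS]
      refine tsum_congr fun b => ?_
      rw [← gaussPole_add_one, gaussPole_sub κ ρ (hζ b)]
    · intro b
      fun_prop
    · exact (summable_exp_quadratic (by positivity) _).mul_left _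
    · intro b t ht
      refine norm_exp_gauss_le hκ ?_ ζ b
      rw [Set.uIcc_of_le (by linarith)] at ht
      exact abs_le.2 ⟨by linarith [ht.1, neg_abs_le ρ], by linarith [ht.2, le_abs_self ρ]⟩
  apply mul_left_cancel₀ hx1
  rw [hL, mul_left_comm, hR]
  simp_rw [gaussian_poisson hκ]
  have := Complex.two_pi_I_ne_zero
  field_simp

/-! ## The modified mock theta function of rank one as a lattice sum -/

/-- `w` does not lie in `ℤ + ℤ τ`. -/
def OffLattice (τ w : ℂ) : Prop := ∀ a b : ℤ, w + a * τ + b ≠ 0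

theorem exists_pos_le_of_eventually {α : Type*} {f : α → ℝ} (hf : ∀ i, 0 < f i) {c : ℝ}
    (hc : 0 < c) (h : ∀ᶠ i in Filter.cofinite, c ≤ f i) : ∃ ε, 0 < ε ∧ ∀ i, ε ≤ f i := by
  have hfin : {i | ¬ c ≤ f i}.Finite := h
  rcases hfin.toFinset.eq_empty_or_nonempty with h0 | h0
  · refine ⟨c, hc, fun i => ?_⟩
    by_contra hi
    have hi' : i ∈ hfin.toFinset := by simpa using hi
    rw [h0] at hi'
    exact Finset.notMem_empty _ hi'
  · obtain ⟨i₀, hi₀, hmin⟩ := hfin.toFinset.exists_min_image f h0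
    refine ⟨f i₀, hf i₀, fun i => ?_⟩
    by_cases hi : i ∈ hfin.toFinset
    · exact hmin i hi
    · have h1 : f i₀ < c := by simpa using hi₀
      have h2 : c ≤ f i := by simpa using hi
      linarith

theorem finite_setOf_abs_int_le (C : ℝ) : {n : ℤ | |(n : ℝ)| ≤ C}.Finite := by
  refine (Set.finite_Icc (-⌈C⌉) ⌈C⌉).subset fun n hn => ?_
  have h2 : |(n : ℝ)| ≤ (⌈C⌉ : ℤ) := (show |(n : ℝ)| ≤ C from hn).trans (Int.le_ceil _)
  have h3 : |n| ≤ ⌈C⌉ := by exact_mod_cast h2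
  exact abs_le.1 h3

/-- No denominator vanishes off the lattice. For all but finitely many n the imaginary part of w +
nτ has absolute value at least 1, and the exponential is then far from 1, being small or large. -/
theorem exists_norm_inv_one_sub_le {τ w : ℂ} (hτ : 0 < τ.im) (hw : OffLattice τ w) :
    ∃ C : ℝ, 0 < C ∧ ∀ n : ℤ, ‖(1 - cexp (2 * Real.pi * I * (w + n * τ)))⁻¹‖ ≤ C := by
  have hne : ∀ n : ℤ, 0 < ‖1 - cexp (2 * Real.pi * I * (w + n * τ))‖ := fun n =>
    norm_pos_iff.2 (sub_ne_zero.2 (exp_two_pi_I_ne_one fun b => hw n b).symm)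
  have hev : ∀ᶠ n : ℤ in Filter.cofinite,
      (1 / 2 : ℝ) ≤ ‖1 - cexp (2 * Real.pi * I * (w + n * τ))‖ := by
    refine (finite_setOf_abs_int_le ((1 + |w.im|) / τ.im)).subset fun n hn => ?_
    by_contra hn'
    apply hn
    have hn' : (1 + |w.im|) / τ.im < |(n : ℝ)| := not_le.1 hn'
    rw [div_lt_iff₀ hτ] at hn'
    have habs : 1 ≤ |w.im + n * τ.im| := by
      have h1 := abs_sub_abs_le_abs_sub (n * τ.im) (-w.im)
      rw [abs_neg, abs_mul, abs_of_pos hτ, sub_neg_eq_add, add_comm] at h1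
      rw [add_comm] at h1 ⊢
      rw [add_comm (n * τ.im)] at *
      linarith
    have hnorm : ‖cexp (2 * Real.pi * I * (w + n * τ))‖
        = Real.exp (2 * Real.pi * -(w.im + n * τ.im)) := by
      rw [Complex.norm_exp]
      congr 1
      simp
      ring
    have htri := abs_norm_sub_norm_le 1 (cexp (2 * Real.pi * I * (w + n * τ)))
    refine le_trans ?_ htri
    rw [hnorm, norm_one]
    have hpi := Real.pi_gt_three
    rcases le_abs'.1 habs with h | h
    · have h2 := Real.add_one_le_exp (2 * Real.pi * -(w.im + n * τ.im))
      rw [abs_sub_comm]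
      refine le_trans ?_ (le_abs_self _)
      nlinarith
    · have h2 := Real.add_one_le_exp (2 * Real.pi * (w.im + n * τ.im))
      have h3 : Real.exp (2 * Real.pi * -(w.im + n * τ.im)) ≤ 1 / 2 := by
        rw [mul_neg, Real.exp_neg, inv_eq_one_div]
        exact one_div_le_one_div_of_le two_pos (by nlinarith)
      refine le_trans ?_ (le_abs_self _)
      linarith
  obtain ⟨ε, hε, hle⟩ := exists_pos_le_of_eventually hne one_half_pos hev
  exact ⟨ε⁻¹, inv_pos.2 hε, fun n => by rw [norm_inv]; exact inv_anti₀ hε (hle n)⟩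

section RankOne

variable {m : ℕ} {τ z₁ z₂ : ℂ}

/-- The exponential factor `exp (2 π i m a (z₁ + z₂)) q ^ (m a²)`. -/
noncomputable def appellFactor (m : ℕ) (τ z₁ z₂ : ℂ) (a : ℤ) : ℂ :=
  cexp (2 * Real.pi * I * (m * a * (z₁ + z₂) + m * a ^ 2 * τ))

theorem Phi_eq_tsum (m : ℕ) (s : ℤ) (τ z₁ z₂ : ℂ) :
    Phi m s τ z₁ z₂ = ∑' a : ℤ, appellFactor m τ z₁ z₂ a
      * (cexp (2 * Real.pi * I * (z₁ + a * τ)) ^ s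
        / (1 - cexp (2 * Real.pi * I * (z₁ + a * τ)))) := by
  refine tsum_congr fun a => ?_
  rw [← mul_div_assoc]
  unfold appellFactor qpow
  rw [← Complex.exp_int_mul, ← Complex.exp_add, ← Complex.exp_add, ← Complex.exp_add]
  congr 2
  · ring
  · congr 2
    ring

theorem summable_Phi (hm : 0 < m) (hτ : 0 < τ.im) (hz : OffLattice τ z₁) (s : ℤ) (z₂ : ℂ) :
    Summable fun a : ℤ => appellFactor m τ z₁ z₂ a
      * (cexp (2 * Real.pi * I * (z₁ + a * τ)) ^ s
        / (1 - cexp (2 * Real.pi * I * (z₁ + a * τ)))) := by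
  obtain ⟨C, _, hC⟩ := exists_norm_inv_one_sub_le hτ hz
  have hm' : (0 : ℝ) < m := by exact_mod_cast hm
  refine Summable.of_norm_bounded (((summable_exp_quadratic
    (a := 2 * Real.pi * m * τ.im) (by positivity)
    (-(2 * Real.pi * (m * (z₁ + z₂).im + s * τ.im)))).mul_left
      (Real.exp (-(2 * Real.pi * s * z₁.im)))).mul_right C) fun a => ?_
  rw [div_eq_mul_inv, ← mul_assoc, norm_mul]
  refine mul_le_mul (le_of_eq ?_) (hC a) (norm_nonneg _) (by positivity)
  rw [appellFactor, ← Complex.exp_int_mul, ← Complex.exp_add, Complex.norm_exp, ← Real.exp_add]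
  congr 1
  simp [sq]
  ring

/-- The general term of `Φ_add`, after reordering. -/
noncomputable def addTerm (m : ℕ) (s : ℤ) (τ z₁ z₂ : ℂ) (p : ℤ × ℤ) : ℂ :=
  appellFactor m τ z₁ z₂ p.1
    * (((sgnFrom s p.2 - errE ((p.2 - 2 * m * ((z₁ - z₂) / 2).im / τ.im) * √(τ.im / m)) : ℝ) : ℂ)
      * cexp (2 * Real.pi * I * p.2 * (z₁ + p.1 * τ)))

theorem summable_addTerm (hm : 0 < m) (hτ : 0 < τ.im) (s : ℤ) (z₁ z₂ : ℂ) :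
    Summable (addTerm m s τ z₁ z₂) := by
  have hm' : (0 : ℝ) < m := by exact_mod_cast hm
  have hκ : 0 < τ.im / m := by positivity
  set ρ := 2 * m * ((z₁ - z₂) / 2).im / τ.im with hρ
  set κ := τ.im / m with hκd
  obtain ⟨C, hC⟩ := abs_sgnFrom_sub_errE_le s hκ ρ
  have hC0 : 0 ≤ C := by
    have := (abs_nonneg _).trans (hC 0)
    exact nonneg_of_mul_nonneg_left this (Real.exp_pos _)
  set B := 2 * Real.pi * κ * ρ - 2 * Real.pi * z₁.im with hB
  have h1 := (summable_exp_quadratic (a := Real.pi * κ * m ^ 2) (by positivity)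
    (-2 * Real.pi * m * (z₁ + z₂).im - B * m)).mul_of_nonneg
    (summable_exp_quadratic (a := Real.pi * κ) (by positivity) B)
    (fun _ => (Real.exp_pos _).le) (fun _ => (Real.exp_pos _).le)
  -- The shear completes the square: 2m²a² + 2man + n² = (n + ma)² + m²a². The majorant becomes a
  -- product of two one-dimensional Gaussians.
  let e : ℤ × ℤ ≃ ℤ × ℤ :=
    { toFun := fun p => (p.1, p.2 + m * p.1)
      invFun := fun p => (p.1, p.2 - m * p.1)
      left_inv := fun p => by simp
      right_inv := fun p => by simp }
  refine Summable.of_norm_bounded ((e.summable_iff.2 h1).mul_left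
    (C * Real.exp (-Real.pi * κ * ρ ^ 2))) fun p => ?_
  obtain ⟨a, n⟩ := p
  rw [addTerm, norm_mul, norm_mul, Complex.norm_real, Real.norm_eq_abs, mul_left_comm]
  refine (mul_le_mul_of_nonneg_right (hC n) (by positivity)).trans (le_of_eq ?_)
  rw [appellFactor, Complex.norm_exp, Complex.norm_exp]
  simp only [Function.comp_apply, e, Equiv.coe_fn_mk]
  rw [mul_assoc C, ← Real.exp_add, ← Real.exp_add, mul_assoc C, ← Real.exp_add, ← Real.exp_add]
  congr 2
  have hκm : κ * m = τ.im := by rw [hκd]; field_simp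
  have e1 : (2 * Real.pi * I * (m * a * (z₁ + z₂) + m * a ^ 2 * τ) : ℂ).re
      = -(2 * Real.pi * (m * a * (z₁ + z₂).im + m * a ^ 2 * (κ * m))) := by
    rw [hκm]; simp [sq]
  have e2 : (2 * Real.pi * I * n * (z₁ + a * τ) : ℂ).re
      = -(2 * Real.pi * n * (z₁.im + a * (κ * m))) := by
    rw [hκm]; simp
  rw [e1, e2, hB]
  push_cast
  ring

/-- The argument of the sign is 2m(l + 1) - 1/2, which never vanishes and is positive exactly for l
≥ 0; since 0 ≤ j < 2m, this means that the index is at least s. The sign thus no longer refers to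
the residue class, and all the classes can be merged into one sum. -/
theorem sign_sub_half_add (hm : 0 < m) (s : ℤ) (j : Fin (2 * m)) (l : ℤ) :
    Real.sign (((s + j + 2 * m * l : ℤ) : ℝ) - 1 / 2 - (s + j : ℤ) + 2 * m)
      = sgnFrom s (s + j + 2 * m * l) := by
  have hm' : (1 : ℝ) ≤ m := by exact_mod_cast hm
  have hj : (j : ℤ) < 2 * m := by exact_mod_cast j.2
  have h0 : (((s + j + 2 * m * l : ℤ) : ℝ) - 1 / 2 - (s + j : ℤ) + 2 * m)
      = 2 * m * ((l + 1 : ℤ) : ℝ) - 1 / 2 := by push_cast; ring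
  rw [h0, sgnFrom]
  rcases le_or_gt 0 l with hl | hl
  · have h1 : (1 : ℝ) ≤ ((l + 1 : ℤ) : ℝ) := by exact_mod_cast (by omega : 1 ≤ l + 1)
    rw [Real.sign_of_pos (by nlinarith), if_pos]
    have : 0 ≤ 2 * (m : ℤ) * l := by positivity
    omega
  · have h1 : ((l + 1 : ℤ) : ℝ) ≤ 0 := by exact_mod_cast (by omega : l + 1 ≤ 0)
    rw [Real.sign_of_neg (by nlinarith), if_neg]
    have : 2 * (m : ℤ) * l ≤ 2 * m * (-1) := by
      apply mul_le_mul_of_nonneg_left (by omega) (by positivity)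
    omega

/-- The reordering `(j, l, a') ↦ (a' - l, s + j + 2 m l)`. -/
noncomputable def addEquiv (m : ℕ) [NeZero (2 * m)] (s : ℤ) :
    Fin (2 * m) × (ℤ × ℤ) ≃ ℤ × ℤ where
  toFun x := (x.2.2 - x.2.1, s + ((Int.divModEquiv (2 * m)).symm (x.2.1, x.1)))
  invFun p := (((Int.divModEquiv (2 * m)) (p.2 - s)).2,
    (((Int.divModEquiv (2 * m)) (p.2 - s)).1, p.1 + ((Int.divModEquiv (2 * m)) (p.2 - s)).1))
  left_inv x := by
    simp only [add_sub_cancel_left, Equiv.apply_symm_apply, sub_add_cancel]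
  right_inv p := by
    simp only [Prod.mk.eta, Equiv.symm_apply_apply, add_sub_cancel_right, add_sub_cancel]

theorem addTerm_addEquiv (hm : 0 < m) [NeZero (2 * m)] (s : ℤ) (j : Fin (2 * m)) (l a : ℤ)
    (τ z₁ z₂ : ℂ) :
    addTerm m s τ z₁ z₂ (addEquiv m s (j, (l, a)))
      = RTerm m (s + j) (s + j + 2 * m * l) τ ((z₁ - z₂) / 2)
        * (cexp (2 * Real.pi * I * m * (z₁ + z₂) * (a + (s + j : ℤ) / (2 * m)))
          * qpow τ (m * (a + (s + j : ℤ) / (2 * m)) ^ 2)) := by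
  have hm' : (m : ℂ) ≠ 0 := by exact_mod_cast hm.ne'
  have h1 : (addEquiv m s (j, (l, a))) = (a - l, s + j + 2 * m * l) := by
    simp only [addEquiv, Equiv.coe_fn_mk, Int.divModEquiv, Equiv.coe_fn_symm_mk]
    congr 1
    push_cast
    ring
  rw [h1, addTerm, RTerm, sign_sub_half_add hm, psi]
  rw [show 2 * (m : ℝ) * (((z₁ - z₂) / 2).im / τ.im) = 2 * m * ((z₁ - z₂) / 2).im / τ.im by ring]
  rw [mul_left_comm, mul_assoc (Complex.ofReal _)]
  refine congrArg₂ _ rfl ?_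
  rw [appellFactor, qpow, ← Complex.exp_add, ← Complex.exp_add, ← Complex.exp_add]
  congr 1
  push_cast
  field_simp
  ring

theorem PhiAdd_eq_tsum (hm : 0 < m) (hτ : 0 < τ.im) (s : ℤ) (z₁ z₂ : ℂ) :
    PhiAdd m s τ z₁ z₂ = ∑' p, addTerm m s τ z₁ z₂ p := by
  have : NeZero (2 * m) := ⟨by omega⟩
  have hS : Summable fun x => addTerm m s τ z₁ z₂ (addEquiv m s x) :=
    (addEquiv m s).summable_iff.2 (summable_addTerm hm hτ s z₁ z₂)
  rw [← (addEquiv m s).tsum_eq, hS.tsum_prod, tsum_fintype, PhiAdd]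
  have hsum : ∀ f : ℤ → ℂ, ∑ j ∈ Finset.Ico s (s + 2 * m), f j
      = ∑ j : Fin (2 * m), f (s + j) := fun f => by
    rw [Int.Ico_eq_finset_map, Finset.sum_map, show (s + 2 * m - s).toNat = 2 * m by omega]
    exact (Fin.sum_univ_eq_sum_range (fun i : ℕ => f (s + i)) (2 * m)).symm
  rw [hsum]
  refine Finset.sum_congr rfl fun j _ => ?_
  rw [(hS.prod_factor j).tsum_prod, RFun, ← tsum_mul_right]
  refine tsum_congr fun l => ?_
  rw [jacobiForm, ← tsum_mul_left]
  exact tsum_congr fun a => (addTerm_addEquiv hm s j l a τ z₁ z₂).symm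

/-- The term with index `(a, b)` of the expansion of `Φ̃^{[m;s]}` over the lattice `ℤ τ + ℤ`. -/
noncomputable def latticeTerm (m : ℕ) (τ z₁ z₂ : ℂ) (p : ℤ × ℤ) : ℂ :=
  -(1 / (2 * Real.pi * I)) *
    (cexp (-(Real.pi * m / τ.im) * (z₁ * z₂ + (starRingEnd ℂ) (p.1 * τ + p.2) * z₂
      + (z₁ + (p.1 * τ + p.2)) * (starRingEnd ℂ) (z₁ + (p.1 * τ + p.2) - z₂)))
      / (z₁ + (p.1 * τ + p.2)))

theorem latticeTerm_eq (hm : 0 < m) (hτ : 0 < τ.im) (z₁ z₂ : ℂ) (a b : ℤ) :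
    latticeTerm m τ z₁ z₂ (a, b) = appellFactor m τ z₁ z₂ a * (-(1 / (2 * Real.pi * I))
      * gaussPole (τ.im / m) (2 * m * ((z₁ - z₂) / 2).im / τ.im) (z₁ + a * τ + b)) := by
  have hm' : (m : ℂ) ≠ 0 := by exact_mod_cast hm.ne'
  have hy : (τ.im : ℂ) ≠ 0 := by exact_mod_cast hτ.ne'
  rw [latticeTerm, gaussPole, mul_left_comm, ← mul_div_assoc (appellFactor _ _ _ _ _), appellFactor,
    ← Complex.exp_add,
    ← add_assoc]
  congr 2
  -- The exponents agree only modulo 2πi; the cross term of aτ and b accounts for 2πi·mab.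
  refine Complex.exp_eq_exp_iff_exists_int.2 ⟨m * a * b, ?_⟩
  have hc : ∀ w : ℂ, (starRingEnd ℂ) w = w - 2 * w.im * I := fun w => by
    have := Complex.sub_conj w
    push_cast at this
    linear_combination -this
  simp only [map_add, map_sub, map_mul, map_intCast]
  rw [hc z₁, hc z₂, hc τ]
  have h2 : ((z₁ - z₂) / 2).im = (z₁.im - z₂.im) / 2 := by simp
  rw [h2]
  push_cast
  field_simp
  linear_combination (0 : ℂ) * I_sq

end RankOne
section RankOne

variable {m : ℕ} {τ z₁ z₂ : ℂ}

/-- The terms linear in g, namely ḡz₂ and -gz̄₂, add up to a purely imaginary number. The modulus is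
therefore a Gaussian in |z₁ + g|. -/
theorem norm_exp_latticeTerm (m : ℕ) (τ z₁ z₂ g : ℂ) :
    ‖cexp (-(Real.pi * m / τ.im) * (z₁ * z₂ + (starRingEnd ℂ) g * z₂
      + (z₁ + g) * (starRingEnd ℂ) (z₁ + g - z₂)))‖
      = Real.exp (-(Real.pi * m / τ.im) * (‖z₁ + g‖ ^ 2 - 2 * z₁.im * z₂.im)) := by
  rw [Complex.norm_exp]
  congr 1
  have h : (-(Real.pi * m / τ.im) : ℂ) = ((-(Real.pi * m / τ.im) : ℝ) : ℂ) := by push_cast; ring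
  rw [h, re_ofReal_mul]
  congr 1
  rw [Complex.sq_norm, Complex.normSq_apply]
  simp
  ring

/-- The imaginary part of aτ + b controls a, and b² ≤ 2(a Re τ + b)² + 2(a Re τ)² then controls b.
-/
theorem sq_add_sq_le (hτ : 0 < τ.im) (a b : ℝ) :
    a ^ 2 + b ^ 2 ≤ (2 + (2 * τ.re ^ 2 + 1) / τ.im ^ 2) * ‖(a * τ + b : ℂ)‖ ^ 2 := by
  rw [Complex.sq_norm, Complex.normSq_apply]
  simp only [add_re, mul_re, ofReal_re, ofReal_im, add_im, mul_im, zero_mul, sub_zero, add_zero]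
  have h1 : (2 * τ.re ^ 2 + 1) / τ.im ^ 2 * (a * τ.im * (a * τ.im)) = (2 * τ.re ^ 2 + 1) * a ^ 2 := by
    field_simp
  have h2 : 0 ≤ (2 * τ.re ^ 2 + 1) / τ.im ^ 2 * ((a * τ.re + b) * (a * τ.re + b)) := by
    have := mul_self_nonneg (a * τ.re + b)
    positivity
  have h3 := mul_self_nonneg (a * τ.im)
  nlinarith [sq_nonneg (2 * a * τ.re + b)]

theorem norm_sq_le_two_mul (z g : ℂ) : ‖g‖ ^ 2 ≤ 2 * ‖z + g‖ ^ 2 + 2 * ‖z‖ ^ 2 := by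
  have h : ‖g‖ ≤ ‖z + g‖ + ‖z‖ := by simpa using norm_sub_le (z + g) z
  have := norm_nonneg g
  nlinarith [sq_nonneg (‖z + g‖ - ‖z‖)]

theorem finite_setOf_norm_le (hτ : 0 < τ.im) (z : ℂ) (C : ℝ) :
    {p : ℤ × ℤ | ‖z + (p.1 * τ + p.2)‖ ≤ C}.Finite := by
  set K := 2 + (2 * τ.re ^ 2 + 1) / τ.im ^ 2 with hK
  have hK0 : 0 ≤ K := by positivity
  set D := K * (2 * C ^ 2 + 2 * ‖z‖ ^ 2) with hD
  refine ((finite_setOf_abs_int_le (1 + D)).prod (finite_setOf_abs_int_le (1 + D))).subset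
    fun p hp => ?_
  have h1 := sq_add_sq_le hτ p.1 p.2
  have h2 := norm_sq_le_two_mul z (p.1 * τ + p.2)
  have h3 : ‖z + (p.1 * τ + p.2)‖ ^ 2 ≤ C ^ 2 := pow_le_pow_left₀ (norm_nonneg _) hp 2
  have h4 : (p.1 : ℝ) ^ 2 + (p.2 : ℝ) ^ 2 ≤ D := by
    refine h1.trans (mul_le_mul_of_nonneg_left ?_ hK0)
    push_cast
    linarith
  refine ⟨?_, ?_⟩
  · show |(p.1 : ℝ)| ≤ 1 + D
    nlinarith [sq_abs (p.1 : ℝ), sq_nonneg (|(p.1 : ℝ)| - 1), sq_nonneg (p.2 : ℝ),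
      abs_nonneg (p.1 : ℝ)]
  · show |(p.2 : ℝ)| ≤ 1 + D
    nlinarith [sq_abs (p.2 : ℝ), sq_nonneg (|(p.2 : ℝ)| - 1), sq_nonneg (p.1 : ℝ),
      abs_nonneg (p.2 : ℝ)]

/-- For all but finitely many lattice points the denominator has modulus at least 1 and can be
dropped, leaving a Gaussian. -/
theorem summable_latticeTerm (hm : 0 < m) (hτ : 0 < τ.im) (z₁ z₂ : ℂ) :
    Summable (latticeTerm m τ z₁ z₂) := by
  have hm' : (0 : ℝ) < m := by exact_mod_cast hm
  refine Summable.mul_left _ ?_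
  set K := 2 + (2 * τ.re ^ 2 + 1) / τ.im ^ 2 with hK
  have hK0 : 0 < K := by positivity
  set c := Real.pi * m / τ.im with hc
  have hc0 : 0 < c := by positivity
  have hg := summable_exp_quadratic (a := c / (2 * K)) (by positivity) 0
  have h1 := (hg.mul_of_nonneg hg (fun _ => (Real.exp_pos _).le)
    (fun _ => (Real.exp_pos _).le)).mul_left (Real.exp (c * (‖z₁‖ ^ 2 + 2 * z₁.im * z₂.im)))
  refine Summable.of_norm_bounded_eventually h1 ?_
  refine (finite_setOf_norm_le hτ z₁ 1).subset fun p hp => ?_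
  by_contra hp'
  apply hp
  have hp1 : 1 ≤ ‖z₁ + (p.1 * τ + p.2)‖ := (not_le.1 hp').le
  show ‖_‖ ≤ _
  rw [norm_div]
  refine (div_le_self (norm_nonneg _) hp1).trans ?_
  rw [norm_exp_latticeTerm, ← Real.exp_add, ← Real.exp_add, Real.exp_le_exp, ← hc]
  have h2 := sq_add_sq_le hτ p.1 p.2
  have h3 := norm_sq_le_two_mul z₁ (p.1 * τ + p.2)
  rw [← hK] at h2
  have h4 : ((p.1 : ℝ) ^ 2 + (p.2 : ℝ) ^ 2) / K ≤ 2 * ‖z₁ + (p.1 * τ + p.2)‖ ^ 2 + 2 * ‖z₁‖ ^ 2 := by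
    rw [div_le_iff₀ hK0, mul_comm]
    refine h2.trans (mul_le_mul_of_nonneg_left ?_ hK0.le)
    push_cast
    exact h3
  have h5 := mul_le_mul_of_nonneg_left h4 hc0.le
  have h6 : c * (‖z₁‖ ^ 2 + 2 * z₁.im * z₂.im)
      + (-(c / (2 * K)) * p.1 ^ 2 + 0 * p.1 + (-(c / (2 * K)) * p.2 ^ 2 + 0 * p.2))
      = c * (‖z₁‖ ^ 2 + 2 * z₁.im * z₂.im)
        - c * (((p.1 : ℝ) ^ 2 + (p.2 : ℝ) ^ 2) / K) / 2 := by
    field_simp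
    ring
  rw [h6]
  linarith

/-- The modified mock theta function of rank one is an absolutely convergent sum over the lattice
`ℤ τ + ℤ`. -/
theorem PhiMod_eq_tsum (hm : 0 < m) (hτ : 0 < τ.im) (hz : OffLattice τ z₁) (s : ℤ) (z₂ : ℂ) :
    PhiMod m s τ z₁ z₂ = ∑' p, latticeTerm m τ z₁ z₂ p := by
  have hm' : (0 : ℝ) < m := by exact_mod_cast hm
  have hκ : 0 < τ.im / m := by positivity
  have hA := summable_addTerm hm hτ s z₁ z₂
  rw [PhiMod, Phi_eq_tsum, PhiAdd_eq_tsum hm hτ, hA.tsum_prod, ← tsum_mul_left,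
    ← (summable_Phi hm hτ hz s z₂).tsum_sub (hA.prod.mul_left _),
    (summable_latticeTerm hm hτ z₁ z₂).tsum_prod]
  refine tsum_congr fun a => ?_
  -- For fixed a, the term of Φ minus half the sum over n of the correction is `appellFactor` times
  -- the completed geometric series at ζ = z₁ + aτ. The centre ρ is the same for every a.
  have h := geomCompletion_eq s hκ (ζ := z₁ + a * τ) (fun b => hz a b)
    (2 * m * ((z₁ - z₂) / 2).im / τ.im)
  simp_rw [latticeTerm_eq hm hτ, tsum_mul_left]
  rw [← h, geomCompletion]
  simp_rw [addTerm, tsum_mul_left]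
  ring

/-- The lattice sum does not contain s. -/
theorem PhiMod_eq_of_charge (hm : 0 < m) (hτ : 0 < τ.im) (hz : OffLattice τ z₁) (s s' : ℤ)
    (z₂ : ℂ) : PhiMod m s τ z₁ z₂ = PhiMod m s' τ z₁ z₂ := by
  rw [PhiMod_eq_tsum hm hτ hz, PhiMod_eq_tsum hm hτ hz]

theorem OffLattice.add_one (hz : OffLattice τ z₁) : OffLattice (τ + 1) z₁ := fun a b => by
  have := hz a (b + a)
  push_cast at this
  convert this using 1
  ring

/-- The lattice ℤτ + ℤ and Im τ are unchanged; only the basis of the lattice moves. -/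
theorem PhiMod_add_one (hm : 0 < m) (hτ : 0 < τ.im) (hz : OffLattice τ z₁) (s : ℤ) (z₂ : ℂ) :
    PhiMod m s (τ + 1) z₁ z₂ = PhiMod m s τ z₁ z₂ := by
  have him : (τ + 1).im = τ.im := by simp
  rw [PhiMod_eq_tsum hm (by simpa using hτ) hz.add_one, PhiMod_eq_tsum hm hτ hz]
  let e : ℤ × ℤ ≃ ℤ × ℤ :=
    { toFun := fun p => (p.1, p.2 + p.1)
      invFun := fun p => (p.1, p.2 - p.1)
      left_inv := fun p => by simp
      right_inv := fun p => by simp }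
  rw [← e.tsum_eq (latticeTerm m τ z₁ z₂)]
  refine tsum_congr fun p => ?_
  have h : (p.1 : ℂ) * (τ + 1) + p.2 = (e p).1 * τ + (e p).2 := by
    simp only [e, Equiv.coe_fn_mk]
    push_cast
    ring
  simp only [latticeTerm, him, h]

/-- Each term is multiplied by e^{-2πimc(z₁ + b)} with b the second lattice coordinate, and
e^{-2πimcb} = 1. -/
theorem PhiMod_add_int_mul (hm : 0 < m) (hτ : 0 < τ.im) (hz : OffLattice τ z₁) (s : ℤ) (z₂ : ℂ)
    (c : ℤ) : PhiMod m s τ z₁ (z₂ + c * τ)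
      = cexp (-(2 * Real.pi * I * m * c * z₁)) * PhiMod m s τ z₁ z₂ := by
  have hy : (τ.im : ℂ) ≠ 0 := by exact_mod_cast hτ.ne'
  rw [PhiMod_eq_tsum hm hτ hz, PhiMod_eq_tsum hm hτ hz, ← tsum_mul_left]
  refine tsum_congr fun p => ?_
  rw [latticeTerm, latticeTerm, mul_left_comm, ← mul_div_assoc (cexp _), ← Complex.exp_add]
  congr 2
  refine Complex.exp_eq_exp_iff_exists_int.2 ⟨-(m * c * p.2), ?_⟩
  have hc : (starRingEnd ℂ) τ = τ - 2 * τ.im * I := by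
    have := Complex.sub_conj τ
    push_cast at this
    linear_combination -this
  simp only [map_add, map_sub, map_mul, map_intCast]
  rw [hc]
  push_cast
  field_simp
  ring

theorem OffLattice.inv (hτ : 0 < τ.im) (hz : OffLattice τ z₁) : OffLattice (-1 / τ) (z₁ / τ) :=
  fun a b h => by
    have hτ0 : τ ≠ 0 := fun h => by simp [h] at hτ
    apply hz b (-a)
    have h2 : τ * (z₁ / τ + a * (-1 / τ) + b) = 0 := by rw [h, mul_zero]
    field_simp at h2
    push_cast
    linear_combination h2

theorem im_neg_one_div (τ : ℂ) : (-1 / τ).im = τ.im / Complex.normSq τ := by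
  rw [neg_div, one_div, neg_im, inv_im]
  ring

/-- The lattice of -1/τ is τ⁻¹(ℤτ + ℤ), so the pole gives the factor τ. In the exponent, 1/Im(-1/τ)
= |τ|²/Im τ absorbs the scaling of all products of a number with a conjugate. Only z₁z₂ scales by
τ⁻² instead, and τ̄/τ - 1 = -2i Im τ/τ gives the exponential factor. -/
theorem PhiMod_neg_one_div (hm : 0 < m) (hτ : 0 < τ.im) (hz : OffLattice τ z₁) (s : ℤ) (z₂ : ℂ) :
    PhiMod m s (-1 / τ) (z₁ / τ) (z₂ / τ)
      = τ * cexp (2 * Real.pi * I * m * z₁ * z₂ / τ) * PhiMod m s τ z₁ z₂ := by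
  have hy : (τ.im : ℂ) ≠ 0 := by exact_mod_cast hτ.ne'
  have hτ0 : τ ≠ 0 := fun h => by simp [h] at hτ
  have hc0 : (starRingEnd ℂ) τ ≠ 0 := by simpa using hτ0
  have hn : (Complex.normSq τ : ℂ) = τ * (starRingEnd ℂ) τ := (Complex.mul_conj τ).symm
  have him : ((-1 / τ).im : ℂ) = τ.im / (τ * (starRingEnd ℂ) τ) := by
    rw [im_neg_one_div, ← hn]; push_cast; ring
  have hτ' : 0 < (-1 / τ).im := by
    rw [im_neg_one_div]
    exact div_pos hτ (Complex.normSq_pos.2 hτ0)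
  rw [PhiMod_eq_tsum hm hτ' (hz.inv hτ), PhiMod_eq_tsum hm hτ hz, ← tsum_mul_left]
  let e : ℤ × ℤ ≃ ℤ × ℤ :=
    { toFun := fun p => (p.2, -p.1)
      invFun := fun p => (-p.2, p.1)
      left_inv := fun p => by simp
      right_inv := fun p => by simp }
  rw [← e.tsum_eq (fun p => τ * cexp (2 * Real.pi * I * m * z₁ * z₂ / τ)
    * latticeTerm m τ z₁ z₂ p)]
  refine tsum_congr fun p => ?_
  obtain ⟨a, b⟩ := p
  simp only [latticeTerm, e, Equiv.coe_fn_mk, him]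
  have hg : (a : ℂ) * (-1 / τ) + b = (b * τ + ((-a : ℤ) : ℂ)) / τ := by
    push_cast
    field_simp
    ring
  rw [hg]
  set g : ℂ := b * τ + ((-a : ℤ) : ℂ) with hgd
  rw [← add_div, div_div_eq_mul_div, mul_assoc τ, mul_left_comm (cexp _),
    ← mul_div_assoc (cexp _), ← Complex.exp_add, mul_left_comm τ, ← mul_div_assoc τ,
    mul_comm _ τ]
  congr 4
  rw [← sub_div]
  simp only [map_div₀]
  have hc : (starRingEnd ℂ) τ = τ - 2 * τ.im * I := by
    have := Complex.sub_conj τ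
    push_cast at this
    linear_combination -this
  generalize (starRingEnd ℂ) (z₁ + g - z₂) = x
  generalize (starRingEnd ℂ) g = x'
  field_simp
  rw [hc]
  ring

end RankOne
open Matrix

/-! ## Gaussian sums over `ℤ ^ ι` -/

section Gaussian

variable {ι : Type*} [Fintype ι]

/-- A finite set of vectors lies in the box formed by its coordinate projections, and the sum over a
box is a product of one-dimensional sums. -/
theorem summable_prod_apply {f : ι → ℤ → ℝ} (hf : ∀ i n, 0 ≤ f i n) (hs : ∀ i, Summable (f i)) :
    Summable fun v : ι → ℤ => ∏ i, f i (v i) := by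
  classical
  refine summable_of_sum_le (c := ∏ i, ∑' n, f i n)
    (fun v => Finset.prod_nonneg fun i _ => hf i _) fun u => ?_
  have hsub : u ⊆ Fintype.piFinset fun i => u.image fun v => v i := fun v hv =>
    Fintype.mem_piFinset.2 fun i => Finset.mem_image_of_mem _ hv
  refine (Finset.sum_le_sum_of_subset_of_nonneg hsub
    fun v _ _ => Finset.prod_nonneg fun i _ => hf i _).trans ?_
  rw [← Finset.prod_univ_sum (fun i => u.image fun v => v i) f]
  exact Finset.prod_le_prod (fun i _ => Finset.sum_nonneg fun n _ => hf i n)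
    fun i _ => (hs i).sum_le_tsum _ fun n _ => hf i n

/-- The form has a positive minimum on the compact unit sphere and is homogeneous of degree two. -/
theorem exists_mul_sum_sq_le {A : Matrix ι ι ℝ} (hA : A.PosDef) :
    ∃ ε : ℝ, 0 < ε ∧ ∀ x : ι → ℝ, ε * ∑ i, x i ^ 2 ≤ x ⬝ᵥ A *ᵥ x := by
  set K : Set (ι → ℝ) := {x | ∑ i, x i ^ 2 = 1} with hK
  have hcomp : IsCompact K := by
    refine Metric.isCompact_of_isClosed_isBounded
      (isClosed_eq (by fun_prop) continuous_const) ?_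
    refine (Metric.isBounded_closedBall (x := (0 : ι → ℝ)) (r := 1)).subset fun x hx => ?_
    rw [mem_closedBall_zero_iff, pi_norm_le_iff_of_nonneg zero_le_one]
    intro i
    have h1 : x i ^ 2 ≤ 1 := by
      rw [← show ∑ i, x i ^ 2 = 1 from hx]
      exact Finset.single_le_sum (f := fun i => x i ^ 2) (fun i _ => sq_nonneg _)
        (Finset.mem_univ i)
    rw [Real.norm_eq_abs]
    exact (sq_le_one_iff_abs_le_one _).1 h1
  have hscale : ∀ (c : ℝ) (x : ι → ℝ), (c • x) ⬝ᵥ A *ᵥ (c • x) = c ^ 2 * (x ⬝ᵥ A *ᵥ x) := by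
    intro c x
    rw [mulVec_smul, dotProduct_smul, smul_dotProduct, smul_smul, smul_eq_mul, sq]
  have hpos : ∀ x : ι → ℝ, x ≠ 0 → 0 < x ⬝ᵥ A *ᵥ x := fun x hx => by
    simpa using hA.dotProduct_mulVec_pos hx
  have hred : ∀ ε : ℝ, (∀ x ∈ K, ε ≤ x ⬝ᵥ A *ᵥ x) →
      ∀ x : ι → ℝ, ε * ∑ i, x i ^ 2 ≤ x ⬝ᵥ A *ᵥ x := by
    intro ε h x
    by_cases hx : x = 0
    · simp [hx]
    have hs : 0 < ∑ i, x i ^ 2 := by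
      obtain ⟨i, hi⟩ := Function.ne_iff.1 hx
      have hi' : x i ≠ 0 := hi
      exact Finset.sum_pos' (fun i _ => sq_nonneg _) ⟨i, Finset.mem_univ _, by positivity⟩
    have h1 := h ((√(∑ i, x i ^ 2))⁻¹ • x) (by
      show ∑ i, _ = _
      simp only [Pi.smul_apply, smul_eq_mul, mul_pow, ← Finset.mul_sum, inv_pow,
        Real.sq_sqrt hs.le]
      exact inv_mul_cancel₀ hs.ne')
    rw [hscale, inv_pow, Real.sq_sqrt hs.le, ← div_eq_inv_mul, le_div_iff₀ hs] at h1
    exact h1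
  rcases K.eq_empty_or_nonempty with h0 | h0
  · exact ⟨1, one_pos, hred 1 (by simp [h0])⟩
  · obtain ⟨x₀, hx₀, hmin⟩ := hcomp.exists_isMinOn h0
      (f := fun x : ι → ℝ => x ⬝ᵥ A *ᵥ x) (by
        simp only [dotProduct, mulVec]
        fun_prop)
    refine ⟨_, hpos x₀ ?_, hred _ fun x hx => hmin hx⟩
    rintro rfl
    simp [hK] at hx₀

theorem summable_exp_neg_quadratic_form {A : Matrix ι ι ℝ} (hA : A.PosDef) (b : ι → ℝ) :
    Summable fun v : ι → ℤ => Real.exp (-((fun i => (v i : ℝ)) ⬝ᵥ A *ᵥ fun i => (v i : ℝ))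
      + ∑ i, b i * v i) := by
  obtain ⟨ε, hε, hle⟩ := exists_mul_sum_sq_le hA
  refine Summable.of_nonneg_of_le (fun v => (Real.exp_pos _).le) (fun v => ?_)
    (summable_prod_apply (f := fun i n => Real.exp (-ε * n ^ 2 + b i * n))
      (fun i n => (Real.exp_pos _).le) fun i => summable_exp_quadratic hε (b i))
  rw [← Real.exp_sum, Real.exp_le_exp, Finset.sum_add_distrib, ← Finset.mul_sum]
  linarith [hle fun i => (v i : ℝ)]

/-- An integral vector as a complex vector. -/
def intVec (v : ι → ℤ) : ι → ℂ := fun i => v i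

/-- The complexification of the quadratic form with matrix `A`. -/
noncomputable def quadForm (A : Matrix ι ι ℝ) (x : ι → ℂ) : ℂ := x ⬝ᵥ A.map Complex.ofReal *ᵥ x

theorem quadForm_intVec (A : Matrix ι ι ℝ) (v : ι → ℤ) :
    quadForm A (intVec v) = (((fun i => (v i : ℝ)) ⬝ᵥ A *ᵥ fun i => (v i : ℝ) : ℝ) : ℂ) := by
  simp [quadForm, intVec, dotProduct, mulVec]

theorem norm_cexp_quadForm (A : Matrix ι ι ℝ) (τ : ℂ) (w : ι → ℂ) (v : ι → ℤ) :
    ‖cexp (Real.pi * I * τ * quadForm A (intVec v) + 2 * Real.pi * I * (intVec v ⬝ᵥ w))‖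
      = Real.exp (-((fun i => (v i : ℝ)) ⬝ᵥ ((Real.pi * τ.im) • A) *ᵥ fun i => (v i : ℝ))
        + ∑ i, (-(2 * Real.pi * (w i).im)) * v i) := by
  rw [Complex.norm_exp, quadForm_intVec, smul_mulVec, dotProduct_smul]
  generalize (fun i => (v i : ℝ)) ⬝ᵥ A *ᵥ (fun i => (v i : ℝ)) = q
  have h : ((intVec v) ⬝ᵥ w).im = ∑ i, (w i).im * v i := by
    simp [dotProduct, intVec, mul_comm]
  congr 1
  have h2 : (2 * Real.pi * I * (intVec v ⬝ᵥ w) : ℂ).re = -(2 * Real.pi * (intVec v ⬝ᵥ w).im) := by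
    simp
  rw [add_re, h2, h]
  simp only [neg_mul, mul_assoc, Finset.sum_neg_distrib, Finset.mul_sum]
  simp
  ring

theorem summable_cexp_quadForm {A : Matrix ι ι ℝ} (hA : A.PosDef) {τ : ℂ} (hτ : 0 < τ.im)
    (w : ι → ℂ) : Summable fun v : ι → ℤ =>
      cexp (Real.pi * I * τ * quadForm A (intVec v) + 2 * Real.pi * I * (intVec v ⬝ᵥ w)) := by
  refine Summable.of_norm ?_
  simp_rw [norm_cexp_quadForm]
  exact summable_exp_neg_quadratic_form (hA.smul (by positivity)) _

end Gaussian

/-! ### Schur complements and completion of the square -/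

section Schur

variable {K : Type*} [Field K] {n : ℕ}

/-- The Schur complement of the upper left entry. -/
def schur (A : Matrix (Fin (n + 1)) (Fin (n + 1)) K) : Matrix (Fin n) (Fin n) K :=
  Matrix.of fun i j => A i.succ j.succ - A i.succ 0 * A 0 j.succ / A 0 0

variable {A : Matrix (Fin (n + 1)) (Fin (n + 1)) K}

theorem schur_mulVec_apply (x : Fin n → K) (i : Fin n) :
    (schur A *ᵥ x) i = ∑ j, A i.succ j.succ * x j - A i.succ 0 * (∑ j, A 0 j.succ * x j) / A 0 0 := by
  simp only [mulVec, dotProduct, schur, of_apply]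
  rw [Finset.mul_sum, Finset.sum_div, ← Finset.sum_sub_distrib]
  exact Finset.sum_congr rfl fun j _ => by ring

theorem mulVec_cons_zero (x₀ : K) (x : Fin n → K) :
    (A *ᵥ (Fin.cons x₀ x : Fin (n + 1) → K)) 0 = A 0 0 * x₀ + ∑ j, A 0 j.succ * x j := by
  simp [mulVec, dotProduct, Fin.sum_univ_succ]

theorem mulVec_cons_succ (x₀ : K) (x : Fin n → K) (i : Fin n) :
    (A *ᵥ (Fin.cons x₀ x : Fin (n + 1) → K)) i.succ
      = A i.succ 0 * x₀ + ∑ j, A i.succ j.succ * x j := by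
  simp [mulVec, dotProduct, Fin.sum_univ_succ]

theorem cons_dotProduct (x₀ : K) (x : Fin n → K) (y : Fin (n + 1) → K) :
    (Fin.cons x₀ x : Fin (n + 1) → K) ⬝ᵥ y = x₀ * y 0 + ∑ i, x i * y i.succ := by
  simp [dotProduct, Fin.sum_univ_succ]

/-- Completion of the square in the first variable. -/
theorem cons_dotProduct_mulVec_cons (h0 : A 0 0 ≠ 0) (hs : ∀ i : Fin n, A i.succ 0 = A 0 i.succ)
    (x₀ : K) (x : Fin n → K) :
    (Fin.cons x₀ x : Fin (n + 1) → K) ⬝ᵥ A *ᵥ (Fin.cons x₀ x : Fin (n + 1) → K)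
      = A 0 0 * (x₀ + (∑ j, A 0 j.succ * x j) / A 0 0) ^ 2 + x ⬝ᵥ schur A *ᵥ x := by
  rw [cons_dotProduct, mulVec_cons_zero]
  simp only [mulVec_cons_succ, dotProduct, schur_mulVec_apply, hs, mul_add, mul_sub,
    Finset.sum_add_distrib, Finset.sum_sub_distrib]
  have h1 : ∀ c : K, ∑ i, x i * (A 0 i.succ * c) = (∑ j, A 0 j.succ * x j) * c := fun c => by
    rw [Finset.sum_mul]
    exact Finset.sum_congr rfl fun i _ => by ring
  simp only [h1, mul_div_assoc]
  field_simp
  ring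

/-- Block elimination: the vector q with Aq = (x₀, x) is found by solving the Schur system for its
tail p and substituting back. In contrast to A itself, the inverse form keeps x₀ alone in the square
and shifts the remaining variables. -/
theorem cons_dotProduct_inv_mulVec_cons (h0 : A 0 0 ≠ 0)
    (hs : ∀ i : Fin n, A i.succ 0 = A 0 i.succ) (hA : IsUnit A) (hS : IsUnit (schur A))
    (x₀ : K) (x : Fin n → K) :
    (Fin.cons x₀ x : Fin (n + 1) → K) ⬝ᵥ A⁻¹ *ᵥ (Fin.cons x₀ x : Fin (n + 1) → K)
      = x₀ ^ 2 / A 0 0 + (fun j => x j - x₀ / A 0 0 * A 0 j.succ)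
        ⬝ᵥ (schur A)⁻¹ *ᵥ fun j => x j - x₀ / A 0 0 * A 0 j.succ := by
  have hAd := (Matrix.isUnit_iff_isUnit_det _).1 hA
  have hSd := (Matrix.isUnit_iff_isUnit_det _).1 hS
  set y : Fin n → K := fun j => x j - x₀ / A 0 0 * A 0 j.succ with hy
  set p := (schur A)⁻¹ *ᵥ y with hp
  have hp1 : schur A *ᵥ p = y := by
    rw [hp, mulVec_mulVec, Matrix.mul_nonsing_inv _ hSd, one_mulVec]
  set q : Fin (n + 1) → K := Fin.cons ((x₀ - ∑ j, A 0 j.succ * p j) / A 0 0) p with hq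
  have hAq : A *ᵥ q = Fin.cons x₀ x := by
    ext i
    refine Fin.cases ?_ (fun i => ?_) i
    · rw [hq, mulVec_cons_zero, Fin.cons_zero]
      field_simp
      ring
    · rw [hq, mulVec_cons_succ, Fin.cons_succ]
      have h1 := congrFun hp1 i
      rw [schur_mulVec_apply, hy] at h1
      simp only [hs] at h1 ⊢
      have h2 : ∑ j, A i.succ j.succ * p j = x i - x₀ / A 0 0 * A 0 i.succ
          + A 0 i.succ * (∑ j, A 0 j.succ * p j) / A 0 0 := by rw [← h1]; ring
      rw [h2]
      field_simp
      ring
  have hAinv : A⁻¹ *ᵥ (Fin.cons x₀ x : Fin (n + 1) → K) = q := by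
    rw [← hAq, mulVec_mulVec, Matrix.nonsing_inv_mul _ hAd, one_mulVec]
  rw [hAinv, cons_dotProduct, hq, Fin.cons_zero]
  simp only [Fin.cons_succ]
  simp only [dotProduct, hy, sub_mul, Finset.sum_sub_distrib]
  have h1 : ∑ j, x₀ / A 0 0 * A 0 j.succ * p j = x₀ / A 0 0 * ∑ j, A 0 j.succ * p j := by
    rw [Finset.mul_sum]
    exact Finset.sum_congr rfl fun i _ => by ring
  rw [h1]
  ring

/-- Row operations with the first row clear the first column and leave the Schur complement. -/
theorem det_eq_mul_det_schur (h0 : A 0 0 ≠ 0) : A.det = A 0 0 * (schur A).det := by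
  have h := Matrix.det_eq_of_forall_row_eq_smul_add_const (A := A)
    (B := Matrix.of fun i j => A i j - (if i = 0 then 0 else A i 0 / A 0 0) * A 0 j)
    (fun i => if i = 0 then 0 else A i 0 / A 0 0) 0 (by simp) (fun i j => by simp)
  rw [h, det_succ_column_zero, Fin.sum_univ_succ]
  simp only [of_apply, Fin.succ_ne_zero, if_false, div_mul_cancel₀ _ h0, sub_self, mul_zero,
    zero_mul, Finset.sum_const_zero, add_zero, if_true, Fin.val_zero, pow_zero, one_mul, sub_zero,
    Fin.succAbove_zero]
  congr 2
  ext i j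
  simp [schur, Fin.succ_ne_zero]
  ring

end Schur

/-! ### Poisson summation for Gaussians in several variables -/

section Poisson

variable {n : ℕ}

/-- The value of the Schur form at x is the value of A at (x₀, x) for the x₀ that annihilates the
completed square. -/
theorem posDef_schur {A : Matrix (Fin (n + 1)) (Fin (n + 1)) ℝ} (hA : A.PosDef) :
    (schur A).PosDef := by
  have h0 : 0 < A 0 0 := hA.diag_pos
  have hs : ∀ i j, A i j = A j i := fun i j => by
    simpa using (hA.isHermitian.apply i j).symm
  refine PosDef.of_dotProduct_mulVec_pos ?_ fun {x} hx => ?_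
  · ext i j
    simp only [conjTranspose_apply, schur, of_apply, star_trivial]
    rw [hs j.succ i.succ, hs j.succ 0, hs 0 i.succ]
    ring
  · have h := cons_dotProduct_mulVec_cons h0.ne' (fun i => hs i.succ 0)
      (-((∑ j, A 0 j.succ * x j) / A 0 0)) x
    rw [neg_add_cancel, sq, mul_zero, mul_zero, zero_add] at h
    rw [star_trivial, ← h]
    have hne : (Fin.cons (-((∑ j, A 0 j.succ * x j) / A 0 0)) x : Fin (n + 1) → ℝ) ≠ 0 := by
      intro h'
      apply hx
      ext i
      simpa using congrFun h' i.succ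
    simpa using hA.dotProduct_mulVec_pos hne

theorem schur_map_ofReal (A : Matrix (Fin (n + 1)) (Fin (n + 1)) ℝ) :
    (schur A).map Complex.ofReal = schur (A.map Complex.ofReal) := by
  ext i j
  simp [schur]

theorem map_ofReal_inv {ι : Type*} [Fintype ι] [DecidableEq ι] {A : Matrix ι ι ℝ} (hA : IsUnit A) :
    (A⁻¹).map Complex.ofReal = (A.map Complex.ofReal)⁻¹ := by
  symm
  apply Matrix.inv_eq_right_inv
  have h := congrArg (fun B : Matrix ι ι ℝ => B.map Complex.ofReal)
    (Matrix.mul_nonsing_inv A ((Matrix.isUnit_iff_isUnit_det _).1 hA))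
  rw [← Complex.coe_algebraMap] at h ⊢
  rw [← Matrix.map_mul, h]
  simp

theorem isUnit_map_ofReal {ι : Type*} [Fintype ι] [DecidableEq ι] {A : Matrix ι ι ℝ}
    (hA : IsUnit A) : IsUnit (A.map Complex.ofReal) :=
  hA.map (Complex.ofRealHom.mapMatrix)

theorem quadForm_cons {A : Matrix (Fin (n + 1)) (Fin (n + 1)) ℝ} (hA : A.PosDef) (x₀ : ℂ)
    (x : Fin n → ℂ) : quadForm A (Fin.cons x₀ x : Fin (n + 1) → ℂ)
      = A 0 0 * (x₀ + (∑ j, A 0 j.succ * x j) / A 0 0) ^ 2 + quadForm (schur A) x := by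
  have h0 : (A 0 0 : ℂ) ≠ 0 := by exact_mod_cast hA.diag_pos.ne'
  have hs : ∀ i j, A i j = A j i := fun i j => by
    simpa using (hA.isHermitian.apply i j).symm
  have := cons_dotProduct_mulVec_cons (A := A.map Complex.ofReal) h0
    (fun i => by simp [hs i.succ 0]) x₀ x
  rw [quadForm, quadForm, this, schur_map_ofReal]
  simp

theorem quadForm_inv_cons {A : Matrix (Fin (n + 1)) (Fin (n + 1)) ℝ} (hA : A.PosDef) (x₀ : ℂ)
    (x : Fin n → ℂ) : quadForm A⁻¹ (Fin.cons x₀ x : Fin (n + 1) → ℂ)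
      = x₀ ^ 2 / A 0 0 + quadForm (schur A)⁻¹ fun j => x j - x₀ / A 0 0 * A 0 j.succ := by
  have h0 : (A 0 0 : ℂ) ≠ 0 := by exact_mod_cast hA.diag_pos.ne'
  have hs : ∀ i j, A i j = A j i := fun i j => by
    simpa using (hA.isHermitian.apply i j).symm
  have hS := (posDef_schur hA).isUnit
  have := cons_dotProduct_inv_mulVec_cons (A := A.map Complex.ofReal) h0
    (fun i => by simp [hs i.succ 0]) (isUnit_map_ofReal hA.isUnit)
    (by rw [← schur_map_ofReal]; exact isUnit_map_ofReal hS) x₀ x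
  rw [quadForm, quadForm, map_ofReal_inv hA.isUnit, map_ofReal_inv hS, this, schur_map_ofReal]
  simp

end Poisson

section Poisson

theorem ofReal_mul_cpow {a : ℝ} (ha : 0 < a) {z : ℂ} (hz : z ≠ 0) (s : ℂ) :
    ((a : ℂ) * z) ^ s = (a : ℂ) ^ s * z ^ s := by
  have ha' : (a : ℂ) ≠ 0 := by exact_mod_cast ha.ne'
  rw [cpow_def_of_ne_zero (mul_ne_zero ha' hz), cpow_def_of_ne_zero ha', cpow_def_of_ne_zero hz,
    Complex.log_ofReal_mul ha hz, ← Complex.exp_add, Complex.ofReal_log ha.le, add_mul]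

theorem ofReal_cpow_half {a : ℝ} (ha : 0 ≤ a) : (a : ℂ) ^ (1 / 2 : ℂ) = (√a : ℝ) := by
  rw [Real.sqrt_eq_rpow, Complex.ofReal_cpow ha]
  simp

theorem neg_one_div_im_pos {τ : ℂ} (hτ : 0 < τ.im) : 0 < (-1 / τ).im := by
  rw [im_neg_one_div]
  exact div_pos hτ (Complex.normSq_pos.2 fun h => by simp [h] at hτ)

theorem quadForm_intVec_add {ι : Type*} [Fintype ι] {A : Matrix ι ι ℝ} (hA : A.IsHermitian)
    (x y : ι → ℂ) : quadForm A (x + y)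
      = quadForm A x + 2 * (x ⬝ᵥ A.map Complex.ofReal *ᵥ y) + quadForm A y := by
  have hs : (A.map Complex.ofReal)ᵀ = A.map Complex.ofReal := by
    ext i j
    simpa using congrArg Complex.ofReal (hA.apply i j)
  have h : y ⬝ᵥ A.map Complex.ofReal *ᵥ x = x ⬝ᵥ A.map Complex.ofReal *ᵥ y := by
    conv_lhs => rw [dotProduct_mulVec, ← mulVec_transpose, hs, dotProduct_comm]
  simp only [quadForm, mulVec_add, dotProduct_add, add_dotProduct, h]
  ring

theorem summable_cexp_quadForm_shift {ι : Type*} [Fintype ι] {A : Matrix ι ι ℝ} (hA : A.PosDef)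
    {τ : ℂ} (hτ : 0 < τ.im) (w : ι → ℂ) : Summable fun v : ι → ℤ =>
      cexp (-(Real.pi * I / τ) * quadForm A (intVec v + w)) := by
  have h := (summable_cexp_quadForm hA (neg_one_div_im_pos hτ)
    ((-1 / τ) • (A.map Complex.ofReal *ᵥ w))).mul_left
      (cexp (-(Real.pi * I / τ) * quadForm A w))
  refine h.congr fun v => ?_
  rw [← Complex.exp_add, quadForm_intVec_add hA.isHermitian, dotProduct_smul, smul_eq_mul]
  congr 1
  ring

theorem summable_cexp_sq_shift {c : ℝ} (hc : 0 < c) {τ : ℂ} (hτ : 0 < τ.im) (w : ℂ) :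
    Summable fun v : ℤ => cexp (-(Real.pi * I / (τ * c)) * (v + w) ^ 2) := by
  have h := ((summable_jacobiTheta₂_term_iff (-w / (τ * c)) (-1 / (τ * c))).2
    (neg_one_div_im_pos (by simpa using mul_pos hτ hc))).mul_left
    (cexp (-(Real.pi * I / (τ * c)) * w ^ 2))
  refine h.congr fun v => ?_
  rw [jacobiTheta₂_term, ← Complex.exp_add]
  congr 1
  ring

theorem tsum_cexp_sq {c : ℝ} (hc : 0 < c) {τ : ℂ} (hτ : 0 < τ.im) (w : ℂ) :
    ∑' v : ℤ, cexp (Real.pi * I * τ * (c * v ^ 2) + 2 * Real.pi * I * (v * w))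
      = ((√c : ℝ) : ℂ)⁻¹ * ((-I * τ) ^ (1 / 2 : ℂ))⁻¹
        * ∑' v : ℤ, cexp (-(Real.pi * I / (τ * c)) * (v + w) ^ 2) := by
  have hτ0 : τ ≠ 0 := fun h => by simp [h] at hτ
  have hc0 : (c : ℂ) ≠ 0 := by exact_mod_cast hc.ne'
  have h := Complex.tsum_exp_neg_quadratic (a := c * (-I * τ)) (by simp; positivity) (I * w)
  rw [ofReal_mul_cpow hc (by simp [hτ0]), ofReal_cpow_half hc.le, one_div, mul_inv] at h
  convert h using 1
  · exact tsum_congr fun v => congrArg _ (by ring)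
  · congr 1
    rw [← (Equiv.neg ℤ).tsum_eq]
    refine tsum_congr fun v => congrArg _ ?_
    simp only [Equiv.neg_apply, Int.cast_neg]
    field_simp
    ring_nf
    simp only [I_sq, I_pow_four]
    ring

/-- Poisson summation for a Gaussian on `ℤ ^ n`. -/
theorem tsum_cexp_quadForm_fin {n : ℕ} (A : Matrix (Fin n) (Fin n) ℝ) (hA : A.PosDef) {τ : ℂ}
    (hτ : 0 < τ.im) (w : Fin n → ℂ) :
    ∑' v : Fin n → ℤ,
        cexp (Real.pi * I * τ * quadForm A (intVec v) + 2 * Real.pi * I * (intVec v ⬝ᵥ w))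
      = ((√A.det : ℝ) : ℂ)⁻¹ * ((-I * τ) ^ (1 / 2 : ℂ))⁻¹ ^ n
        * ∑' v : Fin n → ℤ, cexp (-(Real.pi * I / τ) * quadForm A⁻¹ (intVec v + w)) := by
  induction n with
  | zero => simp [quadForm, dotProduct]
  | succ n ih =>
    -- One-dimensional Poisson summation in the first coordinate turns the left side into a double
    -- sum. The induction hypothesis for the Schur complement, read from right to left in the other
    -- coordinates, turns the right side into the same double sum in the opposite order.
    have hτ0 : τ ≠ 0 := fun h => by simp [h] at hτ
    have hα : 0 < A 0 0 := hA.diag_pos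
    have hα0 : (A 0 0 : ℂ) ≠ 0 := by exact_mod_cast hα.ne'
    have hS := posDef_schur hA
    obtain ⟨α, hαd⟩ : ∃ α, α = A 0 0 := ⟨_, rfl⟩
    obtain ⟨S, hSd⟩ : ∃ S, S = schur A := ⟨_, rfl⟩
    rw [← hSd] at hS
    rw [← hαd] at hα hα0
    let ℓ : (Fin n → ℂ) → ℂ := fun x => ∑ j, A 0 j.succ * x j
    let e := Fin.consEquiv (fun _ : Fin (n + 1) => ℤ)
    have he : ∀ p : ℤ × (Fin n → ℤ), intVec (e p) = Fin.cons (p.1 : ℂ) (intVec p.2) := fun p => by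
      ext i
      refine Fin.cases ?_ (fun i => ?_) i <;> simp [e, intVec, Fin.consEquiv]
    set w' : Fin n → ℂ := fun j => w j.succ with hw'
    -- the common double sum
    let F : (Fin n → ℤ) → ℤ → ℂ := fun v m =>
      cexp (-(Real.pi * I / (τ * α)) * (m + w 0) ^ 2)
        * cexp (Real.pi * I * τ * quadForm S (intVec v)
          + 2 * Real.pi * I * (intVec v ⬝ᵥ fun j => w' j - (m + w 0) / α * A 0 j.succ))
    -- The index m enters the linear term of the second factor through a real multiple of m, which
    -- leaves the modulus unchanged. The norm of F is therefore a product of a function of v and a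
    -- function of m.
    have hF : Summable fun p : (Fin n → ℤ) × ℤ => F p.1 p.2 := by
      have h1 := (summable_cexp_quadForm hS hτ fun j => w' j - w 0 / α * A 0 j.succ).norm
      have h2 := (summable_cexp_sq_shift hα hτ (w 0)).norm
      refine Summable.of_norm ?_
      refine (h1.mul_of_nonneg h2 (fun _ => norm_nonneg _) (fun _ => norm_nonneg _)).congr
        fun p => ?_
      rw [norm_mul, mul_comm]
      congr 1
      rw [norm_cexp_quadForm, norm_cexp_quadForm]
      congr 2
      refine Finset.sum_congr rfl fun i _ => ?_
      have h3 : (((p.2 : ℂ) + w 0) / α * A 0 i.succ).im = (w 0 / α * A 0 i.succ).im := by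
        have h4 : ((p.2 : ℂ) + w 0) / α * A 0 i.succ
            = ((p.2 / α * A 0 i.succ : ℝ) : ℂ) + w 0 / α * A 0 i.succ := by
          push_cast
          ring
        rw [h4, add_im, ofReal_im, zero_add]
      rw [sub_im, sub_im, h3]
    have hLS : Summable fun p : (Fin n → ℤ) × ℤ =>
        cexp (Real.pi * I * τ * quadForm A (intVec (e p.swap))
          + 2 * Real.pi * I * (intVec (e p.swap) ⬝ᵥ w)) :=
      ((Equiv.prodComm _ _).trans e).summable_iff.2 (summable_cexp_quadForm hA hτ w)
    have hL : ∑' v : Fin (n + 1) → ℤ,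
        cexp (Real.pi * I * τ * quadForm A (intVec v) + 2 * Real.pi * I * (intVec v ⬝ᵥ w))
        = ((√α : ℝ) : ℂ)⁻¹ * ((-I * τ) ^ (1 / 2 : ℂ))⁻¹ * ∑' v : Fin n → ℤ, ∑' m : ℤ, F v m := by
      rw [← ((Equiv.prodComm _ _).trans e).tsum_eq]
      simp only [Equiv.trans_apply, Equiv.prodComm_apply]
      rw [hLS.tsum_prod, ← tsum_mul_left]
      refine tsum_congr fun v => ?_
      have h1 := tsum_cexp_sq hα hτ (τ * ℓ (intVec v) + w 0)
      have h2 : ∀ m : ℤ, cexp (Real.pi * I * τ * quadForm A (intVec (e (v, m).swap))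
            + 2 * Real.pi * I * (intVec (e (v, m).swap) ⬝ᵥ w))
          = cexp (Real.pi * I * τ * (ℓ (intVec v) ^ 2 / α + quadForm S (intVec v))
              + 2 * Real.pi * I * (intVec v ⬝ᵥ w'))
            * cexp (Real.pi * I * τ * (α * m ^ 2)
              + 2 * Real.pi * I * (m * (τ * ℓ (intVec v) + w 0))) := fun m => by
        rw [he, Prod.swap_prod_mk, quadForm_cons hA, cons_dotProduct, ← hαd, ← hSd, ← Complex.exp_add]
        congr 1
        simp only [dotProduct, ℓ, hw']
        field_simp
        ring
      simp_rw [h2]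
      rw [tsum_mul_left, h1, mul_left_comm, ← tsum_mul_left]
      congr 1
      refine tsum_congr fun m => ?_
      simp only [F]
      rw [← Complex.exp_add, ← Complex.exp_add]
      congr 1
      have h3 : (intVec v ⬝ᵥ fun j => w' j - (m + w 0) / α * A 0 j.succ)
          = intVec v ⬝ᵥ w' - (m + w 0) / α * ℓ (intVec v) := by
        simp only [dotProduct, ℓ, mul_sub, Finset.sum_sub_distrib, Finset.mul_sum]
        congr 1
        exact Finset.sum_congr rfl fun j _ => by ring
      rw [h3]
      field_simp
      ring
    have hRS : Summable fun p : ℤ × (Fin n → ℤ) =>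
        cexp (-(Real.pi * I / τ) * quadForm A⁻¹ (intVec (e p) + w)) :=
      e.summable_iff.2 (summable_cexp_quadForm_shift hA.inv hτ w)
    have hR : ∑' v : Fin (n + 1) → ℤ, cexp (-(Real.pi * I / τ) * quadForm A⁻¹ (intVec v + w))
        = ((√S.det : ℝ) : ℂ) * ((-I * τ) ^ (1 / 2 : ℂ)) ^ n
          * ∑' m : ℤ, ∑' v : Fin n → ℤ, F v m := by
      have hdet : ((√S.det : ℝ) : ℂ) ≠ 0 := by
        exact_mod_cast (Real.sqrt_pos.2 hS.det_pos).ne'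
      have hcp : (-I * τ) ^ (1 / 2 : ℂ) ≠ 0 := by
        rw [Ne, cpow_eq_zero_iff]
        simp [hτ0]
      rw [← e.tsum_eq, hRS.tsum_prod, ← tsum_mul_left]
      refine tsum_congr fun m => ?_
      simp only [F]
      rw [tsum_mul_left, ih S hS, inv_pow, mul_left_comm (cexp _), ← mul_inv, ← mul_assoc,
        mul_inv_cancel₀ (mul_ne_zero hdet (pow_ne_zero _ hcp)), one_mul, ← tsum_mul_left]
      refine tsum_congr fun v => ?_
      have h1 : (Fin.cons (m : ℂ) (intVec v) : Fin (n + 1) → ℂ) + w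
          = Fin.cons (m + w 0) (intVec v + w') := by
        ext i
        refine Fin.cases ?_ (fun i => ?_) i <;> simp [hw']
      have h2 : (fun j => (intVec v + w') j - (m + w 0) / (A 0 0 : ℂ) * A 0 j.succ)
          = intVec v + fun j => w' j - (m + w 0) / α * A 0 j.succ := by
        ext j
        simp only [Pi.add_apply, hαd]
        ring
      rw [he, h1, quadForm_inv_cons hA, h2, ← hαd, ← hSd, ← Complex.exp_add]
      congr 1
      field_simp
      ring
    have hdetA : ((√A.det : ℝ) : ℂ) = ((√α : ℝ) : ℂ) * ((√S.det : ℝ) : ℂ) := by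
      rw [det_eq_mul_det_schur hA.diag_pos.ne', ← hαd, ← hSd, Real.sqrt_mul hα.le]
      push_cast
      rfl
    have hdet : ((√S.det : ℝ) : ℂ) ≠ 0 := by
      exact_mod_cast (Real.sqrt_pos.2 hS.det_pos).ne'
    have hcp : (-I * τ) ^ (1 / 2 : ℂ) ≠ 0 := by
      rw [Ne, cpow_eq_zero_iff]
      simp [hτ0]
    have hFu : Summable (Function.uncurry F) := hF
    have hsw : ∑' (v : Fin n → ℤ) (m : ℤ), F v m = ∑' (m : ℤ) (v : Fin n → ℤ), F v m :=
      (Summable.tsum_comm (f := F) hFu).symm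
    rw [hL, hR, hsw, hdetA, inv_pow, pow_succ]
    generalize ∑' (m : ℤ) (v : Fin n → ℤ), F v m = X
    generalize (-I * τ) ^ (1 / 2 : ℂ) = y at hcp ⊢
    have hy := pow_ne_zero n hcp
    generalize y ^ n = y' at hy ⊢
    field_simp

end Poisson

section Poisson

variable {ι : Type*} [Fintype ι]

theorem quadForm_submatrix {κ : Type*} [Fintype κ] (A : Matrix ι ι ℝ) (e : κ ≃ ι) (x : ι → ℂ) :
    quadForm (A.submatrix e e) (x ∘ e) = quadForm A x := by
  simp only [quadForm, dotProduct, mulVec, map_apply, submatrix_apply, Function.comp_apply]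
  rw [e.sum_comp (fun i => x i * ∑ j, (A i (e j) : ℂ) * x (e j))]
  exact Finset.sum_congr rfl fun i _ => by rw [e.sum_comp (fun j => (A i j : ℂ) * x j)]

theorem quadForm_smul (k : ℝ) (A : Matrix ι ι ℝ) (x : ι → ℂ) :
    quadForm (k • A) x = k * quadForm A x := by
  simp only [quadForm, dotProduct, mulVec, map_apply, Matrix.smul_apply, smul_eq_mul, ofReal_mul,
    Finset.mul_sum]
  exact Finset.sum_congr rfl fun i _ => Finset.sum_congr rfl fun j _ => by ring

/-- Poisson summation for a Gaussian on `ℤ ^ ι`. -/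
theorem tsum_cexp_quadForm [DecidableEq ι] {A : Matrix ι ι ℝ} (hA : A.PosDef) {τ : ℂ}
    (hτ : 0 < τ.im) (w : ι → ℂ) :
    ∑' v : ι → ℤ,
        cexp (Real.pi * I * τ * quadForm A (intVec v) + 2 * Real.pi * I * (intVec v ⬝ᵥ w))
      = ((√A.det : ℝ) : ℂ)⁻¹ * ((-I * τ) ^ (1 / 2 : ℂ))⁻¹ ^ Fintype.card ι
        * ∑' v : ι → ℤ, cexp (-(Real.pi * I / τ) * quadForm A⁻¹ (intVec v + w)) := by
  let e := (Fintype.equivFin ι).symm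
  have h := tsum_cexp_quadForm_fin (A.submatrix e e) (hA.submatrix e.injective) hτ (w ∘ e)
  rw [det_submatrix_equiv_self, inv_submatrix_equiv] at h
  let E : (ι → ℤ) ≃ (Fin (Fintype.card ι) → ℤ) := e.symm.arrowCongr (Equiv.refl ℤ)
  have hE : ∀ v, intVec (E v) = intVec v ∘ e := fun v => rfl
  rw [← E.tsum_eq, ← E.tsum_eq
    (fun v => cexp (-(Real.pi * I / τ) * quadForm (A⁻¹.submatrix e e) (intVec v + w ∘ e)))] at h
  simp only [hE] at h
  have h2 : ∀ x y : ι → ℂ, x ∘ e + y ∘ e = (x + y) ∘ e := fun _ _ => rfl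
  have h3 : ∀ x : ι → ℂ, (x ∘ e) ⬝ᵥ (w ∘ e) = x ⬝ᵥ w := fun x =>
    e.sum_comp (fun i => x i * w i)
  simp only [h2, h3, quadForm_submatrix] at h
  exact h

end Poisson

/-! ### Lattices with a positive definite Gram matrix and convergence of mock theta series -/

section Lattice

variable {H : Type*} [AddCommGroup H] [Module ℂ H] {ι : Type*} [Fintype ι]

/-- The combination of the vectors `e i` with coefficients `v i`. -/
def comb (e : ι → H) (v : ι → ℂ) : H := ∑ i, v i • e i

theorem mem_span_iff_comb {e : ι → H} {x : H} :
    x ∈ Submodule.span ℤ (Set.range e) ↔ ∃ v : ι → ℤ, comb e (intVec v) = x := by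
  rw [Submodule.mem_span_range_iff_exists_fun]
  simp only [comb, intVec, Int.cast_smul_eq_zsmul]

/-- `A` is a positive definite Gram matrix of the family `e`. -/
structure IsGram (B : LinearMap.BilinForm ℂ H) (e : ι → H) (A : Matrix ι ι ℝ) : Prop where
  posDef : A.PosDef
  form_eq : ∀ i j, B (e i) (e j) = A i j

variable {B : LinearMap.BilinForm ℂ H} {e : ι → H} {A : Matrix ι ι ℝ}

theorem form_comb_left (B : LinearMap.BilinForm ℂ H) (e : ι → H) (v : ι → ℂ) (x : H) :
    B (comb e v) x = ∑ i, v i * B (e i) x := by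
  simp [comb, LinearMap.sum_apply]

theorem form_comb_right (B : LinearMap.BilinForm ℂ H) (e : ι → H) (v : ι → ℂ) (x : H) :
    B x (comb e v) = ∑ i, v i * B x (e i) := by
  simp [comb]

theorem IsGram.form_comb_basis (h : IsGram B e A) (v : ι → ℂ) (j : ι) :
    B (e j) (comb e v) = (A.map Complex.ofReal *ᵥ v) j := by
  simp only [form_comb_right, h.form_eq, mulVec, dotProduct, map_apply]
  exact Finset.sum_congr rfl fun i _ => mul_comm _ _

theorem IsGram.form_comb_comb (h : IsGram B e A) (v w : ι → ℂ) :
    B (comb e v) (comb e w) = v ⬝ᵥ A.map Complex.ofReal *ᵥ w := by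
  rw [form_comb_left, dotProduct]
  exact Finset.sum_congr rfl fun i _ => by rw [h.form_comb_basis]

theorem IsGram.form_comb_self (h : IsGram B e A) (v : ι → ℂ) :
    B (comb e v) (comb e v) = quadForm A v := h.form_comb_comb v v

theorem comb_sub (e : ι → H) (v w : ι → ℂ) : comb e (v - w) = comb e v - comb e w := by
  simp [comb, sub_smul, Finset.sum_sub_distrib]

theorem comb_smul (e : ι → H) (c : ℂ) (v : ι → ℂ) : comb e (c • v) = c • comb e v := by
  simp [comb, smul_smul, Finset.smul_sum]

theorem comb_add (e : ι → H) (v w : ι → ℂ) : comb e (v + w) = comb e v + comb e w := by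
  simp [comb, add_smul, Finset.sum_add_distrib]

/-- The complex span may contain isotropic vectors, so definiteness is of no direct use here; the
invertibility of the real Gram matrix persists over ℂ. -/
theorem IsGram.eq_zero_of_forall (h : IsGram B e A) {v : ι → ℂ}
    (hv : ∀ j, B (e j) (comb e v) = 0) : v = 0 := by
  classical
  have h1 : A.map Complex.ofReal *ᵥ v = 0 := by
    ext j
    rw [← h.form_comb_basis, hv]
    rfl
  have hu := (Matrix.isUnit_iff_isUnit_det _).1 (isUnit_map_ofReal h.posDef.isUnit)
  have h2 := congrArg (fun x => (A.map Complex.ofReal)⁻¹ *ᵥ x) h1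
  simpa [mulVec_mulVec, Matrix.nonsing_inv_mul _ hu] using h2

theorem IsGram.comb_injective (h : IsGram B e A) : Function.Injective (comb e) := by
  intro v w hvw
  rw [← sub_eq_zero]
  apply h.eq_zero_of_forall
  intro j
  rw [comb_sub, hvw, sub_self, map_zero]

theorem IsGram.combInt_injective (h : IsGram B e A) :
    Function.Injective fun v : ι → ℤ => comb e (intVec v) := by
  intro v w hvw
  have h1 := h.comb_injective hvw
  ext i
  have := congrFun h1 i
  simpa [intVec] using this

/-- On integral combinations the coefficients are real, and definiteness does apply. -/
theorem IsGram.eq_zero_of_form_self (h : IsGram B e A) {x : H}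
    (hx : x ∈ Submodule.span ℤ (Set.range e)) (h0 : B x x = 0) : x = 0 := by
  obtain ⟨v, rfl⟩ := mem_span_iff_comb.1 hx
  rw [h.form_comb_self, quadForm_intVec] at h0
  have h0' : (fun i => (v i : ℝ)) ⬝ᵥ A *ᵥ (fun i => (v i : ℝ)) = 0 := by exact_mod_cast h0
  by_contra hne
  have hv : (fun i => (v i : ℝ)) ≠ 0 := by
    intro hv
    apply hne
    have : intVec v = 0 := by
      ext i
      simpa [intVec] using congrFun hv i
    rw [this]
    simp [comb]
  have := h.posDef.dotProduct_mulVec_pos hv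
  rw [star_trivial, h0'] at this
  exact lt_irrefl _ this

/-- Coordinates on the lattice spanned by `e`. -/
noncomputable def IsGram.latticeEquiv (h : IsGram B e A) :
    (ι → ℤ) ≃ Submodule.span ℤ (Set.range e) :=
  Equiv.ofBijective (fun v => ⟨comb e (intVec v), mem_span_iff_comb.2 ⟨v, rfl⟩⟩)
    ⟨fun _ _ hvw => h.combInt_injective (congrArg Subtype.val hvw),
      fun x => by
        obtain ⟨v, hv⟩ := mem_span_iff_comb.1 x.2
        exact ⟨v, Subtype.ext hv⟩⟩

@[simp]
theorem IsGram.latticeEquiv_apply (h : IsGram B e A) (v : ι → ℤ) :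
    (h.latticeEquiv v : H) = comb e (intVec v) := rfl

theorem expWt_translate (B : LinearMap.BilinForm ℂ H) (g : H) (l : AffDual H) (τ : ℂ) (z : H)
    (t : ℂ) : expWt B (translate B g l) τ z t
      = cexp (2 * Real.pi * I * (B l.1 z + level l * B g z + t * level l
        - τ * (l.2.2 - (B l.1 g + 1 / 2 * level l * B g g)))) := by
  simp [expWt, translate, ofFin, level]

theorem expWt_neg_translate_ofFin (B : LinearMap.BilinForm ℂ H) (g b : H) (τ : ℂ) (z : H)
    (t : ℂ) : expWt B (-(translate B g (ofFin b))) τ z t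
      = cexp (2 * Real.pi * I * (-B b z - τ * B b g)) := by
  simp [expWt, translate, ofFin, level]

theorem mockTerm_eq (B : LinearMap.BilinForm ℂ H) (l : AffDual H) {κ : Type*} (S : Finset κ)
    (β : κ → H) (g : H) (τ : ℂ) (z : H) (t : ℂ) :
    mockTerm B l S β g τ z t
      = cexp (2 * Real.pi * I * (B l.1 z + level l * B g z + t * level l
        - τ * (l.2.2 - (B l.1 g + 1 / 2 * level l * B g g))))
        / ∏ p ∈ S, (1 - cexp (2 * Real.pi * I * (-B (β p) z - τ * B (β p) g))) := by
  rw [mockTerm, expWt_translate]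
  simp only [expWt_neg_translate_ofFin]

/-- As (β | γ) is an integer on the lattice, the denominators are values of 1 - e^{2πi(w + nτ)} with
n ∈ ℤ and their inverses are uniformly bounded. The numerators form a Gaussian with matrix kA. -/
theorem IsGram.summable_mockTerm (h : IsGram B e A) {l : AffDual H} {k : ℝ} (hk : 0 < k)
    (hl : level l = k) {κ : Type*} {S : Finset κ} {β : κ → H}
    (hβ : ∀ q ∈ S, ∀ i, ∃ c : ℤ, B (β q) (e i) = c) {τ : ℂ} (hτ : 0 < τ.im) {z : H}
    (hz : ∀ q ∈ S, OffLattice τ (-B (β q) z)) (t : ℂ) :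
    Summable fun g : Submodule.span ℤ (Set.range e) => mockTerm B l S β g τ z t := by
  rw [← h.latticeEquiv.summable_iff]
  have hsum := summable_cexp_quadForm (h.posDef.smul hk) hτ
    (fun i => k * B (e i) z + τ * B l.1 (e i))
  have hC : ∀ q ∈ S, ∃ C : ℝ, ∀ v : ι → ℤ,
      ‖(1 - cexp (2 * Real.pi * I * (-B (β q) z - τ * B (β q) (comb e (intVec v)))))⁻¹‖ ≤ C := by
    intro q hq
    obtain ⟨C, -, hC⟩ := exists_norm_inv_one_sub_le hτ (hz q hq)
    refine ⟨C, fun v => ?_⟩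
    choose c hc using hβ q hq
    have h1 : B (β q) (comb e (intVec v)) = ((∑ i, v i * c i : ℤ) : ℂ) := by
      rw [form_comb_right]
      simp [hc, intVec]
    have h2 := hC (-(∑ i, v i * c i))
    rw [h1]
    convert h2 using 6
    push_cast
    ring
  choose! C hC using hC
  refine Summable.of_norm_bounded (g := fun v => ‖cexp (2 * Real.pi * I * (B l.1 z + t * k
      - τ * l.2.2))‖ * ‖cexp (Real.pi * I * τ * quadForm (k • A) (intVec v)
      + 2 * Real.pi * I * (intVec v ⬝ᵥ fun i => k * B (e i) z + τ * B l.1 (e i)))‖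
      * ∏ q ∈ S, C q) ((hsum.norm.mul_left _).mul_right _) fun v => ?_
  rw [Function.comp_apply, h.latticeEquiv_apply, mockTerm_eq, div_eq_mul_inv, ← Finset.prod_inv_distrib,
    norm_mul, norm_prod]
  refine mul_le_mul (le_of_eq ?_) (Finset.prod_le_prod (fun _ _ => norm_nonneg _)
    fun q hq => hC q hq v) (Finset.prod_nonneg fun _ _ => norm_nonneg _) (by positivity)
  rw [← norm_mul, ← Complex.exp_add]
  congr 2
  have hq : quadForm (k • A) (intVec v) = k * B (comb e (intVec v)) (comb e (intVec v)) := by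
    rw [h.form_comb_self, quadForm_smul]
  have hw : (intVec v ⬝ᵥ fun i => k * B (e i) z + τ * B l.1 (e i))
      = k * B (comb e (intVec v)) z + τ * B l.1 (comb e (intVec v)) := by
    rw [form_comb_left, form_comb_right, dotProduct, Finset.mul_sum, Finset.mul_sum,
      ← Finset.sum_add_distrib]
    exact Finset.sum_congr rfl fun i _ => by ring
  rw [hq, hw, hl]
  ring

end Lattice

namespace Setup

variable {H : Type*} [AddCommGroup H] [Module ℂ H] (D : Setup H)

/-! ## Linear algebra of the modification procedure -/

theorem form_comm (x y : H) : D.form x y = D.form y x := by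
  simpa using D.form_symm.eq x y

theorem gam_bet' (i : Fin D.m) (p : Fin D.n) :
    D.form (D.bet p) (D.gam i) = if (i : ℕ) = p then -1 else 0 := by
  rw [form_comm, gam_bet]

/-- The real Gram matrix of the basis of `L`. -/
noncomputable def gram : Matrix (Fin D.m) (Fin D.m) ℝ :=
  Matrix.of fun i j => (D.form (D.gam i) (D.gam j)).re

theorem form_gam_gam (i j : Fin D.m) : D.form (D.gam i) (D.gam j) = D.gram i j := by
  apply Complex.ext
  · simp [gram]
  · simp [D.gram_real i j]

/-- The indices of the basis vectors of `L_s`. -/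
abbrev Idx (s : ℕ) := {i : Fin D.m // s ≤ (i : ℕ)}

/-- The real Gram matrix of the basis of `L_s`. -/
noncomputable def gramIdx (s : ℕ) : Matrix (D.Idx s) (D.Idx s) ℝ :=
  D.gram.submatrix Subtype.val Subtype.val

theorem gramIdx_posDef (s : ℕ) : (D.gramIdx s).PosDef :=
  PosDef.submatrix (show D.gram.PosDef from D.gram_posDef) Subtype.val_injective

theorem form_gamStep_bet (s : ℕ) (i : Fin D.m) (p : Fin D.n) :
    D.form (D.gamStep s i) (D.bet p) = if (i : ℕ) = p then -1 else 0 := by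
  simp [gamStep, D.gam_bet, D.bet_isotropic, LinearMap.sum_apply]

theorem form_bet_gamStep (s : ℕ) (i : Fin D.m) (p : Fin D.n) :
    D.form (D.bet p) (D.gamStep s i) = if (i : ℕ) = p then -1 else 0 := by
  rw [form_comm, form_gamStep_bet]

/-- Because (β_p | γ_j) = -δ, adding (γ_i | γ_p)β_p cancels precisely the product with γ_p. -/
theorem form_gamStep_gam (s : ℕ) (i j : Fin D.m) :
    D.form (D.gamStep s i) (D.gam j)
      = if (j : ℕ) < s ∧ (j : ℕ) < D.n then 0 else D.form (D.gam i) (D.gam j) := by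
  simp only [gamStep, map_add, map_sum, map_smul, LinearMap.add_apply, LinearMap.sum_apply,
    LinearMap.smul_apply, gam_bet', smul_eq_mul, mul_ite, mul_neg, mul_one, mul_zero]
  by_cases hj : (j : ℕ) < D.n
  · have h1 : ∀ p : Fin D.n, ((j : ℕ) = p) ↔ p = ⟨j, hj⟩ := fun p => by
      rw [Fin.ext_iff]; exact eq_comm
    simp only [h1]
    rw [Finset.sum_ite_eq']
    by_cases hs : (j : ℕ) < s
    · rw [if_pos (by simpa using hs), if_pos ⟨hs, hj⟩]
      have : D.gamT ⟨j, hj⟩ = D.gam j := rfl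
      rw [this, add_neg_cancel]
    · rw [if_neg (by simpa using hs), if_neg (fun h => hs h.1), add_zero]
  · rw [if_neg (fun h => hj h.2), Finset.sum_eq_zero, add_zero]
    intro p _
    rw [if_neg]
    have := p.2
    omega

/-- The corrections β_p, p < s, are orthogonal to `gamStep s i` for i ≥ s. Hence the Gram matrix of
L_s is a principal submatrix of that of L. -/
theorem form_gamStep_gamStep {s : ℕ} {i j : Fin D.m} (hj : s ≤ (j : ℕ)) (hi : s ≤ (i : ℕ)) :
    D.form (D.gamStep s i) (D.gamStep s j) = D.form (D.gam i) (D.gam j) := by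
  have hs : D.gamStep s j = D.gam j
      + ∑ p : Fin D.n with p.val < s, D.form (D.gam j) (D.gamT p) • D.bet p := rfl
  rw [hs, map_add, map_sum, Finset.sum_eq_zero, add_zero, form_gamStep_gam, if_neg]
  · omega
  · intro p hp
    rw [map_smul, form_gamStep_bet, if_neg, smul_zero]
    have := (Finset.mem_filter.1 hp).2
    omega

theorem isGram_gamStep (s : ℕ) :
    IsGram D.form (fun i : D.Idx s => D.gamStep s i) (D.gramIdx s) :=
  ⟨D.gramIdx_posDef s, fun i j => by
    rw [D.form_gamStep_gamStep j.2 i.2, form_gam_gam]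
    rfl⟩

end Setup

namespace Setup

variable {H : Type*} [AddCommGroup H] [Module ℂ H] (D : Setup H)

theorem lat_eq (s : ℕ) :
    D.lat s = Submodule.span ℤ (Set.range fun i : D.Idx s => D.gamStep s i) := by
  rw [lat]
  congr 1
  ext x
  constructor
  · rintro ⟨i, hi, rfl⟩
    exact ⟨⟨i, hi⟩, rfl⟩
  · rintro ⟨i, rfl⟩
    exact ⟨i, i.2, rfl⟩

theorem rest_eq (p : Fin D.n) :
    D.rest p = Submodule.span ℤ (Set.range fun i : D.Idx (p + 1) => D.gamStep p i) := by
  rw [rest]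
  congr 1
  ext x
  constructor
  · rintro ⟨i, hi, rfl⟩
    exact ⟨⟨i, hi⟩, rfl⟩
  · rintro ⟨i, rfl⟩
    exact ⟨i, i.2, rfl⟩

theorem isGram_rest (p : Fin D.n) :
    IsGram D.form (fun i : D.Idx (p + 1) => D.gamStep p i) (D.gramIdx (p + 1)) :=
  ⟨D.gramIdx_posDef _, fun i j => by
    rw [D.form_gamStep_gamStep ((Nat.le_succ _).trans j.2) ((Nat.le_succ _).trans i.2),
      form_gam_gam]
    rfl⟩

theorem gamStep_zero (i : Fin D.m) : D.gamStep 0 i = D.gam i := by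
  simp [gamStep]

theorem L_eq_lat : D.L = D.lat 0 := by
  rw [lat_eq, L]
  congr 1
  ext x
  simp [gamStep_zero]

theorem wt_fst (s : ℕ) (l : AffDual H) : (D.wt s l).1
    = l.1 + ∑ p : Fin D.n with p.val < s, D.form l.1 (D.gamT p) • D.bet p := by
  simp [wt, ofFin, Prod.fst_sum]

theorem wt_snd (s : ℕ) (l : AffDual H) : (D.wt s l).2 = l.2 := by
  simp [wt, ofFin, Prod.snd_sum]

theorem level_wt (s : ℕ) (l : AffDual H) : level (D.wt s l) = level l := by
  rw [level, level, wt_snd]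

variable {D} {k : ℝ} {l : AffDual H}

theorem form_wt_bet (hl : l ∈ D.weights k) (s : ℕ) (p : Fin D.n) :
    D.form (D.wt s l).1 (D.bet p) = 0 := by
  rw [wt_fst]
  simp [LinearMap.sum_apply, D.bet_isotropic, hl.2.2]

theorem form_wt_gam (s : ℕ) (j : Fin D.m) :
    D.form (D.wt s l).1 (D.gam j)
      = if (j : ℕ) < s ∧ (j : ℕ) < D.n then 0 else D.form l.1 (D.gam j) := by
  simp only [wt_fst, map_add, map_sum, map_smul, LinearMap.add_apply, LinearMap.sum_apply,
    LinearMap.smul_apply, gam_bet', smul_eq_mul, mul_ite, mul_neg, mul_one, mul_zero]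
  by_cases hj : (j : ℕ) < D.n
  · have h1 : ∀ p : Fin D.n, ((j : ℕ) = p) ↔ p = ⟨j, hj⟩ := fun p => by
      rw [Fin.ext_iff]; exact eq_comm
    simp only [h1]
    rw [Finset.sum_ite_eq']
    by_cases hs : (j : ℕ) < s
    · rw [if_pos (by simpa using hs), if_pos ⟨hs, hj⟩]
      have : D.gamT ⟨j, hj⟩ = D.gam j := rfl
      rw [this, add_neg_cancel]
    · rw [if_neg (by simpa using hs), if_neg (fun h => hs h.1), add_zero]
  · rw [if_neg (fun h => hj h.2), Finset.sum_eq_zero, add_zero]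
    intro p _
    rw [if_neg]
    have := p.2
    omega

theorem form_wt_gamStep (hl : l ∈ D.weights k) {s r : ℕ} {j : Fin D.m} (hj : s ≤ (j : ℕ)) :
    D.form (D.wt s l).1 (D.gamStep r j) = D.form l.1 (D.gam j) := by
  rw [gamStep, map_add, map_sum, Finset.sum_eq_zero, add_zero, form_wt_gam, if_neg]
  · omega
  · intro p _
    rw [map_smul, form_wt_bet hl, smul_zero]

/-- The corrections lie in the span of T, which is isotropic and orthogonal to all weights. In
particular the power q^{|λ_s|²/2k} is the same at every stage. -/
theorem form_wt_wt {l' : AffDual H} (hl : l ∈ D.weights k) (hl' : l' ∈ D.weights k) (s r : ℕ) :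
    D.form (D.wt s l).1 (D.wt r l').1 = D.form l.1 l'.1 := by
  have h1 : ∀ y, (∀ p, D.form y (D.bet p) = 0) → D.form y (D.wt r l').1 = D.form y l'.1 := by
    intro y hy
    rw [wt_fst, map_add, map_sum, Finset.sum_eq_zero, add_zero]
    intro p _
    rw [map_smul, hy, smul_zero]
  rw [h1 _ (form_wt_bet hl s), form_comm, wt_fst, map_add, map_sum, Finset.sum_eq_zero, add_zero,
    form_comm]
  intro p _
  rw [map_smul, hl'.2.2, smul_zero]

theorem affForm_wt (hl : l ∈ D.weights k) (s : ℕ) :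
    affForm D.form (D.wt s l) (D.wt s l) = affForm D.form l l := by
  rw [affForm, affForm, form_wt_wt hl hl, wt_snd]

theorem form_weight_gam (hl : l ∈ D.weights k) (i : Fin D.m) : ∃ c : ℤ, D.form l.1 (D.gam i) = c :=
  hl.2.1 _ (Submodule.subset_span ⟨i, rfl⟩)

theorem charge_eq (hl : l ∈ D.weights k) (p : Fin D.n) :
    (D.charge l p : ℂ) = D.form l.1 (D.gamT p) := by
  obtain ⟨c, hc⟩ := form_weight_gam hl (Fin.castLE D.n_le_m p)
  rw [charge, gamT, hc]
  simp

theorem form_gamT_pos (p : Fin D.n) : 0 < D.gram (Fin.castLE D.n_le_m p) (Fin.castLE D.n_le_m p) :=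
  (show D.gram.PosDef from D.gram_posDef).diag_pos

theorem form_gamT_self (p : Fin D.n) : D.form (D.gamT p) (D.gamT p)
    = D.gram (Fin.castLE D.n_le_m p) (Fin.castLE D.n_le_m p) := D.form_gam_gam _ _

theorem form_gamT_ne_zero (p : Fin D.n) : D.form (D.gamT p) (D.gamT p) ≠ 0 := by
  rw [form_gamT_self]
  exact_mod_cast (form_gamT_pos p).ne'

/-- Evenness makes k|γ_p|²/2 an integer and definiteness makes it positive, so the floor in `deg`
loses nothing. -/
theorem deg_eq_and_pos (hk : 0 < k) (heven : ∀ x ∈ D.L, ∃ c : ℤ, (k : ℂ) * D.form x x = 2 * c)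
    (p : Fin D.n) :
    (D.deg k p : ℂ) = k / 2 * D.form (D.gamT p) (D.gamT p) ∧ 0 < D.deg k p := by
  obtain ⟨c, hc⟩ := heven (D.gamT p) (Submodule.subset_span ⟨_, rfl⟩)
  have hpos := form_gamT_pos p
  rw [form_gamT_self] at hc
  have hc' : k * D.gram (Fin.castLE D.n_le_m p) (Fin.castLE D.n_le_m p) = 2 * c := by
    exact_mod_cast hc
  have hc0 : 0 < c := by
    have h1 : (0 : ℝ) < 2 * c := by rw [← hc']; positivity
    have h2 : (0 : ℝ) < c := by linarith
    exact_mod_cast h2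
  have h3 : (k : ℂ) / 2 * D.form (D.gamT p) (D.gamT p) = c := by
    rw [form_gamT_self]
    linear_combination hc / 2
  obtain ⟨d, rfl⟩ := Int.eq_ofNat_of_zero_le hc0.le
  have h4 : D.deg k p = d := by
    rw [deg, h3]
    simp
  rw [h3, h4]
  exact ⟨by simp, by exact_mod_cast hc0⟩

theorem form_gamTilde_self (p : Fin D.n) :
    D.form (D.gamTilde p) (D.gamTilde p) = D.form (D.gamT p) (D.gamT p) :=
  D.form_gamStep_gamStep le_rfl le_rfl

theorem form_bet_gamTilde (q p : Fin D.n) :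
    D.form (D.bet q) (D.gamTilde p) = if p = q then -1 else 0 := by
  rw [gamTilde, form_bet_gamStep]
  simp [Fin.ext_iff]

theorem form_bet_rest {p q : Fin D.n} (hq : q ≤ p) {g : H} (hg : g ∈ D.rest p) :
    D.form (D.bet q) g = 0 := by
  rw [rest_eq, mem_span_iff_comb] at hg
  obtain ⟨v, rfl⟩ := hg
  rw [form_comb_right]
  refine Finset.sum_eq_zero fun i _ => ?_
  rw [form_bet_gamStep, if_neg, mul_zero]
  have := i.2
  have : (q : ℕ) ≤ p := hq
  omega

/-- The assumption on (γ_i^∨ | γ_j) enters here. It makes the second argument of Φ̃ vary by integral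
multiples of τ over `rest p`. -/
theorem form_rest_coroot {p : Fin D.n} {g : H} (hg : g ∈ D.rest p) :
    ∃ c : ℤ, D.form g (coroot D.form (D.gamTilde p)) = c := by
  rw [rest_eq, mem_span_iff_comb] at hg
  obtain ⟨v, rfl⟩ := hg
  have h1 : ∀ i : D.Idx (p + 1), ∃ c : ℤ,
      D.form (D.gamStep p i) (coroot D.form (D.gamTilde p)) = c := by
    intro i
    have hi : (p : ℕ) ≤ i.1 := (Nat.le_succ _).trans i.2
    obtain ⟨c, hc⟩ := D.coroot_int p i.1 hi
    refine ⟨c, ?_⟩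
    rw [← hc, coroot, map_smul, form_gamTilde_self, gamTilde,
      D.form_gamStep_gamStep (s := p) (i := i.1) (j := Fin.castLE D.n_le_m p) le_rfl hi, coroot, map_smul,
      LinearMap.smul_apply,
      D.form_comm (D.gam i.1)]
    rfl
  choose c hc using h1
  refine ⟨∑ i, v i * c i, ?_⟩
  rw [form_comb_left]
  simp [hc, intVec]

/-! ## The lattices of consecutive steps -/

/-- The decomposition `L_{p-1} = ℤ gamTilde p ⊕ rest p`. -/
noncomputable def splitEquiv (p : Fin D.n) : D.rest p × ℤ ≃ D.lat p :=
  Equiv.ofBijective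
    (fun x => ⟨x.1 + x.2 • D.gamTilde p, by
      refine add_mem ?_ (Submodule.smul_mem _ _ (Submodule.subset_span ⟨_, le_rfl, rfl⟩))
      exact Submodule.span_mono (t := {x | ∃ i : Fin D.m, (p : ℕ) ≤ i ∧ x = D.gamStep p i})
        (fun y hy => by
          obtain ⟨i, hi, hy⟩ := hy
          exact ⟨i, hi.le, hy⟩) x.1.2⟩)
    ⟨by
      rintro ⟨g, n⟩ ⟨g', n'⟩ h
      have h1 : (g : H) + n • D.gamTilde p = g' + n' • D.gamTilde p := congrArg Subtype.val h
      -- The product with β_p annihilates `rest p` and reads off -n.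
      have h2 := congrArg (D.form (D.bet p)) h1
      rw [map_add, map_add, form_bet_rest le_rfl g.2, form_bet_rest le_rfl g'.2, map_zsmul,
        map_zsmul, form_bet_gamTilde, if_pos rfl] at h2
      have h3 : n = n' := by
        simp only [zsmul_eq_mul, mul_neg, mul_one, zero_add, neg_inj] at h2
        exact_mod_cast h2
      subst h3
      exact Prod.ext (Subtype.ext (add_right_cancel h1)) rfl, by
      rintro ⟨x, hx⟩
      have hset : {x | ∃ i : Fin D.m, (p : ℕ) ≤ i ∧ x = D.gamStep p i}
          = insert (D.gamTilde p) {x | ∃ i : Fin D.m, (p : ℕ) < i ∧ x = D.gamStep p i} := by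
        ext y
        constructor
        · rintro ⟨i, hi, rfl⟩
          rcases hi.eq_or_lt with h | h
          · left
            have : i = Fin.castLE D.n_le_m p := Fin.ext h.symm
            rw [this]
            rfl
          · exact Or.inr ⟨i, h, rfl⟩
        · rintro (rfl | ⟨i, hi, rfl⟩)
          · exact ⟨_, le_rfl, rfl⟩
          · exact ⟨i, hi.le, rfl⟩
      rw [lat, hset, Submodule.mem_span_insert] at hx
      obtain ⟨n, g, hg, rfl⟩ := hx
      exact ⟨(⟨g, hg⟩, n), Subtype.ext (add_comm _ _)⟩⟩

theorem splitEquiv_apply (p : Fin D.n) (x : D.rest p × ℤ) :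
    (splitEquiv p x : H) = x.1 + (x.2 : ℂ) • D.gamTilde p := by
  rw [Int.cast_smul_eq_zsmul]
  rfl

/-- The map `γ ↦ γ + (γ | gamTilde p) β_p`. -/
noncomputable def shift (p : Fin D.n) : H →ₗ[ℤ] H where
  toFun g := g + D.form g (D.gamTilde p) • D.bet p
  map_add' x y := by
    rw [map_add, LinearMap.add_apply, add_smul]
    abel
  map_smul' n x := by
    simp [mul_smul, Int.cast_smul_eq_zsmul]

theorem form_gamStep_gamTilde {p : Fin D.n} {i : Fin D.m} (hi : (p : ℕ) ≤ i) :
    D.form (D.gamStep p i) (D.gamTilde p) = D.form (D.gam i) (D.gamT p) :=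
  D.form_gamStep_gamStep le_rfl hi

theorem shift_gamStep (p : Fin D.n) {i : Fin D.m} (hi : (p : ℕ) ≤ i) :
    shift p (D.gamStep p i) = D.gamStep (p + 1) i := by
  show D.gamStep p i + _ = _
  rw [form_gamStep_gamTilde hi, gamStep, gamStep, add_assoc]
  congr 1
  have : (Finset.univ.filter fun q : Fin D.n => q.val < (p : ℕ) + 1)
      = insert p (Finset.univ.filter fun q : Fin D.n => q.val < (p : ℕ)) := by
    ext q
    simp only [Finset.mem_filter, Finset.mem_univ, true_and, Finset.mem_insert, Fin.ext_iff]
    omega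
  rw [this, Finset.sum_insert (by simp), add_comm]

/-- The bijection `rest p ≃ L_p`, `γ ↦ γ + (γ | gamTilde p) β_p`. -/
noncomputable def shiftEquiv (p : Fin D.n) : D.rest p ≃ D.lat (p + 1) :=
  have hmap : (D.rest p).map (shift p) = D.lat (p + 1) := by
    rw [rest_eq, lat_eq, Submodule.map_span, ← Set.range_comp]
    congr 2
    ext i
    exact shift_gamStep p ((Nat.le_succ _).trans i.2)
  Equiv.ofBijective (fun g => ⟨shift p g, by rw [← hmap]; exact Submodule.mem_map_of_mem g.2⟩)
    ⟨by
      intro g g' h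
      have h1 : shift p (g : H) = shift p (g' : H) := congrArg Subtype.val h
      have h2 : shift p ((g - g' : D.rest p) : H) = 0 := by
        rw [Submodule.coe_sub, map_sub, h1, sub_self]
      set x := g - g' with hx
      have h3 : (x : H) = -(D.form (x : H) (D.gamTilde p) • D.bet p) :=
        eq_neg_of_add_eq_zero_left h2
      -- A vector in the kernel is a multiple of β_p, and β_p is orthogonal to `rest p`; so it is
      -- isotropic in a positive definite lattice.
      have h4 : D.form (x : H) (x : H) = 0 := by
        conv_lhs => arg 2; rw [h3]
        rw [map_neg, map_smul, D.form_comm x (D.bet p), form_bet_rest le_rfl x.2]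
        simp
      have h5 : (x : H) = 0 := by
        refine (D.isGram_rest p).eq_zero_of_form_self ?_ h4
        rw [← rest_eq]
        exact x.2
      exact sub_eq_zero.1 (Subtype.ext h5), by
      rintro ⟨x, hx⟩
      rw [← hmap] at hx
      obtain ⟨g, hg, rfl⟩ := hx
      exact ⟨⟨g, hg⟩, rfl⟩⟩

theorem shiftEquiv_apply (p : Fin D.n) (g : D.rest p) :
    (shiftEquiv p g : H) = g + D.form (g : H) (D.gamTilde p) • D.bet p := rfl

end Setup

namespace Setup

variable {H : Type*} [AddCommGroup H] [Module ℂ H] {D : Setup H} {k : ℝ} {l : AffDual H}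

/-! ## One modification step -/

theorem offLattice_of_offPoles {τ : ℂ} {z : H} (hz : D.OffPoles τ z) (p : Fin D.n) :
    OffLattice τ (-D.form (D.bet p) z) := fun a b h => by
  apply hz p b a
  linear_combination -h

theorem summable_mockTerm_lat (hk : 0 < k) (hl : level l = k) {τ : ℂ} (hτ : 0 < τ.im) {z : H}
    (hz : D.OffPoles τ z) (t : ℂ) (s : ℕ) (S : Finset (Fin D.n)) :
    Summable fun g : D.lat s => mockTerm D.form l S D.bet g τ z t := by
  have h := (D.isGram_gamStep s).summable_mockTerm hk hl (S := S) (β := D.bet)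
    (fun q _ i => ⟨if (i.1 : ℕ) = q then -1 else 0, by
      rw [form_bet_gamStep]; push_cast; rfl⟩) hτ (fun q _ => offLattice_of_offPoles hz q) t
  rw [lat_eq]
  exact h

theorem T_eq_insert (p : Fin D.n) : D.T p = insert p (D.T (p + 1)) := by
  ext q
  simp only [T, Finset.mem_filter, Finset.mem_univ, true_and, Finset.mem_insert, Fin.ext_iff]
  omega

theorem wt_succ_fst (p : Fin D.n) (l : AffDual H) :
    (D.wt (p + 1) l).1 = (D.wt p l).1 + D.form l.1 (D.gamT p) • D.bet p := by
  rw [wt_fst, wt_fst, add_assoc]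
  congr 1
  have : (Finset.univ.filter fun q : Fin D.n => q.val < (p : ℕ) + 1)
      = insert p (Finset.univ.filter fun q : Fin D.n => q.val < (p : ℕ)) := by
    ext q
    simp only [Finset.mem_filter, Finset.mem_univ, true_and, Finset.mem_insert, Fin.ext_iff]
    omega
  rw [this, Finset.sum_insert (by simp), add_comm]

/-- The second argument of the rank one functions in the modification step. -/
noncomputable def stepArg (p : Fin D.n) (τ : ℂ) (z g : H) : ℂ :=
  D.form (D.bet p) z + D.form (coroot D.form (D.gamTilde p)) z
    + τ * D.form g (coroot D.form (D.gamTilde p))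

theorem form_coroot_gamTilde (p : Fin D.n) (x : H) :
    D.form (coroot D.form (D.gamTilde p)) x
      = 2 / D.form (D.gamT p) (D.gamT p) * D.form (D.gamTilde p) x := by
  rw [coroot, map_smul, LinearMap.smul_apply, form_gamTilde_self, smul_eq_mul]

/-- Only the denominator of β_p sees n, since γ̃_p is orthogonal to the other β_q and β_p is
orthogonal to `rest p`. In the exponent, n² has coefficient k|γ_p|²/2, the mixed term of g and n is
the τ-part of `stepArg`, and the change of weight by (λ | γ_p)β_p is undone by the factor e^{2πisz₁}
of Φ. -/
theorem mockTerm_split (hk : 0 < k)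
    (heven : ∀ x ∈ D.L, ∃ c : ℤ, (k : ℂ) * D.form x x = 2 * c) (hl : l ∈ D.weights k) (p : Fin D.n)
    (τ : ℂ) (z : H) (t : ℂ)
    (g : D.rest p) (n : ℤ) :
    mockTerm D.form (D.wt p l) (D.T p) D.bet (g + (n : ℂ) • D.gamTilde p) τ z t
      = mockTerm D.form (D.wt (p + 1) l) (D.T (p + 1)) D.bet g τ z t
        * (cexp (2 * Real.pi * I * D.deg k p * n
              * (-D.form (D.bet p) z + stepArg p τ z g)
            + 2 * Real.pi * I * D.charge l p * -D.form (D.bet p) z)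
          * qpow τ (D.deg k p * n ^ 2 + D.charge l p * n)
          / (1 - cexp (2 * Real.pi * I * -D.form (D.bet p) z) * qpow τ n)) := by
  obtain ⟨hdeg, -⟩ := deg_eq_and_pos hk heven p
  have hne := form_gamT_ne_zero p
  have hgb : ∀ q ∈ D.T (p + 1), D.form (D.bet q) (g + (n : ℂ) • D.gamTilde p)
      = D.form (D.bet q) g := fun q hq => by
    have : (p : ℕ) + 1 ≤ q := (Finset.mem_filter.1 hq).2
    rw [map_add, map_smul, form_bet_gamTilde, if_neg (by rw [Fin.ext_iff]; omega), smul_zero,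
      add_zero]
  have hpb : D.form (D.bet p) (g + (n : ℂ) • D.gamTilde p) = -n := by
    rw [map_add, map_smul, form_bet_gamTilde, if_pos rfl, form_bet_rest le_rfl g.2]
    simp
  rw [mockTerm_eq, mockTerm_eq, T_eq_insert, Finset.prod_insert (by simp [T]),
    Finset.prod_congr rfl (fun q hq => by rw [hgb q hq]), hpb, div_mul_div_comm, mul_comm (_ - _),
    level_wt, level_wt, hl.1]
  unfold qpow
  rw [← Complex.exp_add, ← Complex.exp_add, ← Complex.exp_add]
  have e2 : cexp (2 * Real.pi * I * (-D.form (D.bet p) z - τ * -n))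
      = cexp (2 * Real.pi * I * -D.form (D.bet p) z + 2 * Real.pi * I * τ * n) :=
    congrArg _ (by ring)
  rw [e2]
  congr 2
  have hw : D.form (D.wt p l).1 (D.gamTilde p) = D.form l.1 (D.gamT p) :=
    form_wt_gamStep hl le_rfl
  have hgt : D.form (D.gamTilde p) (g : H) = D.form (g : H) (D.gamTilde p) := D.form_comm _ _
  have hc : D.form (g : H) (coroot D.form (D.gamTilde p))
      = 2 / D.form (D.gamT p) (D.gamT p) * D.form (g : H) (D.gamTilde p) := by
    rw [form_comm, form_coroot_gamTilde, hgt]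
  rw [wt_succ_fst, wt_snd, wt_snd, stepArg, hc, form_coroot_gamTilde, hdeg, charge_eq hl]
  simp only [map_add, map_smul, LinearMap.add_apply, LinearMap.smul_apply, smul_eq_mul, hw, hgt,
    form_bet_rest le_rfl g.2, form_gamTilde_self]
  field_simp
  ring

theorem mockTheta_lat_eq (hk : 0 < k)
    (heven : ∀ x ∈ D.L, ∃ c : ℤ, (k : ℂ) * D.form x x = 2 * c) (hl : l ∈ D.weights k) (p : Fin D.n)
    {τ : ℂ} (hτ : 0 < τ.im) {z : H}
    (hz : D.OffPoles τ z) (t : ℂ) :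
    (Summable fun g : D.rest p => mockTerm D.form (D.wt (p + 1) l) (D.T (p + 1)) D.bet g τ z t
      * Phi (D.deg k p) (D.charge l p) τ (-D.form (D.bet p) z) (stepArg p τ z g)) ∧
    ∑' g : D.lat p, mockTerm D.form (D.wt p l) (D.T p) D.bet g τ z t
      = ∑' g : D.rest p, mockTerm D.form (D.wt (p + 1) l) (D.T (p + 1)) D.bet g τ z t
        * Phi (D.deg k p) (D.charge l p) τ (-D.form (D.bet p) z) (stepArg p τ z g) := by
  have hs := summable_mockTerm_lat hk (l := D.wt p l) (by rw [level_wt, hl.1]) hτ hz t p (D.T p)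
  rw [← (splitEquiv p).summable_iff] at hs
  have hs' : Summable fun x : D.rest p × ℤ =>
      mockTerm D.form (D.wt p l) (D.T p) D.bet (x.1 + (x.2 : ℂ) • D.gamTilde p) τ z t :=
    hs.congr fun x => by rw [Function.comp_apply, splitEquiv_apply]
  have hfib : ∀ g : D.rest p, ∑' n : ℤ,
      mockTerm D.form (D.wt p l) (D.T p) D.bet (g + (n : ℂ) • D.gamTilde p) τ z t
      = mockTerm D.form (D.wt (p + 1) l) (D.T (p + 1)) D.bet g τ z t
        * Phi (D.deg k p) (D.charge l p) τ (-D.form (D.bet p) z) (stepArg p τ z g) := fun g => by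
    rw [Phi, ← tsum_mul_left]
    exact tsum_congr fun n => mockTerm_split hk heven hl p τ z t g n
  refine ⟨hs'.prod.congr hfib, ?_⟩
  rw [← (splitEquiv p).tsum_eq]
  simp only [splitEquiv_apply]
  rw [hs'.tsum_prod]
  exact tsum_congr hfib

/-- With c = (g | γ̃^∨) one has `deg`·c = k(g | γ̃), so the elliptic factor of Φ̃ is e^{2πik(g |
γ̃)(β_p | z)}. The exponential gains just this factor when g moves by (g | γ̃)β_p; the norm of g and
its products with the weight and with the β_q do not change. -/
theorem mockTerm_mul_PhiMod (hk : 0 < k)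
    (heven : ∀ x ∈ D.L, ∃ c : ℤ, (k : ℂ) * D.form x x = 2 * c) (hl : l ∈ D.weights k) (p : Fin D.n)
    {τ : ℂ} (hτ : 0 < τ.im) {z : H}
    (hz : D.OffPoles τ z) (t : ℂ) (g : D.rest p) :
    mockTerm D.form (D.wt (p + 1) l) (D.T (p + 1)) D.bet g τ z t
        * PhiMod (D.deg k p) (D.charge l p) τ (-D.form (D.bet p) z) (stepArg p τ z g)
      = mockTerm D.form (D.wt (p + 1) l) (D.T (p + 1)) D.bet (shiftEquiv p g) τ z t
        * D.phiFactor l p τ z := by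
  obtain ⟨hdeg, hpos⟩ := deg_eq_and_pos hk heven p
  obtain ⟨c, hc⟩ := form_rest_coroot g.2
  have hne := form_gamT_ne_zero p
  have harg : stepArg p τ z g = D.form (D.bet p) z + D.form (coroot D.form (D.gamTilde p)) z
      + c * τ := by
    rw [stepArg, hc, mul_comm τ]
  rw [harg, PhiMod_add_int_mul hpos hτ (offLattice_of_offPoles hz p), phiFactor, hl.1, ← mul_assoc]
  congr 1
  rw [shiftEquiv_apply, mockTerm_eq, mockTerm_eq, div_mul_eq_mul_div, ← Complex.exp_add]
  have hgb : ∀ q, D.form (D.bet q) ((g : H) + D.form (g : H) (D.gamTilde p) • D.bet p)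
      = D.form (D.bet q) g := fun q => by
    rw [map_add, map_smul, D.bet_isotropic, smul_zero, add_zero]
  have hgp : D.form (g : H) (D.bet p) = 0 := by rw [form_comm, form_bet_rest le_rfl g.2]
  have hc' : (D.deg k p : ℂ) * c = k * D.form (g : H) (D.gamTilde p) := by
    rw [hdeg, ← hc, D.form_comm g, form_coroot_gamTilde, D.form_comm (D.gamTilde p) g]
    field_simp
  simp only [hgb, level_wt, hl.1]
  congr 2
  simp only [map_add, map_smul, LinearMap.add_apply, LinearMap.smul_apply, smul_eq_mul,
    form_wt_bet hl, form_bet_rest le_rfl g.2, hgp, D.bet_isotropic]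
  linear_combination (2 * Real.pi * I * D.form (D.bet p) z) * hc'

theorem stepModified_eq (hk : 0 < k)
    (heven : ∀ x ∈ D.L, ∃ c : ℤ, (k : ℂ) * D.form x x = 2 * c) (hl : l ∈ D.weights k) (p : Fin D.n)
    {τ : ℂ} (hτ : 0 < τ.im) {z : H}
    (hz : D.OffPoles τ z) (t : ℂ) :
    D.stepModified l p τ z t
      = mockTheta D.form (D.lat (p + 1)) (D.wt (p + 1) l) (D.T (p + 1)) D.bet τ z t
        * D.phiFactor l p τ z := by
  obtain ⟨hS1, h1⟩ := mockTheta_lat_eq hk heven hl p hτ hz t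
  have hS2 : Summable fun g : D.rest p =>
      mockTerm D.form (D.wt (p + 1) l) (D.T (p + 1)) D.bet g τ z t
        * PhiMod (D.deg k p) (D.charge l p) τ (-D.form (D.bet p) z) (stepArg p τ z g) := by
    have h := summable_mockTerm_lat hk (l := D.wt (p + 1) l) (by rw [level_wt, hl.1]) hτ hz t
      (p + 1) (D.T (p + 1))
    rw [← (shiftEquiv p).summable_iff] at h
    exact (h.mul_right (D.phiFactor l p τ z)).congr fun g =>
      (mockTerm_mul_PhiMod hk heven hl p hτ hz t g).symm
  -- Written as 2(Φ - Φ̃), the Φ_add-sum is a difference of two sums already known to converge.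
  have hadd : ∀ g : D.rest p, mockTerm D.form (D.wt (p + 1) l) (D.T (p + 1)) D.bet g τ z t
        * PhiAdd (D.deg k p) (D.charge l p) τ (-D.form (D.bet p) z) (stepArg p τ z g)
      = 2 * (mockTerm D.form (D.wt (p + 1) l) (D.T (p + 1)) D.bet g τ z t
          * Phi (D.deg k p) (D.charge l p) τ (-D.form (D.bet p) z) (stepArg p τ z g)
        - mockTerm D.form (D.wt (p + 1) l) (D.T (p + 1)) D.bet g τ z t
          * PhiMod (D.deg k p) (D.charge l p) τ (-D.form (D.bet p) z) (stepArg p τ z g)) :=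
    fun g => by
      rw [PhiMod]
      ring
  have h2 : ∑' g : D.rest p, mockTerm D.form (D.wt (p + 1) l) (D.T (p + 1)) D.bet g τ z t
        * PhiMod (D.deg k p) (D.charge l p) τ (-D.form (D.bet p) z) (stepArg p τ z g)
      = (∑' g : D.lat (p + 1), mockTerm D.form (D.wt (p + 1) l) (D.T (p + 1)) D.bet g τ z t)
        * D.phiFactor l p τ z := by
    rw [← (shiftEquiv p).tsum_eq, ← tsum_mul_right]
    exact tsum_congr fun g => mockTerm_mul_PhiMod hk heven hl p hτ hz t g
  rw [stepModified, mockTheta, mockTheta, h1, affForm_wt hl, affForm_wt hl, level_wt, level_wt,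
    hl.1]
  change _ - 1 / 2 * (_ * ∑' g : D.rest p,
    mockTerm D.form (D.wt (p + 1) l) (D.T (p + 1)) D.bet g τ z t
      * PhiAdd (D.deg k p) (D.charge l p) τ (-D.form (D.bet p) z) (stepArg p τ z g)) = _
  rw [tsum_congr hadd, tsum_mul_left, hS1.tsum_sub hS2, h2]
  ring

/-- A stage is defined from the already factored form of the preceding one, so a case distinction
replaces an induction. -/
theorem modifiedStage_eq (hk : 0 < k)
    (heven : ∀ x ∈ D.L, ∃ c : ℤ, (k : ℂ) * D.form x x = 2 * c) (hl : l ∈ D.weights k) {τ : ℂ}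
    (hτ : 0 < τ.im) {z : H} (hz : D.OffPoles τ z) (t : ℂ) {s : ℕ} (hs : s ≤ D.n) :
    D.modifiedStage l τ z t s = mockTheta D.form (D.lat s) (D.wt s l) (D.T s) D.bet τ z t
      * ∏ p : Fin D.n with p.val < s, D.phiFactor l p τ z := by
  cases s with
  | zero =>
    have hw : D.wt 0 l = l := by simp [wt]
    simp [modifiedStage, L_eq_lat, hw]
  | succ s =>
    have h : s < D.n := hs
    rw [modifiedStage, dif_pos h, stepModified_eq hk heven hl ⟨s, h⟩ hτ hz, mul_assoc]
    congr 1
    have hset : (Finset.univ.filter fun q : Fin D.n => q.val < s + 1)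
        = insert ⟨s, h⟩ (Finset.univ.filter fun q : Fin D.n => q.val < s) := by
      ext q
      simp only [Finset.mem_filter, Finset.mem_univ, true_and, Finset.mem_insert, Fin.ext_iff]
      omega
    rw [hset, Finset.prod_insert (by simp)]

/-- The modified mock theta function is `Θ^M_{λ_n}` times the product of the rank one factors. -/
theorem modTheta_eq_mul_prod (hk : 0 < k)
    (heven : ∀ x ∈ D.L, ∃ c : ℤ, (k : ℂ) * D.form x x = 2 * c) (hl : l ∈ D.weights k) {τ : ℂ}
    (hτ : 0 < τ.im) {z : H} (hz : D.OffPoles τ z) (t : ℂ) :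
    D.modTheta l τ z t = mockTheta D.form D.M (D.wt D.n l) ∅ D.bet τ z t
      * ∏ p : Fin D.n, D.phiFactor l p τ z := by
  have hT : D.T D.n = ∅ := by
    ext q
    simp [T]
  rw [modTheta, modifiedStage_eq hk heven hl hτ hz t le_rfl, hT, M]
  congr 1
  refine Finset.prod_congr ?_ fun _ _ => rfl
  ext q
  simp

end Setup
-- The complex span of M and the orthogonal projection to it
section Lattice

variable {H : Type*} [AddCommGroup H] [Module ℂ H] {ι : Type*} [Fintype ι] [DecidableEq ι]
  {B : LinearMap.BilinForm ℂ H} {e : ι → H} {A : Matrix ι ι ℝ}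

/-- The combination of the `e i` that has the same products with the `e i` as `z`. -/
noncomputable def gramProj (B : LinearMap.BilinForm ℂ H) (e : ι → H) (A : Matrix ι ι ℝ) (z : H) :
    H :=
  comb e ((A.map Complex.ofReal)⁻¹ *ᵥ fun i => B (e i) z)

theorem IsGram.form_gramProj (h : IsGram B e A) (z : H) (j : ι) :
    B (e j) (gramProj B e A z) = B (e j) z := by
  have hu := (Matrix.isUnit_iff_isUnit_det _).1 (isUnit_map_ofReal h.posDef.isUnit)
  rw [gramProj, h.form_comb_basis, mulVec_mulVec, Matrix.mul_nonsing_inv _ hu, one_mulVec]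

end Lattice

namespace Setup

variable {H : Type*} [AddCommGroup H] [Module ℂ H] (D : Setup H)

/-- The basis of `M`. -/
def basisM (i : D.Idx D.n) : H := D.gamStep D.n i

theorem isGram_basisM : IsGram D.form D.basisM (D.gramIdx D.n) := D.isGram_gamStep D.n

theorem M_eq : D.M = Submodule.span ℤ (Set.range D.basisM) := D.lat_eq D.n

theorem card_idx : Fintype.card (D.Idx D.n) = D.m - D.n := by
  have h := Fintype.card_subtype_compl (fun i : Fin D.m => (i : ℕ) < D.n)
  have h2 : Fintype.card {i : Fin D.m // (i : ℕ) < D.n} = D.n := by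
    rw [Fintype.card_subtype, Fin.card_filter_val_lt, min_eq_right D.n_le_m]
  simp only [not_lt] at h
  rw [h, h2, Fintype.card_fin]

theorem form_basisM_bet (i : D.Idx D.n) (p : Fin D.n) : D.form (D.basisM i) (D.bet p) = 0 := by
  have := i.2
  rw [basisM, form_gamStep_bet, if_neg (by omega)]

theorem form_basisM_gamT (i : D.Idx D.n) (p : Fin D.n) : D.form (D.basisM i) (D.gamT p) = 0 := by
  rw [basisM, gamT, form_gamStep_gam, if_pos]
  simp

theorem form_gamT_bet (p q : Fin D.n) : D.form (D.gamT p) (D.bet q) = if p = q then -1 else 0 := by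
  rw [gamT, D.gam_bet]
  simp [Fin.ext_iff]

/-- The Gram matrix is triangular by blocks: products with the β_q isolate the coefficients of the
γ_q, then those with M isolate the coefficients in M, then those with the γ_q isolate the
coefficients of the β_q. -/
theorem linearIndependent_basis :
    LinearIndependent ℂ (Sum.elim D.basisM (Sum.elim D.gamT D.bet)) := by
  rw [Fintype.linearIndependent_iff]
  intro c hc
  simp only [Fintype.sum_sum_type, Sum.elim_inl, Sum.elim_inr] at hc
  have pair : ∀ x, D.form x (∑ i, c (Sum.inl i) • D.basisM i
      + (∑ p, c (Sum.inr (Sum.inl p)) • D.gamT p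
      + ∑ p, c (Sum.inr (Sum.inr p)) • D.bet p)) = 0 := fun x => by rw [hc, map_zero]
  simp only [map_add, map_sum, map_smul, smul_eq_mul] at pair
  have h1 : ∀ q, c (Sum.inr (Sum.inl q)) = 0 := fun q => by
    have := pair (D.bet q)
    simpa [D.form_comm (D.bet q), form_basisM_bet, form_gamT_bet, D.bet_isotropic] using this
  have h2 : (fun i => c (Sum.inl i)) = 0 := by
    refine D.isGram_basisM.eq_zero_of_forall fun j => ?_
    have := pair (D.basisM j)
    simpa [h1, form_basisM_bet, form_comb_right] using this
  have h2' : ∀ i, c (Sum.inl i) = 0 := fun i => congrFun h2 i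
  have h3 : ∀ q, c (Sum.inr (Sum.inr q)) = 0 := fun q => by
    have := pair (D.gamT q)
    simpa [h1, h2', form_gamT_bet] using this
  rintro (i | p | p)
  exacts [h2' i, h1 p, h3 p]

variable {D}

/-- The `γ_p`, the `β_p` and the basis of `M` span `𝔥`. -/
theorem eq_zero_of_orthogonal [FiniteDimensional ℂ H] {w : H}
    (h1 : ∀ i, D.form (D.basisM i) w = 0) (h2 : ∀ p, D.form (D.gamT p) w = 0)
    (h3 : ∀ p, D.form (D.bet p) w = 0) : w = 0 := by
  have hspan := D.linearIndependent_basis.span_eq_top_of_card_eq_finrank' (by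
    rw [Fintype.card_sum, Fintype.card_sum, card_idx, Fintype.card_fin, D.dim_eq]
    have := D.n_le_m
    omega)
  have key : ∀ x, D.form x w = 0 := by
    intro x
    have hx : x ∈ Submodule.span ℂ (Set.range (Sum.elim D.basisM (Sum.elim D.gamT D.bet))) := by
      rw [hspan]
      trivial
    induction hx using Submodule.span_induction with
    | mem x hx =>
      obtain ⟨i | p | p, rfl⟩ := hx
      exacts [h1 i, h2 p, h3 p]
    | zero => simp
    | add x y _ _ hx hy => simp [hx, hy]
    | smul c x _ hx => simp [hx]
  exact D.form_nondeg.2 w key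

theorem mem_MC_iff {x : H} : x ∈ D.MC ↔ ∃ c, comb D.basisM c = x := by
  rw [MC, M_eq, Submodule.span_span_of_tower, Submodule.mem_span_range_iff_exists_fun]
  rfl

theorem mem_MPerp_iff {y : H} : y ∈ D.MPerp ↔ ∀ i, D.form (D.basisM i) y = 0 := by
  constructor
  · intro h i
    rw [form_comm]
    exact h _ (by rw [M_eq]; exact Submodule.subset_span ⟨i, rfl⟩)
  · intro h x hx
    rw [M_eq] at hx
    obtain ⟨v, rfl⟩ := mem_span_iff_comb.1 hx
    rw [form_comm, form_comb_left]
    simp [h]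

theorem form_MC_MPerp {x y : H} (hx : x ∈ D.MC) (hy : y ∈ D.MPerp) : D.form x y = 0 := by
  obtain ⟨c, rfl⟩ := mem_MC_iff.1 hx
  rw [form_comb_left]
  simp [mem_MPerp_iff.1 hy]

theorem M_le_MC {x : H} (hx : x ∈ D.M) : x ∈ D.MC := Submodule.subset_span hx

theorem eq_zero_of_mem_MC_of_mem_MPerp {x : H} (hx : x ∈ D.MC) (hy : x ∈ D.MPerp) : x = 0 := by
  obtain ⟨c, rfl⟩ := mem_MC_iff.1 hx
  rw [D.isGram_basisM.eq_zero_of_forall (mem_MPerp_iff.1 hy)]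
  simp [comb]

variable (D) in
/-- The orthogonal projection to `ℂ M`. -/
noncomputable def proj (z : H) : H := gramProj D.form D.basisM (D.gramIdx D.n) z

theorem isProj_proj (z : H) : D.IsProj z (D.proj z) :=
  ⟨mem_MC_iff.2 ⟨_, rfl⟩, mem_MPerp_iff.2 fun i => by
    rw [map_sub, proj, D.isGram_basisM.form_gramProj, sub_self]⟩

theorem IsProj.eq {z z₁ z₂ : H} (h₁ : D.IsProj z z₁) (h₂ : D.IsProj z z₂) : z₁ = z₂ := by
  rw [← sub_eq_zero]
  refine eq_zero_of_mem_MC_of_mem_MPerp (sub_mem h₁.1 h₂.1) ?_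
  have := sub_mem h₂.2 h₁.2
  rwa [sub_sub_sub_cancel_left] at this

theorem existsUnique_isProj (z : H) : ∃! z₁, D.IsProj z z₁ :=
  ⟨D.proj z, isProj_proj z, fun _ h => h.eq (isProj_proj z)⟩

theorem IsProj.form_eq {z z₁ x : H} (h : D.IsProj z z₁) (hx : x ∈ D.MC) :
    D.form x z = D.form x z₁ := by
  rw [← sub_eq_zero, ← map_sub]
  exact form_MC_MPerp hx h.2

section FiniteDimensional

variable [FiniteDimensional ℂ H]

theorem mem_MC_of_orthogonal {x : H} (h1 : ∀ p, D.form (D.gamT p) x = 0)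
    (h2 : ∀ p, D.form (D.bet p) x = 0) : x ∈ D.MC := by
  obtain ⟨hp, hq⟩ := isProj_proj (D := D) x
  obtain ⟨c, hc⟩ := mem_MC_iff.1 hp
  have : x - D.proj x = 0 := by
    refine eq_zero_of_orthogonal (mem_MPerp_iff.1 hq) (fun p => ?_) fun p => ?_
    · rw [map_sub, h1, ← hc, form_comb_right]
      simp [D.form_comm (D.gamT p), form_basisM_gamT]
    · rw [map_sub, h2, ← hc, form_comb_right]
      simp [D.form_comm (D.bet p), form_basisM_bet]
  rw [sub_eq_zero.1 this]
  exact hp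

/-- The vector λ_n is orthogonal to the γ_p through its correction terms and to the β_p by
definition of P_{k,T}; together with M these span 𝔥. -/
theorem wt_mem_MC {k : ℝ} {l : AffDual H} (hl : l ∈ D.weights k) : (D.wt D.n l).1 ∈ D.MC := by
  refine mem_MC_of_orthogonal (fun p => ?_) fun p => ?_
  · rw [form_comm, gamT, form_wt_gam, if_pos]
    simp
  · rw [form_comm, form_wt_bet hl]

/-- The norm of `z` in terms of its orthogonal projection to `ℂ M`. -/
theorem IsProj.form_self {z z₁ : H} (h : D.IsProj z z₁) :
    D.form z z = D.form z₁ z₁ - 2 * ∑ p, D.form (D.gamT p) z * D.form (D.bet p) z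
      - ∑ p, ∑ i, D.form (D.gamT p) (D.gamT i) * D.form (D.bet p) z * D.form (D.bet i) z := by
  -- These are, up to sign for y, the coefficients of z - z₁ in the γ_p and the β_p. The products
  -- with the β_q give -y, and then those with the γ_q give b.
  set y := fun p => D.form (D.bet p) z with hy
  set b := fun p => -(∑ i, D.form (D.gamT p) (D.gamT i) * y i) - D.form (D.gamT p) z with hb
  obtain ⟨c, hc⟩ := mem_MC_iff.1 h.1
  have hg : ∀ p, D.form (D.gamT p) z₁ = 0 := fun p => by
    rw [← hc, form_comb_right]
    simp [D.form_comm (D.gamT p), form_basisM_gamT]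
  have hβ : ∀ p, D.form (D.bet p) z₁ = 0 := fun p => by
    rw [← hc, form_comb_right]
    simp [D.form_comm (D.bet p), form_basisM_bet]
  have hdec : z - z₁ = ∑ p, (-y p) • D.gamT p + ∑ p, b p • D.bet p := by
    rw [← sub_eq_zero]
    refine eq_zero_of_orthogonal (D := D) (fun i => ?_) (fun q => ?_) fun q => ?_
    · rw [map_sub, mem_MPerp_iff.1 h.2]
      simp [form_basisM_gamT, form_basisM_bet]
    · simp only [map_sub, map_add, map_sum, map_smul, hg, form_gamT_bet, smul_eq_mul, mul_ite,
        mul_neg, mul_one, mul_zero, Finset.sum_ite_eq, Finset.mem_univ, if_true, hb]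
      simp only [neg_mul, Finset.sum_neg_distrib, mul_comm (y _)]
      ring
    · simp [hβ, D.form_comm (D.bet q) (D.gamT _), form_gamT_bet, D.bet_isotropic, hy]
  have h1 : D.form z z = D.form z₁ z₁ + D.form z (z - z₁) := by
    have h2 : D.form z z₁ = D.form z₁ z₁ := by rw [form_comm, h.form_eq h.1]
    rw [map_sub, h2]
    ring
  rw [h1, hdec, D.form_comm z]
  simp only [map_add, map_sum, map_smul, smul_eq_mul, LinearMap.add_apply, LinearMap.sum_apply,
    LinearMap.smul_apply]
  rw [sub_sub, sub_eq_add_neg, Finset.mul_sum, ← Finset.sum_add_distrib, ← Finset.sum_add_distrib,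
    ← Finset.sum_neg_distrib]
  congr 1
  refine Finset.sum_congr rfl fun p _ => ?_
  have : ∑ i, D.form (D.gamT p) (D.gamT i) * D.form (D.bet p) z * D.form (D.bet i) z
      = (∑ i, D.form (D.gamT p) (D.gamT i) * y i) * y p := by
    rw [Finset.sum_mul]
    exact Finset.sum_congr rfl fun i _ => by simp only [hy]; ring
  rw [this]
  simp only [hb, hy]
  ring

end FiniteDimensional

end Setup
-- Theta functions of a lattice and their inversion
section Lattice

variable {H : Type*} [AddCommGroup H] [Module ℂ H] {ι : Type*} [Fintype ι]
  {B : LinearMap.BilinForm ℂ H} {e : ι → H} {A : Matrix ι ι ℝ}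

/-- The function `e^x` of level `k`, times the power `q^{(x|x)/2k}`. -/
noncomputable def thetaTerm (B : LinearMap.BilinForm ℂ H) (k : ℝ) (τ : ℂ) (z x : H) : ℂ :=
  cexp (2 * Real.pi * I * B x z + Real.pi * I * τ / k * B x x)

/-- The prefactor q^{|λ|²/2k} completes the square, so that a term depends only on the vector λ̄ +
kγ and on the level; the δ-coordinate cancels. -/
theorem mockTheta_empty (B : LinearMap.BilinForm ℂ H) (hB : ∀ x y, B x y = B y x)
    (L : Submodule ℤ H) {k : ℝ} (hk : 0 < k) {l : AffDual H} (hl : level l = k) {κ : Type*}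
    (β : κ → H) (τ : ℂ) (z : H) (t : ℂ) :
    mockTheta B L l ∅ β τ z t
      = cexp (2 * Real.pi * I * k * t) * ∑' g : L, thetaTerm B k τ z (l.1 + (k : ℂ) • (g : H)) := by
  have hk' : (k : ℂ) ≠ 0 := by exact_mod_cast hk.ne'
  rw [mockTheta, ← tsum_mul_left, ← tsum_mul_left]
  refine tsum_congr fun g => ?_
  rw [mockTerm_eq, Finset.prod_empty, div_one, qpow, thetaTerm, ← Complex.exp_add,
    ← Complex.exp_add, affForm, hl]
  congr 1
  have h1 : l.2.1 = k := hl
  simp only [h1, map_add, map_smul, LinearMap.add_apply, LinearMap.smul_apply, smul_eq_mul,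
    hB g l.1]
  field_simp
  ring

theorem IsGram.summable_thetaTerm (h : IsGram B e A) (hB : ∀ x y, B x y = B y x) {k : ℝ}
    (hk : 0 < k) {τ : ℂ} (hτ : 0 < τ.im) (z x : H) :
    Summable fun g : Submodule.span ℤ (Set.range e) => thetaTerm B k τ z (x + (k : ℂ) • (g : H)) := by
  have hk' : (k : ℂ) ≠ 0 := by exact_mod_cast hk.ne'
  rw [← h.latticeEquiv.summable_iff]
  have hs := summable_cexp_quadForm (h.posDef.smul hk) hτ (fun i => k * B (e i) z + τ * B (e i) x)
  refine (hs.mul_left (thetaTerm B k τ z x)).congr fun v => ?_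
  rw [Function.comp_apply, h.latticeEquiv_apply, thetaTerm, thetaTerm, ← Complex.exp_add,
    quadForm_smul, ← h.form_comb_self]
  congr 1
  have hw : (intVec v ⬝ᵥ fun i => k * B (e i) z + τ * B (e i) x)
      = k * B (comb e (intVec v)) z + τ * B (comb e (intVec v)) x := by
    rw [form_comb_left, form_comb_left, dotProduct, Finset.mul_sum, Finset.mul_sum,
      ← Finset.sum_add_distrib]
    exact Finset.sum_congr rfl fun i _ => by ring
  simp only [hw, map_add, map_smul, LinearMap.add_apply, LinearMap.smul_apply, smul_eq_mul,
    hB x (comb e (intVec v))]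
  field_simp
  ring

variable [DecidableEq ι]

/-- The element of the dual lattice with coordinates `v`. -/
noncomputable def dualComb (e : ι → H) (A : Matrix ι ι ℝ) (v : ι → ℂ) : H :=
  comb e ((A.map Complex.ofReal)⁻¹ *ᵥ v)

theorem IsGram.form_dualComb (h : IsGram B e A) (v : ι → ℂ) (j : ι) :
    B (e j) (dualComb e A v) = v j := by
  have hu := (Matrix.isUnit_iff_isUnit_det _).1 (isUnit_map_ofReal h.posDef.isUnit)
  rw [dualComb, h.form_comb_basis, mulVec_mulVec, Matrix.mul_nonsing_inv _ hu, one_mulVec]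

theorem IsGram.dualComb_mulVec (h : IsGram B e A) (v : ι → ℂ) :
    dualComb e A (A.map Complex.ofReal *ᵥ v) = comb e v := by
  have hu := (Matrix.isUnit_iff_isUnit_det _).1 (isUnit_map_ofReal h.posDef.isUnit)
  rw [dualComb, mulVec_mulVec, Matrix.nonsing_inv_mul _ hu, one_mulVec]

theorem IsGram.quadForm_inv (h : IsGram B e A) (v : ι → ℂ) :
    quadForm A⁻¹ v = B (dualComb e A v) (dualComb e A v) := by
  have hu := (Matrix.isUnit_iff_isUnit_det _).1 (isUnit_map_ofReal h.posDef.isUnit)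
  rw [quadForm, map_ofReal_inv h.posDef.isUnit]
  conv_rhs => arg 1; rw [dualComb]
  rw [form_comb_left, dotProduct]
  simp only [h.form_dualComb]
  exact Finset.sum_congr rfl fun i _ => mul_comm _ _

/-- Jacobi inversion for the theta function of a shifted lattice. -/
theorem IsGram.tsum_thetaTerm_neg_one_div (h : IsGram B e A) (hB : ∀ x y, B x y = B y x) {k : ℝ}
    (hk : 0 < k) {τ : ℂ} (hτ : 0 < τ.im) (z : H) (c : ι → ℂ) :
    ∑' v : ι → ℤ, thetaTerm B k (-1 / τ) (τ⁻¹ • z) (comb e c + (k : ℂ) • comb e (intVec v))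
      = ((√(k • A).det : ℝ) : ℂ)⁻¹ * ((-I * τ) ^ (1 / 2 : ℂ)) ^ Fintype.card ι
        * cexp (Real.pi * I * k / τ * B (gramProj B e A z) (gramProj B e A z))
        * ∑' v : ι → ℤ, cexp (-(2 * Real.pi * I / k) * B (comb e c) (dualComb e A (intVec v)))
          * thetaTerm B k τ z (dualComb e A (intVec v)) := by
  have hk' : (k : ℂ) ≠ 0 := by exact_mod_cast hk.ne'
  have hτ0 : τ ≠ 0 := fun h0 => by simp [h0] at hτ
  set x := comb e c with hx
  set z₁ := gramProj B e A z with hz₁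
  set w : ι → ℂ := fun i => (k * B (e i) z - B (e i) x) / τ with hw
  have hP := tsum_cexp_quadForm (h.posDef.smul hk) (neg_one_div_im_pos hτ) w
  -- Here -i(-1/τ) = (-iτ)⁻¹, and -iτ has positive real part, so that inversion commutes with the
  -- principal square root.
  have hconst : ((-I * (-1 / τ)) ^ (1 / 2 : ℂ))⁻¹ = (-I * τ) ^ (1 / 2 : ℂ) := by
    have h1 : -I * (-1 / τ) = (-I * τ)⁻¹ := by
      rw [mul_inv, ← neg_inv, Complex.inv_I]
      field_simp
    rw [h1, Complex.inv_cpow, inv_inv]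
    rw [Ne, Complex.arg_eq_pi_iff]
    rintro ⟨h2, -⟩
    simp at h2
    linarith
  have hL : ∀ v : ι → ℤ,
      thetaTerm B k (-1 / τ) (τ⁻¹ • z) (x + (k : ℂ) • comb e (intVec v))
      = thetaTerm B k (-1 / τ) (τ⁻¹ • z) x
        * cexp (Real.pi * I * (-1 / τ) * quadForm (k • A) (intVec v)
          + 2 * Real.pi * I * (intVec v ⬝ᵥ w)) := fun v => by
    have hd : intVec v ⬝ᵥ w = (k * B (comb e (intVec v)) z - B (comb e (intVec v)) x) / τ := by
      rw [form_comb_left, form_comb_left, dotProduct, Finset.mul_sum, ← Finset.sum_sub_distrib,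
        Finset.sum_div]
      exact Finset.sum_congr rfl fun i _ => by simp only [hw]; ring
    rw [thetaTerm, thetaTerm, ← Complex.exp_add, quadForm_smul, ← h.form_comb_self, hd]
    simp only [map_add, map_smul, LinearMap.add_apply, LinearMap.smul_apply, smul_eq_mul,
      hB x (comb e (intVec v))]
    congr 1
    field_simp
    ring
  -- The shift in Poisson summation corresponds to the vector (kz₁ - x)/τ. Expanding the square
  -- gives the factor in |z₁|², the character e^{-2πi(x|y)/k} and the theta term at τ.
  have hdual : ∀ v : ι → ℤ, dualComb e A (intVec v + w)
      = dualComb e A (intVec v) + τ⁻¹ • ((k : ℂ) • z₁ - x) := fun v => by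
    have h1 : w = τ⁻¹ • ((k : ℂ) • (fun i => B (e i) z) - A.map Complex.ofReal *ᵥ c) := by
      ext i
      rw [Pi.smul_apply, Pi.sub_apply, Pi.smul_apply, ← h.form_comb_basis, hw, ← hx]
      simp only [smul_eq_mul]
      field_simp
    have h2 : dualComb e A w = τ⁻¹ • ((k : ℂ) • z₁ - x) := by
      rw [h1, dualComb, mulVec_smul, comb_smul, mulVec_sub, comb_sub, mulVec_smul, comb_smul]
      have h3 := h.dualComb_mulVec c
      rw [dualComb] at h3
      rw [h3]
      rfl
    rw [← h2, dualComb, mulVec_add, comb_add]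
    rfl
  have hdz : ∀ v : ι → ℤ, B (dualComb e A (intVec v)) z = B (dualComb e A (intVec v)) z₁ :=
    fun v => by
      rw [dualComb, form_comb_left, form_comb_left]
      exact Finset.sum_congr rfl fun i _ => by rw [hz₁, h.form_gramProj]
  have hxz : B x z = B x z₁ := by
    rw [hx, form_comb_left, form_comb_left]
    exact Finset.sum_congr rfl fun i _ => by rw [hz₁, h.form_gramProj]
  have hinv : (k • A)⁻¹ = k⁻¹ • A⁻¹ := by
    have := Matrix.inv_smul' (A := A) (Units.mk0 k hk.ne')
      ((Matrix.isUnit_iff_isUnit_det _).1 h.posDef.isUnit)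
    simpa [Units.smul_def] using this
  have hR : ∀ v : ι → ℤ, thetaTerm B k (-1 / τ) (τ⁻¹ • z) x
        * cexp (-(Real.pi * I / (-1 / τ)) * quadForm (k • A)⁻¹ (intVec v + w))
      = cexp (Real.pi * I * k / τ * B z₁ z₁)
        * (cexp (-(2 * Real.pi * I / k) * B x (dualComb e A (intVec v)))
          * thetaTerm B k τ z (dualComb e A (intVec v))) := fun v => by
    rw [hinv, quadForm_smul, h.quadForm_inv, hdual, thetaTerm, thetaTerm, ← Complex.exp_add,
      ← Complex.exp_add, ← Complex.exp_add, hdz]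
    simp only [map_add, map_sub, map_smul, LinearMap.add_apply, LinearMap.sub_apply,
      LinearMap.smul_apply, smul_eq_mul, hB (dualComb e A (intVec v)) x,
      hB z₁ (dualComb e A (intVec v)), hB z₁ x, hxz]
    push_cast
    congr 1
    field_simp
    ring
  rw [tsum_congr hL, tsum_mul_left, hP, hconst, mul_left_comm, ← tsum_mul_left, tsum_congr hR,
    tsum_mul_left]
  ring

end Lattice

namespace Setup

variable {H : Type*} [AddCommGroup H] [Module ℂ H] {D : Setup H} {k : ℝ} {l : AffDual H}

/-! ## The dual lattice of `M` and the classes of weights -/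

theorem form_MC_gamT {x : H} (hx : x ∈ D.MC) (p : Fin D.n) : D.form x (D.gamT p) = 0 := by
  obtain ⟨c, rfl⟩ := mem_MC_iff.1 hx
  rw [form_comb_left]
  simp [form_basisM_gamT]

theorem form_MC_bet {x : H} (hx : x ∈ D.MC) (p : Fin D.n) : D.form x (D.bet p) = 0 := by
  obtain ⟨c, rfl⟩ := mem_MC_iff.1 hx
  rw [form_comb_left]
  simp [form_basisM_bet]

theorem bet_mem_MPerp (p : Fin D.n) : D.bet p ∈ D.MPerp :=
  mem_MPerp_iff.2 fun i => D.form_basisM_bet i p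

theorem wt_sub_mem_MPerp (l : AffDual H) : (D.wt D.n l).1 - l.1 ∈ D.MPerp := by
  rw [wt_fst, add_sub_cancel_left]
  exact sum_mem fun p _ => D.MPerp.smul_mem _ (bet_mem_MPerp p)

theorem isGram_gam_idx :
    IsGram D.form (fun i : D.Idx D.n => D.gam i) (D.gramIdx D.n) :=
  ⟨D.gramIdx_posDef _, fun i j => D.form_gam_gam i j⟩

/-- The basis of M has the same Gram matrix as the γ_i with i > n, so integrality and evenness pass
from L to M although M need not lie in L. -/
theorem exists_mem_L_form_eq {x y : H} (hx : x ∈ D.M) (hy : y ∈ D.M) :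
    ∃ x' ∈ D.L, ∃ y' ∈ D.L, D.form x y = D.form x' y' ∧ D.form x x = D.form x' x' := by
  rw [M_eq] at hx hy
  obtain ⟨v, rfl⟩ := mem_span_iff_comb.1 hx
  obtain ⟨w, rfl⟩ := mem_span_iff_comb.1 hy
  have hL : ∀ v : D.Idx D.n → ℤ, comb (fun i : D.Idx D.n => D.gam i) (intVec v) ∈ D.L := fun v =>
    Submodule.span_mono (by rintro _ ⟨i, rfl⟩; exact ⟨i, rfl⟩) (mem_span_iff_comb.2 ⟨v, rfl⟩)
  refine ⟨_, hL v, _, hL w, ?_, ?_⟩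
  · rw [D.isGram_basisM.form_comb_comb, isGram_gam_idx.form_comb_comb]
  · rw [D.isGram_basisM.form_comb_comb, isGram_gam_idx.form_comb_comb]

theorem exists_form_wt_eq_int (hl : l ∈ D.weights k) {x : H} (hx : x ∈ D.M) :
    ∃ c : ℤ, D.form (D.wt D.n l).1 x = c := by
  rw [M_eq] at hx
  obtain ⟨v, rfl⟩ := mem_span_iff_comb.1 hx
  choose c hc using fun i : D.Idx D.n => form_weight_gam hl i.1
  refine ⟨∑ i, v i * c i, ?_⟩
  rw [form_comb_right]
  push_cast
  exact Finset.sum_congr rfl fun i _ => by rw [basisM, form_wt_gamStep hl i.2, hc, intVec]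

theorem mem_MDual_iff {x : H} : x ∈ D.MDual ↔
    ∃ v : D.Idx D.n → ℤ, dualComb D.basisM (D.gramIdx D.n) (intVec v) = x := by
  constructor
  · rintro ⟨hx, hi⟩
    choose v hv using fun i : D.Idx D.n =>
      hi (D.basisM i) (by rw [M_eq]; exact Submodule.subset_span ⟨i, rfl⟩)
    refine ⟨v, sub_eq_zero.1 (eq_zero_of_mem_MC_of_mem_MPerp (D := D)
      (sub_mem (mem_MC_iff.2 ⟨_, rfl⟩) hx) (mem_MPerp_iff.2 fun i => ?_))⟩
    rw [map_sub, D.isGram_basisM.form_dualComb, form_comm, hv, intVec, sub_self]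
  · rintro ⟨v, rfl⟩
    refine ⟨mem_MC_iff.2 ⟨_, rfl⟩, fun y hy => ?_⟩
    rw [M_eq] at hy
    obtain ⟨u, rfl⟩ := mem_span_iff_comb.1 hy
    refine ⟨∑ i, u i * v i, ?_⟩
    rw [form_comm, form_comb_left]
    simp only [D.isGram_basisM.form_dualComb, intVec]
    push_cast
    rfl

theorem mem_kM_iff {x : H} : x ∈ D.kM k ↔ ∃ y ∈ D.M, (k : ℂ) • y = x := AddSubgroup.mem_map

theorem smul_mem_MDual (hint : ∀ x ∈ D.L, ∀ y ∈ D.L, ∃ c : ℤ, (k : ℂ) * D.form x y = c) {x : H}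
    (hx : x ∈ D.M) : (k : ℂ) • x ∈ D.MDual := by
  refine ⟨D.MC.smul_mem _ (M_le_MC hx), fun y hy => ?_⟩
  obtain ⟨x', hx', y', hy', h, -⟩ := exists_mem_L_form_eq hx hy
  obtain ⟨c, hc⟩ := hint x' hx' y' hy'
  exact ⟨c, by rw [map_smul, LinearMap.smul_apply, h, smul_eq_mul, hc]⟩

/-- Provides a weight above every vector of M*: a vector in ℂM is orthogonal to the γ_p and the β_p,
hence receives no correction. -/
theorem mem_weights_of_mem_MDual {x : H} (hx : x ∈ D.MDual) :
    ((x, (k : ℂ), 0) : AffDual H) ∈ D.weights k ∧ (D.wt D.n ((x, (k : ℂ), 0) : AffDual H)).1 = x := by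
  refine ⟨⟨rfl, fun y hy => ?_, form_MC_bet hx.1⟩, ?_⟩
  · rw [L] at hy
    obtain ⟨v, rfl⟩ := mem_span_iff_comb.1 hy
    have h : ∀ i, ∃ c : ℤ, D.form x (D.gam i) = c := fun i => by
      by_cases hi : (i : ℕ) < D.n
      · exact ⟨0, by rw [Int.cast_zero]; exact form_MC_gamT hx.1 ⟨i, hi⟩⟩
      · obtain ⟨c, hc⟩ := hx.2 (D.basisM ⟨i, not_lt.1 hi⟩)
          (by rw [M_eq]; exact Submodule.subset_span ⟨_, rfl⟩)
        refine ⟨c, ?_⟩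
        rw [← hc, basisM, gamStep]
        simp [form_MC_bet hx.1]
    choose c hc using h
    refine ⟨∑ i, v i * c i, ?_⟩
    rw [form_comb_right]
    push_cast
    exact Finset.sum_congr rfl fun i _ => by rw [hc, intVec]
  · rw [wt_fst]
    simp [form_MC_gamT hx.1]

section FiniteDimensional

variable [FiniteDimensional ℂ H]

theorem wt_mem_MDual (hl : l ∈ D.weights k) : (D.wt D.n l).1 ∈ D.MDual :=
  ⟨wt_mem_MC hl, fun _ hy => exists_form_wt_eq_int hl hy⟩

/-- Passing from λ to λ_n changes λ̄ by an element of M^⊥, and ℂM ∩ M^⊥ = 0. -/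
theorem congr_iff {l' : AffDual H} (hl : l ∈ D.weights k) (hl' : l' ∈ D.weights k) :
    D.Congr k l l' ↔ ∃ x ∈ D.M, (D.wt D.n l).1 - (D.wt D.n l').1 = (k : ℂ) • x := by
  constructor
  · rintro ⟨x, hx, y, hy, a, h⟩
    refine ⟨x, hx, ?_⟩
    have h1 : l.1 - l'.1 = (k : ℂ) • x + y := congrArg Prod.fst h
    have h2 : (D.wt D.n l).1 - (D.wt D.n l').1 - (k : ℂ) • x
        = ((D.wt D.n l).1 - l.1) - ((D.wt D.n l').1 - l'.1) + y := by
      rw [← sub_eq_iff_eq_add'.2 h1]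
      abel
    rw [← sub_eq_zero]
    refine eq_zero_of_mem_MC_of_mem_MPerp (D := D) (sub_mem (sub_mem (wt_mem_MC hl) (wt_mem_MC hl'))
      (D.MC.smul_mem _ (M_le_MC hx))) ?_
    rw [h2]
    exact add_mem (sub_mem (wt_sub_mem_MPerp l) (wt_sub_mem_MPerp l')) hy
  · rintro ⟨x, hx, h⟩
    refine ⟨x, hx, ((D.wt D.n l').1 - l'.1) - ((D.wt D.n l).1 - l.1),
      sub_mem (wt_sub_mem_MPerp l') (wt_sub_mem_MPerp l), l.2.2 - l'.2.2, ?_⟩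
    refine Prod.ext ?_ (Prod.ext ?_ rfl)
    · rw [← h]
      simp only [Prod.fst_sub]
      abel
    · have h1 : l.2.1 = k := hl.1
      have h2 : l'.2.1 = k := hl'.1
      simp [h1, h2]

/-- The vectors λ_n of a set of representatives represent the cosets of kM in M*. -/
theorem bijective_of_isRepresentatives (hk : 0 < k)
    (hint : ∀ x ∈ D.L, ∀ y ∈ D.L, ∃ c : ℤ, (k : ℂ) * D.form x y = c) {R : Finset (AffDual H)}
    (hR : D.IsRepresentatives k R) :
    Function.Bijective fun p : R × D.M => (⟨(D.wt D.n p.1.1).1 + (k : ℂ) • (p.2 : H),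
      add_mem (wt_mem_MDual (hR.1 p.1.2)) (smul_mem_MDual hint p.2.2)⟩ : D.MDual) := by
  have hk' : (k : ℂ) ≠ 0 := by exact_mod_cast hk.ne'
  constructor
  · rintro ⟨⟨μ, hμ⟩, g⟩ ⟨⟨ν, hν⟩, g'⟩ h
    have h1 : (D.wt D.n μ).1 + (k : ℂ) • (g : H) = (D.wt D.n ν).1 + (k : ℂ) • (g' : H) :=
      congrArg Subtype.val h
    have h2 : D.Congr k μ ν := (congr_iff (hR.1 hμ) (hR.1 hν)).2
      ⟨g' - g, sub_mem g'.2 g.2, by rw [smul_sub, sub_eq_sub_iff_add_eq_add, h1, add_comm]⟩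
    have h3 : D.Congr k μ μ := ⟨0, zero_mem _, 0, zero_mem _, 0, by simp; rfl⟩
    have h4 : μ = ν := (hR.2 μ (hR.1 hμ)).unique ⟨hμ, h3⟩ ⟨hν, h2⟩
    subst h4
    have h5 : (g : H) = g' := smul_right_injective H hk' (add_left_cancel h1)
    rw [Subtype.ext h5]
  · rintro ⟨y, hy⟩
    obtain ⟨hw, hwt⟩ := mem_weights_of_mem_MDual (k := k) hy
    obtain ⟨r, ⟨hr, hc⟩, -⟩ := hR.2 _ hw
    obtain ⟨x, hx, h⟩ := (congr_iff hw (hR.1 hr)).1 hc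
    refine ⟨(⟨r, hr⟩, ⟨x, hx⟩), Subtype.ext ?_⟩
    show (D.wt D.n r).1 + (k : ℂ) • x = y
    rw [← h, hwt, add_sub_cancel]

end FiniteDimensional

/-- The dual lattice in coordinates. -/
noncomputable def dualHom (D : Setup H) : (D.Idx D.n → ℤ) →+ H where
  toFun v := dualComb D.basisM (D.gramIdx D.n) (intVec v)
  map_zero' := by
    have : intVec (0 : D.Idx D.n → ℤ) = 0 := by ext; simp [intVec]
    rw [this, dualComb, mulVec_zero]
    simp [comb]
  map_add' v w := by
    have : intVec (v + w) = intVec v + intVec w := by ext; simp [intVec]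
    rw [this, dualComb, mulVec_add, comb_add]
    rfl

theorem dualHom_apply (v : D.Idx D.n → ℤ) :
    D.dualHom v = dualComb D.basisM (D.gramIdx D.n) (intVec v) := rfl

theorem dualHom_injective : Function.Injective D.dualHom := by
  intro v w h
  ext i
  have := congrArg (fun x => D.form (D.basisM i) x) h
  simp only [dualHom_apply, D.isGram_basisM.form_dualComb, intVec] at this
  exact_mod_cast this

/-- In dual coordinates M* is ℤ^r and kM is the image of the integral matrix k·Gram, whose index is
its determinant. -/
theorem indexM_eq (hk : 0 < k)
    (hint : ∀ x ∈ D.L, ∀ y ∈ D.L, ∃ c : ℤ, (k : ℂ) * D.form x y = c) :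
    (D.indexM k : ℝ) = (k • D.gramIdx D.n).det := by
  choose G hG using fun i j : D.Idx D.n =>
    hint (D.gam i) (Submodule.subset_span ⟨_, rfl⟩) (D.gam j) (Submodule.subset_span ⟨_, rfl⟩)
  have hG' : k • D.gramIdx D.n = (Matrix.of G).map (Int.cast : ℤ → ℝ) := by
    ext i j
    have h := hG i j
    rw [form_gam_gam] at h
    rw [Matrix.smul_apply, smul_eq_mul, map_apply, of_apply]
    exact_mod_cast h
  have hdet : (k • D.gramIdx D.n).det = ((Matrix.of G).det : ℤ) := by
    rw [hG']
    exact (Int.cast_det _).symm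
  have hpos : 0 < (Matrix.of G).det := by
    have := ((D.gramIdx_posDef D.n).smul hk).det_pos
    rw [hdet] at this
    exact_mod_cast this
  have hinj : Function.Injective (Matrix.toLin' (Matrix.of G)) :=
    Matrix.mulVec_injective_of_det_ne_zero hpos.ne'
  set N := LinearMap.range (Matrix.toLin' (Matrix.of G)) with hN
  have h1 := Submodule.natAbs_det_equiv N (LinearEquiv.ofInjective _ hinj)
  have h2 : N.subtype ∘ₗ AddMonoidHom.toIntLinearMap
      ((LinearEquiv.ofInjective (Matrix.toLin' (Matrix.of G)) hinj :
        (D.Idx D.n → ℤ) ≃ₗ[ℤ] N) : (D.Idx D.n → ℤ) →+ N) = Matrix.toLin' (Matrix.of G) := by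
    ext
    rfl
  rw [h2, LinearMap.det_toLin'] at h1
  have hMD : D.MDual = (⊤ : AddSubgroup (D.Idx D.n → ℤ)).map D.dualHom := by
    ext x
    simp [mem_MDual_iff, dualHom_apply]
  have hkM : D.kM k = N.toAddSubgroup.map D.dualHom := by
    have hv : ∀ v : D.Idx D.n → ℤ, D.dualHom (Matrix.of G *ᵥ v) = (k : ℂ) • comb D.basisM (intVec v) := by
      intro v
      rw [dualHom_apply, ← D.isGram_basisM.dualComb_mulVec, dualComb, dualComb, ← comb_smul,
        ← mulVec_smul, ← smul_mulVec]
      congr 2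
      ext i
      have h : ∀ j, (k : ℂ) * D.gramIdx D.n i j = G i j := fun j => by
        rw [← hG, form_gam_gam]
        rfl
      simp [intVec, mulVec, dotProduct, h]
    ext x
    rw [mem_kM_iff, AddSubgroup.mem_map]
    constructor
    · rintro ⟨y, hy, rfl⟩
      rw [M_eq] at hy
      obtain ⟨v, rfl⟩ := mem_span_iff_comb.1 hy
      exact ⟨_, ⟨v, rfl⟩, hv v⟩
    · rintro ⟨y, ⟨v, rfl⟩, rfl⟩
      refine ⟨comb D.basisM (intVec v), ?_, (hv v).symm⟩
      rw [M_eq]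
      exact mem_span_iff_comb.2 ⟨v, rfl⟩
  have h3 : D.indexM k = (D.kM k).relIndex D.MDual := rfl
  rw [h3, hMD, hkM, AddSubgroup.relIndex_map_map_of_injective _ _ dualHom_injective,
    AddSubgroup.relIndex_top_right, hdet]
  have h4 : N.toAddSubgroup.index = Nat.card ((D.Idx D.n → ℤ) ⧸ N) := rfl
  rw [h4, ← h1]
  rw [← Int.cast_natCast, Int.natAbs_of_nonneg hpos.le]

/-- Representatives of the finite group M*/kM, regarded as weights, represent the classes. -/
theorem exists_isRepresentatives [FiniteDimensional ℂ H] (hk : 0 < k)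
    (hint : ∀ x ∈ D.L, ∀ y ∈ D.L, ∃ c : ℤ, (k : ℂ) * D.form x y = c) :
    ∃ R, D.IsRepresentatives k R := by
  classical
  have hfin : Finite (D.MDual ⧸ (D.kM k).addSubgroupOf D.MDual) := by
    refine Nat.finite_of_card_ne_zero ?_
    have h : (D.indexM k : ℝ) ≠ 0 := by
      rw [indexM_eq hk hint]
      exact ((D.gramIdx_posDef D.n).smul hk).det_pos.ne'
    exact_mod_cast h
  have := Fintype.ofFinite (D.MDual ⧸ (D.kM k).addSubgroupOf D.MDual)
  let f : D.MDual ⧸ (D.kM k).addSubgroupOf D.MDual → AffDual H :=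
    fun c => ((c.out : D.MDual), (k : ℂ), 0)
  have hf : ∀ c, f c ∈ D.weights k ∧ (D.wt D.n (f c)).1 = (c.out : D.MDual) := fun c =>
    mem_weights_of_mem_MDual c.out.2
  have hcongr : ∀ {l} (hl : l ∈ D.weights k) c, D.Congr k l (f c) ↔
      c = QuotientAddGroup.mk ⟨(D.wt D.n l).1, wt_mem_MDual hl⟩ := by
    intro l hl c
    rw [congr_iff hl (hf c).1, (hf c).2]
    conv_rhs => rw [← QuotientAddGroup.out_eq' c]
    rw [QuotientAddGroup.eq, AddSubgroup.mem_addSubgroupOf, mem_kM_iff]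
    refine exists_congr fun x => and_congr_right fun _ => ?_
    rw [eq_comm]
    show _ ↔ _ = -(c.out : H) + (D.wt D.n l).1
    rw [neg_add_eq_sub]
  refine ⟨Finset.univ.image f, ?_, fun l hl => ?_⟩
  · intro x hx
    obtain ⟨c, -, rfl⟩ := Finset.mem_image.1 (Finset.mem_coe.1 hx)
    exact (hf c).1
  · refine ⟨f (QuotientAddGroup.mk ⟨(D.wt D.n l).1, wt_mem_MDual hl⟩),
      ⟨Finset.mem_image_of_mem _ (Finset.mem_univ _), (hcongr hl _).2 rfl⟩, ?_⟩
    rintro r ⟨hr, hc⟩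
    obtain ⟨c, -, rfl⟩ := Finset.mem_image.1 hr
    rw [(hcongr hl c).1 hc]

end Setup
theorem summable_prod_of_finite {α β : Type*} [Finite α] {f : α × β → ℂ}
    (h : ∀ a, Summable fun b => f (a, b)) : Summable f := by
  have := Fintype.ofFinite α
  refine Summable.of_norm ((summable_prod_of_nonneg fun _ => norm_nonneg _).2
    ⟨fun a => (h a).norm, ?_⟩)
  exact (hasSum_fintype _).summable

namespace Setup

variable {H : Type*} [AddCommGroup H] [Module ℂ H] {D : Setup H} {k : ℝ} {l : AffDual H}

/-! ## Transformation of the theta functions of `M` -/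

theorem tsum_M (f : H → ℂ) :
    ∑' g : D.M, f g = ∑' v : D.Idx D.n → ℤ, f (comb D.basisM (intVec v)) := by
  rw [M_eq, ← D.isGram_basisM.latticeEquiv.tsum_eq]
  rfl

theorem tsum_MDual (f : H → ℂ) : ∑' y : D.MDual, f y
    = ∑' v : D.Idx D.n → ℤ, f (dualComb D.basisM (D.gramIdx D.n) (intVec v)) := by
  let E : (D.Idx D.n → ℤ) ≃ D.MDual :=
    Equiv.ofBijective (fun v => ⟨D.dualHom v, mem_MDual_iff.2 ⟨v, rfl⟩⟩)
      ⟨fun v w h => dualHom_injective (congrArg Subtype.val h), fun y => by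
        obtain ⟨v, hv⟩ := mem_MDual_iff.1 y.2
        exact ⟨v, Subtype.ext hv⟩⟩
  rw [← E.tsum_eq]
  rfl

theorem summable_thetaTerm_M (hk : 0 < k) {τ : ℂ} (hτ : 0 < τ.im) (z x : H) :
    Summable fun g : D.M => thetaTerm D.form k τ z (x + (k : ℂ) • (g : H)) := by
  rw [M_eq]
  exact D.isGram_basisM.summable_thetaTerm D.form_comm hk hτ z x

theorem mockTheta_M_eq (hk : 0 < k) (hl : l ∈ D.weights k) (τ : ℂ) (z : H) (t : ℂ) :
    mockTheta D.form D.M (D.wt D.n l) ∅ D.bet τ z t = cexp (2 * Real.pi * I * k * t)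
      * ∑' g : D.M, thetaTerm D.form k τ z ((D.wt D.n l).1 + (k : ℂ) • (g : H)) :=
  mockTheta_empty D.form D.form_comm D.M hk ((D.level_wt D.n l).trans hl.1) D.bet τ z t

theorem mockTheta_M_add_one (hk : 0 < k)
    (heven : ∀ x ∈ D.L, ∃ c : ℤ, (k : ℂ) * D.form x x = 2 * c) (hl : l ∈ D.weights k) (τ : ℂ)
    (z : H) (t : ℂ) :
    mockTheta D.form D.M (D.wt D.n l) ∅ D.bet (τ + 1) z t
      = cexp (Real.pi * I / k * D.form l.1 l.1)
        * mockTheta D.form D.M (D.wt D.n l) ∅ D.bet τ z t := by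
  have hk' : (k : ℂ) ≠ 0 := by exact_mod_cast hk.ne'
  rw [mockTheta_M_eq hk hl, mockTheta_M_eq hk hl, mul_left_comm]
  congr 1
  rw [← tsum_mul_left]
  refine tsum_congr fun g => ?_
  obtain ⟨c, hc⟩ := exists_form_wt_eq_int hl g.2
  obtain ⟨x, hx, -, -, -, hgx⟩ := exists_mem_L_form_eq g.2 g.2
  obtain ⟨d, hd⟩ := heven x hx
  rw [← hgx] at hd
  rw [thetaTerm, thetaTerm, ← Complex.exp_add, Complex.exp_eq_exp_iff_exists_int]
  -- The exponent changes by πi|λ + kγ|²/k = πi|λ|²/k + 2πi(λ | γ) + πik|γ|², where (λ | γ) = c and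
  -- k|γ|² = 2d.
  refine ⟨c + d, ?_⟩
  simp only [map_add, map_smul, LinearMap.add_apply, LinearMap.smul_apply, smul_eq_mul,
    D.form_comm g, hc, form_wt_wt hl hl]
  push_cast
  field_simp
  linear_combination (k : ℂ) * hd

theorem summable_classes (D : Setup H) (hk : 0 < k) {τ : ℂ} (hτ : 0 < τ.im) (z : H)
    (R : Finset (AffDual H)) (c : AffDual H → ℂ) :
    Summable fun p : R × D.M =>
      c p.1 * thetaTerm D.form k τ z ((D.wt D.n p.1.1).1 + (k : ℂ) • (p.2 : H)) := by
  refine summable_prod_of_finite fun μ => ?_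
  have h := (summable_thetaTerm_M (D := D) hk hτ z (D.wt D.n μ.1).1).mul_left (c μ)
  exact h

variable [FiniteDimensional ℂ H]

theorem mockTheta_M_eq_of_isProj (hk : 0 < k) (hl : l ∈ D.weights k) {z z₁ : H}
    (h : D.IsProj z z₁) (τ t : ℂ) :
    mockTheta D.form D.M (D.wt D.n l) ∅ D.bet τ z t
      = mockTheta D.form D.M (D.wt D.n l) ∅ D.bet τ z₁ t := by
  rw [mockTheta_M_eq hk hl, mockTheta_M_eq hk hl]
  congr 1
  refine tsum_congr fun g => ?_
  rw [thetaTerm, thetaTerm,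
    h.form_eq (add_mem (wt_mem_MC hl) (D.MC.smul_mem _ (M_le_MC g.2)))]

/-- The character y ↦ e^{-2πi(λ|y)/k} is trivial on kM, hence constant on each coset. -/
theorem tsum_MDual_eq_sum (hk : 0 < k)
    (hint : ∀ x ∈ D.L, ∀ y ∈ D.L, ∃ c : ℤ, (k : ℂ) * D.form x y = c) (hl : l ∈ D.weights k)
    {R : Finset (AffDual H)} (hR : D.IsRepresentatives k R) {τ : ℂ} (hτ : 0 < τ.im) (z : H) :
    ∑' y : D.MDual, cexp (-(2 * Real.pi * I / k) * D.form (D.wt D.n l).1 y)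
        * thetaTerm D.form k τ z y
      = ∑ μ ∈ R, cexp (-(2 * Real.pi * I / k) * D.form l.1 μ.1)
        * ∑' g : D.M, thetaTerm D.form k τ z ((D.wt D.n μ).1 + (k : ℂ) • (g : H)) := by
  have hk' : (k : ℂ) ≠ 0 := by exact_mod_cast hk.ne'
  have hterm : ∀ p : R × D.M,
      cexp (-(2 * Real.pi * I / k)
          * D.form (D.wt D.n l).1 ((D.wt D.n p.1.1).1 + (k : ℂ) • (p.2 : H)))
        * thetaTerm D.form k τ z ((D.wt D.n p.1.1).1 + (k : ℂ) • (p.2 : H))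
      = cexp (-(2 * Real.pi * I / k) * D.form l.1 p.1.1.1)
        * thetaTerm D.form k τ z ((D.wt D.n p.1.1).1 + (k : ℂ) • (p.2 : H)) := by
    rintro ⟨μ, g⟩
    congr 1
    obtain ⟨c, hc⟩ := exists_form_wt_eq_int hl g.2
    rw [Complex.exp_eq_exp_iff_exists_int]
    refine ⟨-c, ?_⟩
    simp only [map_add, map_smul, smul_eq_mul, hc, form_wt_wt hl (hR.1 μ.2)]
    push_cast
    field_simp
    ring
  have hs := summable_classes D hk hτ z R fun μ => cexp (-(2 * Real.pi * I / k) * D.form l.1 μ.1)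
  let E := Equiv.ofBijective _ (bijective_of_isRepresentatives hk hint hR)
  have hE : ∀ p, (E p : H) = (D.wt D.n p.1.1).1 + (k : ℂ) • (p.2 : H) := fun _ => rfl
  rw [← E.tsum_eq]
  simp only [hE, hterm]
  rw [hs.tsum_prod, tsum_fintype, ← Finset.sum_coe_sort R]
  exact Finset.sum_congr rfl fun μ _ => by dsimp only; rw [tsum_mul_left]

/-- Jacobi inversion for the theta functions of `M`. -/
theorem mockTheta_M_neg_one_div (hk : 0 < k)
    (hint : ∀ x ∈ D.L, ∀ y ∈ D.L, ∃ c : ℤ, (k : ℂ) * D.form x y = c) (hl : l ∈ D.weights k)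
    {R : Finset (AffDual H)} (hR : D.IsRepresentatives k R) {τ : ℂ} (hτ : 0 < τ.im) (z : H)
    (t t' : ℂ) :
    mockTheta D.form D.M (D.wt D.n l) ∅ D.bet (-1 / τ) (τ⁻¹ • z) t'
      = cexp (2 * Real.pi * I * k * (t' - t)
          + Real.pi * I * k / τ * D.form (D.proj z) (D.proj z))
        * (((√(k • D.gramIdx D.n).det : ℝ) : ℂ)⁻¹ * ((-I * τ) ^ (1 / 2 : ℂ)) ^ (D.m - D.n))
        * ∑ μ ∈ R, cexp (-(2 * Real.pi * I / k) * D.form l.1 μ.1)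
          * mockTheta D.form D.M (D.wt D.n μ) ∅ D.bet τ z t := by
  obtain ⟨c, hc⟩ := mem_MC_iff.1 (wt_mem_MC hl)
  have hR' : ∀ μ ∈ R, cexp (-(2 * Real.pi * I / k) * D.form l.1 μ.1)
      * mockTheta D.form D.M (D.wt D.n μ) ∅ D.bet τ z t = cexp (2 * Real.pi * I * k * t)
        * (cexp (-(2 * Real.pi * I / k) * D.form l.1 μ.1)
          * ∑' g : D.M, thetaTerm D.form k τ z ((D.wt D.n μ).1 + (k : ℂ) • (g : H))) :=
    fun μ hμ => by rw [mockTheta_M_eq hk (hR.1 hμ), mul_left_comm]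
  rw [Finset.sum_congr rfl hR', ← Finset.mul_sum, ← tsum_MDual_eq_sum hk hint hl hR hτ,
    tsum_MDual (fun y => cexp (-(2 * Real.pi * I / k) * D.form (D.wt D.n l).1 y)
        * thetaTerm D.form k τ z y), mockTheta_M_eq hk hl,
    tsum_M (fun g => thetaTerm D.form k (-1 / τ) (τ⁻¹ • z) ((D.wt D.n l).1 + (k : ℂ) • g)), ← hc,
    D.isGram_basisM.tsum_thetaTerm_neg_one_div D.form_comm hk hτ, card_idx, Complex.exp_add,
    mul_sub, Complex.exp_sub, proj]
  field_simp

end Setup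
-- Matches the full double sum in |z|² with the triangular sums over i < p in γ̃_p.
theorem sum_sum_eq_of_symm {n : ℕ} (f : Fin n → Fin n → ℂ) (hf : ∀ i j, f i j = f j i) :
    ∑ p, ∑ i, f p i = ∑ p, (f p p + 2 * ∑ i with i < p, f p i) := by
  have h1 : ∀ p i, f p i = (if i = p then f p i else 0) + (if i < p then f p i else 0)
      + (if p < i then f p i else 0) := fun p i => by
    rcases lt_trichotomy i p with h | h | h
    · simp [h, h.ne, h.not_gt]
    · simp [h]
    · simp [h, h.ne', h.not_gt]
  have h2 : ∑ p, ∑ i, (if p < i then f p i else 0) = ∑ p, ∑ i, (if i < p then f p i else 0) := by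
    rw [Finset.sum_comm]
    exact Finset.sum_congr rfl fun i _ => Finset.sum_congr rfl fun p _ => by rw [hf]
  rw [Finset.sum_congr rfl fun p _ => Finset.sum_congr rfl fun i _ => h1 p i]
  simp only [Finset.sum_add_distrib, h2, ← Finset.mul_sum, Finset.sum_filter]
  simp
  ring

namespace Setup

variable {H : Type*} [AddCommGroup H] [Module ℂ H] {D : Setup H} {k : ℝ} {l : AffDual H}

/-! ## The rank one factors -/

theorem form_gamTilde (p : Fin D.n) (z : H) : D.form (D.gamTilde p) z
    = D.form (D.gamT p) z + ∑ i with i < p, D.form (D.gamT p) (D.gamT i) * D.form (D.bet i) z := by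
  rw [gamTilde, gamStep]
  simp [LinearMap.sum_apply, gamT]

theorem form_coroot_gamTilde_eq (p : Fin D.n) (z : H) : D.form (coroot D.form (D.gamTilde p)) z
    = D.form (coroot D.form (D.gamT p)) z
      + ∑ i with i < p, D.form (coroot D.form (D.gamT p)) (D.gamT i) * D.form (D.bet i) z := by
  rw [form_coroot_gamTilde, form_gamTilde, mul_add, Finset.mul_sum]
  simp [coroot, mul_assoc]

theorem phiFactor_eq (hk : 0 < k) (heven : ∀ x ∈ D.L, ∃ c : ℤ, (k : ℂ) * D.form x x = 2 * c)
    (hl : l ∈ D.weights k) {τ : ℂ} (hτ : 0 < τ.im) {z : H} (hz : D.OffPoles τ z) (p : Fin D.n)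
    (s : ℤ) : D.phiFactor l p τ z = PhiMod (D.deg k p) s τ (-(D.form (D.bet p) z))
      (D.form (D.bet p) z + D.form (coroot D.form (D.gamTilde p)) z) := by
  rw [phiFactor, hl.1]
  exact PhiMod_eq_of_charge (deg_eq_and_pos hk heven p).2 hτ (offLattice_of_offPoles hz p) _ _ _

theorem phiFactor_add_one (hk : 0 < k)
    (heven : ∀ x ∈ D.L, ∃ c : ℤ, (k : ℂ) * D.form x x = 2 * c) (hl : l ∈ D.weights k) {τ : ℂ}
    (hτ : 0 < τ.im) {z : H} (hz : D.OffPoles τ z) (p : Fin D.n) :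
    D.phiFactor l p (τ + 1) z = D.phiFactor l p τ z := by
  rw [phiFactor, phiFactor, hl.1]
  exact PhiMod_add_one (deg_eq_and_pos hk heven p).2 hτ (offLattice_of_offPoles hz p) _ _

/-- With degree k|γ_p|²/2, the denominator of γ̃_p^∨ cancels in the automorphy exponent of Φ̃, and a
quadratic polynomial in z remains. -/
theorem phiFactor_neg_one_div (hk : 0 < k)
    (heven : ∀ x ∈ D.L, ∃ c : ℤ, (k : ℂ) * D.form x x = 2 * c) {μ : AffDual H}
    (hl : l ∈ D.weights k) (hμ : μ ∈ D.weights k) {τ : ℂ}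
    (hτ : 0 < τ.im) {z : H} (hz : D.OffPoles τ z) (p : Fin D.n) :
    D.phiFactor l p (-1 / τ) (τ⁻¹ • z) = τ * cexp (Real.pi * I * k / τ
        * -(D.form (D.bet p) z * (D.form (D.gamT p) (D.gamT p) * D.form (D.bet p) z
          + 2 * D.form (D.gamTilde p) z))) * D.phiFactor μ p τ z := by
  obtain ⟨hdeg, hpos⟩ := deg_eq_and_pos hk heven p
  have hne := form_gamT_ne_zero p
  rw [phiFactor_eq hk heven hμ hτ hz p (D.charge l p), phiFactor, hl.1]
  have h1 : -(D.form (D.bet p) (τ⁻¹ • z)) = -(D.form (D.bet p) z) / τ := by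
    rw [map_smul, smul_eq_mul]
    ring
  have h2 : D.form (D.bet p) (τ⁻¹ • z) + D.form (coroot D.form (D.gamTilde p)) (τ⁻¹ • z)
      = (D.form (D.bet p) z + D.form (coroot D.form (D.gamTilde p)) z) / τ := by
    rw [map_smul, map_smul, smul_eq_mul, smul_eq_mul]
    ring
  rw [h1, h2, PhiMod_neg_one_div hpos hτ (offLattice_of_offPoles hz p), hdeg,
    form_coroot_gamTilde]
  congr 3
  field_simp

/-- The exponents of the automorphy factors of the rank one factors add up to
`|z|² - |z₁|²`, where `z₁` is the projection of `z` to `ℂ M`. -/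
theorem IsProj.sum_eq [FiniteDimensional ℂ H] {z z₁ : H} (h : D.IsProj z z₁) :
    ∑ p, -(D.form (D.bet p) z * (D.form (D.gamT p) (D.gamT p) * D.form (D.bet p) z
      + 2 * D.form (D.gamTilde p) z)) = D.form z z - D.form z₁ z₁ := by
  have hcancel : ∀ a b c : ℂ, a - b - c - a = -(b + c) := fun a b c => by ring
  rw [h.form_self, sum_sum_eq_of_symm
    (fun p i => D.form (D.gamT p) (D.gamT i) * D.form (D.bet p) z * D.form (D.bet i) z)
    (fun p i => by rw [D.form_comm (D.gamT p)]; ring), hcancel,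
    Finset.mul_sum, ← Finset.sum_add_distrib, ← Finset.sum_neg_distrib]
  refine Finset.sum_congr rfl fun p _ => ?_
  have : ∑ i with i < p, D.form (D.gamT p) (D.gamT i) * D.form (D.bet p) z * D.form (D.bet i) z
      = D.form (D.bet p) z * ∑ i with i < p, D.form (D.gamT p) (D.gamT i) * D.form (D.bet i) z := by
    rw [Finset.mul_sum]
    exact Finset.sum_congr rfl fun i _ => by ring
  rw [this, form_gamTilde]
  ring

theorem OffPoles.add_one {τ : ℂ} {z : H} (hz : D.OffPoles τ z) : D.OffPoles (τ + 1) z := by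
  intro p a b h
  apply hz p (a + b) b
  rw [h]
  push_cast
  ring

theorem OffPoles.neg_one_div {τ : ℂ} (hτ : 0 < τ.im) {z : H} (hz : D.OffPoles τ z) :
    D.OffPoles (-1 / τ) (τ⁻¹ • z) := by
  have hτ0 : τ ≠ 0 := fun h0 => by simp [h0] at hτ
  intro p a b h
  apply hz p (-b) a
  rw [map_smul, smul_eq_mul] at h
  field_simp at h
  rw [h]
  push_cast
  ring

/-! ## The modified mock theta functions -/

theorem modTheta_eq_mul_prod_of_isProj [FiniteDimensional ℂ H] (hk : 0 < k)
    (heven : ∀ x ∈ D.L, ∃ c : ℤ, (k : ℂ) * D.form x x = 2 * c) (hl : l ∈ D.weights k) {τ : ℂ}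
    (hτ : 0 < τ.im) {z z₁ : H} (hz : D.OffPoles τ z) (h : D.IsProj z z₁) (t : ℂ)
    (s : Fin D.n → ℤ) :
    D.modTheta l τ z t = mockTheta D.form D.M (D.wt D.n l) ∅ D.bet τ z₁ t
      * ∏ p : Fin D.n, PhiMod (D.deg k p) (s p) τ (-(D.form (D.bet p) z))
          (D.form (D.bet p) z + D.form (coroot D.form (D.gamT p)) z
            + ∑ i : Fin D.n with i < p,
              D.form (coroot D.form (D.gamT p)) (D.gamT i) * D.form (D.bet i) z) := by
  rw [modTheta_eq_mul_prod hk heven hl hτ hz, mockTheta_M_eq_of_isProj hk hl h]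
  congr 1
  refine Finset.prod_congr rfl fun p _ => ?_
  rw [phiFactor_eq hk heven hl hτ hz p (s p), form_coroot_gamTilde_eq, add_assoc]

theorem modTheta_add_one (hk : 0 < k)
    (heven : ∀ x ∈ D.L, ∃ c : ℤ, (k : ℂ) * D.form x x = 2 * c) (hl : l ∈ D.weights k) {τ : ℂ}
    (hτ : 0 < τ.im) {z : H} (hz : D.OffPoles τ z) (t : ℂ) :
    D.modTheta l (τ + 1) z t
      = cexp (Real.pi * I / k * D.form l.1 l.1) * D.modTheta l τ z t := by
  rw [modTheta_eq_mul_prod hk heven hl (by simpa using hτ) hz.add_one,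
    modTheta_eq_mul_prod hk heven hl hτ hz, mockTheta_M_add_one hk heven hl, mul_assoc]
  congr 2
  exact Finset.prod_congr rfl fun p _ => phiFactor_add_one hk heven hl hτ hz p

/-- The constant in the transformation formula. -/
theorem inversion_constant (hk : 0 < k)
    (hint : ∀ x ∈ D.L, ∀ y ∈ D.L, ∃ c : ℤ, (k : ℂ) * D.form x y = c) {τ : ℂ} (hτ : 0 < τ.im) :
    ((√(k • D.gramIdx D.n).det : ℝ) : ℂ)⁻¹ * ((-I * τ) ^ (1 / 2 : ℂ)) ^ (D.m - D.n) * τ ^ D.n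
      = I ^ D.n * (-I * τ) ^ ((Module.finrank ℂ H : ℂ) / 2) * (D.indexM k : ℂ) ^ (-(1 / 2) : ℂ) := by
  have hτ0 : τ ≠ 0 := fun h0 => by simp [h0] at hτ
  have hx0 : -I * τ ≠ 0 := mul_ne_zero (neg_ne_zero.2 I_ne_zero) hτ0
  have hindex : (D.indexM k : ℂ) ^ (-(1 / 2) : ℂ) = ((√(k • D.gramIdx D.n).det : ℝ) : ℂ)⁻¹ := by
    rw [cpow_neg, ← ofReal_cpow_half ((D.gramIdx_posDef D.n).smul hk).det_pos.le,
      ← indexM_eq hk hint, ofReal_natCast]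
  -- Since dim 𝔥 = (m - n) + 2n, the theta function of M supplies m - n square roots of -iτ, and the
  -- n factors Φ̃ supply n full powers τ = i(-iτ), hence also i^n.
  have hfin : (-I * τ) ^ ((Module.finrank ℂ H : ℂ) / 2)
      = ((-I * τ) ^ (1 / 2 : ℂ)) ^ (D.m - D.n) * (-I * τ) ^ D.n := by
    have h1 : ((Module.finrank ℂ H : ℕ) : ℂ) / 2 = (Module.finrank ℂ H : ℕ) * (1 / 2 : ℂ) := by ring
    have h2 : Module.finrank ℂ H = (D.m - D.n) + 2 * D.n := by
      rw [D.dim_eq]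
      have := D.n_le_m
      omega
    have h3 : ((-I * τ) ^ (1 / 2 : ℂ)) ^ 2 = -I * τ := by
      rw [← cpow_nat_mul]
      norm_num
    rw [h1, cpow_nat_mul, h2, pow_add, pow_mul _ 2, h3]
  have hI : τ ^ D.n = I ^ D.n * (-I * τ) ^ D.n := by
    rw [← mul_pow, ← mul_assoc, mul_neg, I_mul_I, neg_neg, one_mul]
  rw [hindex, hfin, hI]
  ring

/-- The product P of the rank one factors is common to all μ, so the sum over classes is that of the
theta function of M alone. The factor |z|² - |z⁽¹⁾|² in the exponent of P, the |z⁽¹⁾|² from the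
theta function and the shift of t cancel. -/
theorem modTheta_neg_one_div [FiniteDimensional ℂ H] (hk : 0 < k)
    (hint : ∀ x ∈ D.L, ∀ y ∈ D.L, ∃ c : ℤ, (k : ℂ) * D.form x y = c)
    (heven : ∀ x ∈ D.L, ∃ c : ℤ, (k : ℂ) * D.form x x = 2 * c) (hl : l ∈ D.weights k) {τ : ℂ}
    (hτ : 0 < τ.im) {z : H} (hz : D.OffPoles τ z) (t : ℂ) {R : Finset (AffDual H)}
    (hR : D.IsRepresentatives k R) :
    D.modTheta l (-1 / τ) (τ⁻¹ • z) (t - D.form z z / (2 * τ))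
      = I ^ D.n * (-I * τ) ^ ((Module.finrank ℂ H : ℂ) / 2) * (D.indexM k : ℂ) ^ (-(1 / 2) : ℂ)
        * ∑ μ ∈ R, cexp (-(2 * Real.pi * I / k) * D.form l.1 μ.1) * D.modTheta μ τ z t := by
  have hτ0 : τ ≠ 0 := fun h0 => by simp [h0] at hτ
  set P := ∏ p, D.phiFactor l p τ z with hP
  have h1 : ∀ μ ∈ R, cexp (-(2 * Real.pi * I / k) * D.form l.1 μ.1) * D.modTheta μ τ z t
      = cexp (-(2 * Real.pi * I / k) * D.form l.1 μ.1)
        * mockTheta D.form D.M (D.wt D.n μ) ∅ D.bet τ z t * P := fun μ hμ => by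
    rw [modTheta_eq_mul_prod hk heven (hR.1 hμ) hτ hz, ← mul_assoc, hP]
    congr 1
    refine Finset.prod_congr rfl fun p _ => ?_
    rw [phiFactor_eq hk heven (hR.1 hμ) hτ hz p 0, phiFactor_eq hk heven hl hτ hz p 0]
  have h2 : ∏ p, D.phiFactor l p (-1 / τ) (τ⁻¹ • z)
      = τ ^ D.n * cexp (Real.pi * I * k / τ * (D.form z z - D.form (D.proj z) (D.proj z))) * P := by
    rw [Finset.prod_congr rfl fun p _ => phiFactor_neg_one_div hk heven hl hl hτ hz p,
      Finset.prod_mul_distrib, Finset.prod_mul_distrib, Finset.prod_const, Finset.card_univ,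
      Fintype.card_fin, ← Complex.exp_sum, ← Finset.mul_sum, (isProj_proj z).sum_eq]
  have h3 : cexp (2 * Real.pi * I * k * (t - D.form z z / (2 * τ) - t)
      + Real.pi * I * k / τ * D.form (D.proj z) (D.proj z))
      * cexp (Real.pi * I * k / τ * (D.form z z - D.form (D.proj z) (D.proj z))) = 1 := by
    rw [← Complex.exp_add, ← Complex.exp_zero]
    congr 1
    field_simp
    ring
  rw [modTheta_eq_mul_prod hk heven hl (neg_one_div_im_pos hτ) (hz.neg_one_div hτ),
    mockTheta_M_neg_one_div hk hint hl hR hτ z t, h2, Finset.sum_congr rfl h1, ← Finset.sum_mul,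
    ← inversion_constant hk hint hτ]
  linear_combination (((√(k • D.gramIdx D.n).det : ℝ) : ℂ)⁻¹
    * ((-I * τ) ^ (1 / 2 : ℂ)) ^ (D.m - D.n) * τ ^ D.n
    * (∑ μ ∈ R, cexp (-(2 * Real.pi * I / k) * D.form l.1 μ.1)
      * mockTheta D.form D.M (D.wt D.n μ) ∅ D.bet τ z t) * P) * h3

end Setup
end MockTheta

theorem proposition3p2 {H : Type*} [AddCommGroup H] [Module ℂ H] [FiniteDimensional ℂ H]
    (D : MockTheta.Setup H) (k : ℝ) (hk : 0 < k)
    -- the form `k (· | ·)` is integral on `L`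
    (hint : ∀ x ∈ D.L, ∀ y ∈ D.L, ∃ c : ℤ, (k : ℂ) * D.form x y = c)
    -- every element of `L` is even for `k`
    (heven : ∀ x ∈ D.L, ∃ c : ℤ, (k : ℂ) * D.form x x = 2 * c) :
    -- the weights of level `k` fall into finitely many classes
    (∃ R, D.IsRepresentatives k R) ∧
    ∀ l ∈ D.weights k, ∀ (τ : ℂ) (z : H) (t : ℂ), 0 < τ.im → D.OffPoles τ z →
      -- factorization; the functions `Φ̃^{[m;s]}` do not depend on `s`
      ((∃! z₁, D.IsProj z z₁) ∧ ∀ z₁, D.IsProj z z₁ → ∀ s : Fin D.n → ℤ,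
        D.modTheta l τ z t =
          MockTheta.mockTheta D.form D.M (D.wt D.n l) ∅ D.bet τ z₁ t *
            ∏ p : Fin D.n, MockTheta.PhiMod (D.deg k p) (s p) τ (-(D.form (D.bet p) z))
              (D.form (D.bet p) z + D.form (MockTheta.coroot D.form (D.gamT p)) z
                + ∑ i : Fin D.n with i < p,
                  D.form (MockTheta.coroot D.form (D.gamT p)) (D.gamT i)
                    * D.form (D.bet i) z)) ∧
      -- transformation under `S`
      (∀ R, D.IsRepresentatives k R →
        D.modTheta l (-1 / τ) (τ⁻¹ • z) (t - D.form z z / (2 * τ)) =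
          Complex.I ^ D.n * (-Complex.I * τ) ^ ((Module.finrank ℂ H : ℂ) / 2)
            * (D.indexM k : ℂ) ^ (-(1 / 2) : ℂ)
            * ∑ μ ∈ R, Complex.exp (-(2 * Real.pi * Complex.I / k) * D.form l.1 μ.1)
                * D.modTheta μ τ z t) ∧
      -- transformation under `T`
      D.modTheta l (τ + 1) z t =
        Complex.exp (Real.pi * Complex.I / k * D.form l.1 l.1) * D.modTheta l τ z t := by
  refine ⟨MockTheta.Setup.exists_isRepresentatives hk hint,
    fun l hl τ z t hτ hz => ⟨⟨?_, ?_⟩, ?_, ?_⟩⟩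
  · exact MockTheta.Setup.existsUnique_isProj z
  · exact fun z₁ h s => MockTheta.Setup.modTheta_eq_mul_prod_of_isProj hk heven hl hτ hz h t s
  · exact fun R hR => MockTheta.Setup.modTheta_neg_one_div hk hint heven hl hτ hz t hR
  · exact MockTheta.Setup.modTheta_add_one hk heven hl hτ hz t
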